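/- Let $d\ge 1$, let $\Omega\subset\mathbb R^d$ be a bounded Lipschitz domain (open, connected, non-empty), let $p\in\mathbb N_0$, and let $\alpha,\beta,\sigma,\tau$ be real numbers. There are constants $C_0,C>0$, depending only on $d,\Omega,p,\alpha,\beta,\sigma,\tau$, such that the following holds. Let $A\in L^\infty(\Omega)$ be a scalar coefficient with $0<\alpha\le A\le\beta$ almost everywhere, and let $\mathcal T_H$ be a conforming decomposition of $\Omega$ into finitely many $d$-rectangles $K=\prod_{i=1}^d[a_i^K,b_i^K]$: they cover $\overline\Omega$, their interiors are disjoint, and any two that meet do so in a common face. Let $\mathcal T_H$ be shape regular and quasi-uniform, that is, $\operatorname{diam}K\le\sigma\,(b_i^K-a_i^K)$ for all $K$ and $i$, and $H:=\max_{K}\operatorname{diam}K\le\tau\operatorname{diam}K$ for all $K$. Let $\Pi_H$ be the $L^2(\Omega)$-orthogonal projection onto the space of functions that are on every $K\in\mathcal T_H$ a polynomial of degree at most $p$ in each variable, and let $W=\{w\in H^1_0(\Omega):\Pi_Hw=0\}$. For $S\subset\overline\Omega$ let $W(S)$ be the set of $w\in W$ that vanish almost everywhere outside $S$, let $\mathtt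 N^1(S)=\mathtt N(S)$ be the union of the elements $K\in\mathcal T_H$ with $K\cap\overline S\ne\emptyset$, and let $\mathtt N^{\ell}(S)=\mathtt N(\mathtt N^{\ell-1}(S))$ for $\ell\ge2$. For $G\in\mathcal T_H$, $v\in L^2(\Omega)$ and an integer $\lambda_G\ge1$, let $\mathcal D_G^{[\lambda_G]}v\in W(\mathtt N^{\lambda_G}(G))$ and $\mathcal D_Gv\in W$ be the unique solutions of $$\int_{\mathtt N^{\lambda_G}(G)}A\,\nabla\mathcal D_G^{[\lambda_G]}v\cdot\nabla w\,dx=-\int_G v\,w\,dx\quad\text{for all }w\in W(\mathtt N^{\lambda_G}(G)),$$ $$\int_{\Omega}A\,\nabla\mathcal D_Gv\cdot\nabla w\,dx=-\int_G v\,w\,dx\quad\text{for all }w\in W.$$ Then $$\|\nabla(\mathcal D_G^{[\lambda_G]}v-\mathcal D_Gv)\|_{L^2(\Omega)}\le C_0\,e^{-C\lambda_G}\,\|\nabla\mathcal D_Gv\|_{L^2(\Omega)}.$$ -/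

import Mathlib

open MeasureTheory Set Filter Topology
open scoped ContDiff Gradient

noncomputable section

namespace LOD

/-! ### Domains and meshes -/

/-- A bounded Lipschitz domain: non-empty, open, connected, bounded, and near every boundary point,
after a rotation that turns the unit vector `e` into the vertical direction, the set is the strict
epigraph of a Lipschitz function of the horizontal component `y - ⟪e, y⟫ e`. -/
structure IsLipschitzDomain {d : ℕ} (Ω : Set (EuclideanSpace ℝ (Fin d))) : Prop where
  isOpen : IsOpen Ω
  isConnected : IsConnected Ω
  isBounded : Bornology.IsBounded Ω
  lipschitz_boundary : ∀ x ∈ frontier Ω, ∃ e : EuclideanSpace ℝ (Fin d), ‖e‖ = 1 ∧ ∃ r > 0,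
    ∃ (L : NNReal) (f : EuclideanSpace ℝ (Fin d) → ℝ), LipschitzWith L f ∧
      ∀ y ∈ Metric.ball x r, y ∈ Ω ↔ f (y - inner ℝ e y • e) < inner ℝ e y

/-- The closed `d`-rectangle `∏ [aᵢ, bᵢ]` as a subset of Euclidean space. -/
def cell {d : ℕ} (K : BoxIntegral.Box (Fin d)) : Set (EuclideanSpace ℝ (Fin d)) :=
  {x | ∀ i, x i ∈ Icc (K.lower i) (K.upper i)}

/-- `F` is a face (of any dimension, `K` itself included) of the closed rectangle `K`. -/
def IsFace {d : ℕ} (F : Set (EuclideanSpace ℝ (Fin d))) (K : BoxIntegral.Box (Fin d)) : Prop :=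
  ∃ s : Fin d → Set ℝ,
    (∀ i, s i = {K.lower i} ∨ s i = {K.upper i} ∨ s i = Icc (K.lower i) (K.upper i)) ∧
    F = {x | ∀ i, x i ∈ s i}

/-- A regular (conforming) decomposition of `Ω` into finitely many `d`-rectangles: the closed
rectangles cover the closure of `Ω`, they have disjoint interiors, and two of them that meet
do so in a common face. -/
structure Mesh {d : ℕ} (Ω : Set (EuclideanSpace ℝ (Fin d))) where
  cells : Finset (BoxIntegral.Box (Fin d))
  iUnion_cell : ⋃ K ∈ cells, cell K = closure Ω
  disjoint_interior : ∀ K ∈ cells, ∀ K' ∈ cells, K ≠ K' →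
    Disjoint (interior (cell K)) (interior (cell K'))
  conforming : ∀ K ∈ cells, ∀ K' ∈ cells, (cell K ∩ cell K').Nonempty →
    IsFace (cell K ∩ cell K') K ∧ IsFace (cell K ∩ cell K') K'

variable {d : ℕ} {Ω : Set (EuclideanSpace ℝ (Fin d))}

/-- Shape regularity with constant `σ`: the diameter of every element is at most `σ` times the
diameter of its largest inscribed ball, that is, at most `σ` times each of its side lengths. -/
def Mesh.IsShapeRegular (T : Mesh Ω) (σ : ℝ) : Prop :=
  ∀ K ∈ T.cells, ∀ i, Metric.diam (cell K) ≤ σ * (K.upper i - K.lower i)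

/-- Quasi-uniformity with constant `τ`: the mesh size `H`, which is the largest diameter of an
element, is at most `τ` times the diameter of every element. -/
def Mesh.IsQuasiUniform (T : Mesh Ω) (τ : ℝ) : Prop :=
  ∀ K ∈ T.cells, ∀ K' ∈ T.cells, Metric.diam (cell K') ≤ τ * Metric.diam (cell K)

/-- The patch `N(S)`: the union of all closed elements that meet the closure of `S`. -/
def Mesh.nbhd (T : Mesh Ω) (S : Set (EuclideanSpace ℝ (Fin d))) :
    Set (EuclideanSpace ℝ (Fin d)) :=
  ⋃ K ∈ {K | K ∈ T.cells ∧ (closure S ∩ cell K).Nonempty}, cell K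

/-- The patch `N^ℓ(S)` of order `ℓ`, with `N^0(S)` the closure of `S`. -/
def Mesh.patch (T : Mesh Ω) (S : Set (EuclideanSpace ℝ (Fin d))) :
    ℕ → Set (EuclideanSpace ℝ (Fin d))
  | 0 => closure S
  | ℓ + 1 => T.nbhd (T.patch S ℓ)

theorem isClosed_cell (K : BoxIntegral.Box (Fin d)) : IsClosed (cell K) := by
  simp only [cell, mem_Icc, ofPred_forall, ofPred_and]
  refine isClosed_iInter fun i => IsClosed.inter ?_ ?_
  · exact isClosed_le continuous_const (by fun_prop)
  · exact isClosed_le (by fun_prop) continuous_const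

theorem Mesh.isClosed_patch (T : Mesh Ω) (S : Set (EuclideanSpace ℝ (Fin d))) (ℓ : ℕ) :
    IsClosed (T.patch S ℓ) := by
  cases ℓ with
  | zero => exact isClosed_closure
  | succ ℓ =>
    refine Set.Finite.isClosed_biUnion ?_ fun K _ => isClosed_cell K
    exact T.cells.finite_toSet.subset fun K hK => hK.1

/-! ### Function spaces -/

/-- `L²(Ω)`. -/
abbrev L2 (Ω : Set (EuclideanSpace ℝ (Fin d))) : Type :=
  Lp ℝ 2 (volume.restrict Ω)

/-- `L²(Ω; ℝᵈ)`. -/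
abbrev L2Vec (Ω : Set (EuclideanSpace ℝ (Fin d))) : Type :=
  Lp (EuclideanSpace ℝ (Fin d)) 2 (volume.restrict Ω)

theorem memLp_gradient {φ : EuclideanSpace ℝ (Fin d) → ℝ} (h : ContDiff ℝ ∞ φ)
    (hc : HasCompactSupport φ) (μ : Measure (EuclideanSpace ℝ (Fin d)))
    [IsFiniteMeasureOnCompacts μ] : MemLp (∇ φ) 2 μ := by
  have h1 : Continuous (∇ φ) := (InnerProductSpace.toDual ℝ _).symm.continuous.comp
    (h.continuous_fderiv (by simp))
  refine h1.memLp_of_hasCompactSupport ?_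
  exact (hc.fderiv ℝ).comp_left (g := (InnerProductSpace.toDual ℝ _).symm) (map_zero _)

/-- The pairs `(φ, ∇φ)` in `L²(Ω) × L²(Ω; ℝᵈ)`, where `φ` is a smooth function with compact support
in `Ω`. The norm of `WithLp 2` is the norm `(‖φ‖² + ‖∇φ‖²)^(1/2)` of `H¹(Ω)`. -/
def testGraph (Ω : Set (EuclideanSpace ℝ (Fin d))) :
    Submodule ℝ (WithLp 2 (L2 Ω × L2Vec Ω)) where
  carrier := {u | ∃ φ : EuclideanSpace ℝ (Fin d) → ℝ, ContDiff ℝ ∞ φ ∧ HasCompactSupport φ ∧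
    tsupport φ ⊆ Ω ∧ u.fst =ᵐ[volume.restrict Ω] φ ∧ u.snd =ᵐ[volume.restrict Ω] ∇ φ}
  zero_mem' := by
    refine ⟨0, contDiff_const, HasCompactSupport.zero, by simp [tsupport], ?_, ?_⟩
    · exact Lp.coeFn_zero ..
    · have : ∇ (0 : EuclideanSpace ℝ (Fin d) → ℝ) = 0 := by
        funext x; simp [gradient]
      rw [this]; exact Lp.coeFn_zero ..
  add_mem' := by
    rintro u v ⟨φ, h1, h2, h3, h4, h5⟩ ⟨ψ, k1, k2, k3, k4, k5⟩
    refine ⟨φ + ψ, h1.add k1, h2.add k2, (tsupport_add φ ψ).trans (union_subset h3 k3), ?_, ?_⟩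
    · exact (Lp.coeFn_add _ _).trans (h4.add k4)
    · have : ∇ (φ + ψ) = ∇ φ + ∇ ψ := by
        funext x
        simp only [gradient, Pi.add_apply]
        rw [fderiv_add (h1.differentiable (by simp) x) (k1.differentiable (by simp) x), map_add]
      rw [this]; exact (Lp.coeFn_add _ _).trans (h5.add k5)
  smul_mem' := by
    rintro c u ⟨φ, h1, h2, h3, h4, h5⟩
    refine ⟨c • φ, contDiff_const.smul h1, h2.smul_left (f := fun _ => c),
      (closure_mono (Function.support_const_smul_subset c φ)).trans h3, ?_, ?_⟩
    · exact (Lp.coeFn_smul _ _).trans (h4.const_smul c)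
    · have : ∇ (c • φ) = c • ∇ φ := by
        funext x
        simp only [gradient, Pi.smul_apply]
        rw [fderiv_const_smul (h1.differentiable (by simp) x)]; simp
      rw [this]; exact (Lp.coeFn_smul _ _).trans (h5.const_smul c)

/-- The Sobolev space `H¹₀(Ω)`, the closure of the smooth functions with compact support in `Ω` with
respect to the norm of `H¹(Ω)`. An element `u` is stored with its weak gradient:
`u.1.fst` is the function and `u.1.snd` is its weak gradient. -/
def H10 (Ω : Set (EuclideanSpace ℝ (Fin d))) : Submodule ℝ (WithLp 2 (L2 Ω × L2Vec Ω)) :=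
  (testGraph Ω).topologicalClosure

/-- The `L²` function underlying an element of `H¹₀(Ω)`. -/
def H10.toL2 : H10 Ω →L[ℝ] L2 Ω :=
  (WithLp.fstL 2 ℝ (L2 Ω) (L2Vec Ω)).comp (H10 Ω).subtypeL

/-- The weak gradient of an element of `H¹₀(Ω)`. -/
def H10.grad : H10 Ω →L[ℝ] L2Vec Ω :=
  (WithLp.sndL 2 ℝ (L2 Ω) (L2Vec Ω)).comp (H10 Ω).subtypeL

/-- The space `V_H` of functions in `L²(Ω)` that are on every element of the mesh
a polynomial of partial degree at most `p`. -/
def Mesh.polySpace (T : Mesh Ω) (p : ℕ) : Submodule ℝ (L2 Ω) where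
  carrier := {v | ∀ K ∈ T.cells, ∃ q ∈ MvPolynomial.restrictDegree (Fin d) ℝ p,
    ∀ᵐ x ∂(volume.restrict Ω), x ∈ cell K → v x = MvPolynomial.eval (fun i => x i) q}
  zero_mem' := fun K _ => ⟨0, Submodule.zero_mem _, by
    filter_upwards [Lp.coeFn_zero ℝ 2 (volume.restrict Ω)] with x hx _
    rw [hx]; simp⟩
  add_mem' := by
    intro u v hu hv K hK
    obtain ⟨q, hq, h⟩ := hu K hK
    obtain ⟨q', hq', h'⟩ := hv K hK
    refine ⟨q + q', Submodule.add_mem _ hq hq', ?_⟩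
    filter_upwards [h, h', Lp.coeFn_add u v] with x h1 h2 h3 hx
    rw [h3, Pi.add_apply, h1 hx, h2 hx, map_add]
  smul_mem' := by
    intro c u hu K hK
    obtain ⟨q, hq, h⟩ := hu K hK
    refine ⟨c • q, Submodule.smul_mem _ c hq, ?_⟩
    filter_upwards [h, Lp.coeFn_smul c u] with x h1 h3 hx
    rw [h3, Pi.smul_apply, h1 hx, MvPolynomial.smul_eval, smul_eq_mul]

instance finiteDimensional_restrictDegree (p : ℕ) :
    FiniteDimensional ℝ (MvPolynomial.restrictDegree (Fin d) ℝ p) := by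
  have : Finite {n : Fin d →₀ ℕ | ∀ i, n i ≤ p} := by
    refine Set.Finite.subset (Set.finite_Iic (Finsupp.equivFunOnFinite.symm fun _ => p)) ?_
    intro n hn i
    simpa using hn i
  exact Module.Finite.of_basis (MvPolynomial.basisRestrictSupport ℝ {n : Fin d →₀ ℕ | ∀ i, n i ≤ p})

instance Mesh.finiteDimensional_polySpace (T : Mesh Ω) (p : ℕ) :
    FiniteDimensional ℝ (T.polySpace p) := by
  let ae' : T.cells → Filter (EuclideanSpace ℝ (Fin d)) := fun K =>
    ae ((volume.restrict Ω).restrict (cell K.1))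
  let P : ∀ K : T.cells, MvPolynomial.restrictDegree (Fin d) ℝ p →ₗ[ℝ] Germ (ae' K) ℝ :=
    fun K =>
    { toFun := fun q => ((fun x => MvPolynomial.eval (fun i => x i) q.1 :
        EuclideanSpace ℝ (Fin d) → ℝ) : Germ (ae' K) ℝ)
      map_add' := by
        intro q q'
        rw [← Germ.coe_add]; congr 1; funext x; simp
      map_smul' := by
        intro c q
        rw [RingHom.id_apply, ← Germ.coe_smul]; congr 1; funext x; simp [MvPolynomial.smul_eval] }
  have hmem : ∀ (v : T.polySpace p) (K : T.cells),
      ((v.1 : EuclideanSpace ℝ (Fin d) → ℝ) : Germ (ae' K) ℝ) ∈ LinearMap.range (P K) := by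
    intro v K
    obtain ⟨q, hq, h⟩ := v.2 K.1 K.2
    refine ⟨⟨q, hq⟩, Germ.coe_eq.2 ?_⟩
    have := (ae_restrict_iff' (μ := volume.restrict Ω) (isClosed_cell K.1).measurableSet).2 h
    filter_upwards [this] with x hx using hx.symm
  let F : T.polySpace p →ₗ[ℝ] ∀ K : T.cells, LinearMap.range (P K) :=
    { toFun := fun v K => ⟨_, hmem v K⟩
      map_add' := by
        intro u v
        funext K
        refine Subtype.ext (Germ.coe_eq.2 ?_)
        exact ae_restrict_of_ae (Lp.coeFn_add u.1 v.1)
      map_smul' := by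
        intro c u
        funext K
        refine Subtype.ext (Germ.coe_eq.2 ?_)
        exact ae_restrict_of_ae (Lp.coeFn_smul c u.1) }
  refine Module.Finite.of_injective F ?_
  rw [← LinearMap.ker_eq_bot, LinearMap.ker_eq_bot']
  intro v hv
  have h0 : ∀ K ∈ T.cells, ∀ᵐ x ∂(volume.restrict Ω), x ∈ cell K → v.1 x = 0 := by
    intro K hK
    have := congrArg Subtype.val (congrFun hv ⟨K, hK⟩)
    exact (ae_restrict_iff' (isClosed_cell K).measurableSet).1 (Germ.coe_eq.1 this)
  have hc : ∀ᵐ x ∂(volume.restrict Ω), x ∈ closure Ω :=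
    ae_mono (Measure.restrict_mono subset_closure le_rfl)
      (ae_restrict_mem isClosed_closure.measurableSet)
  have h1 : ∀ᵐ x ∂(volume.restrict Ω), ∀ K ∈ T.cells, x ∈ cell K → v.1 x = 0 :=
    (Filter.eventually_all_finset T.cells).2 h0
  refine Subtype.ext (Lp.ext ?_)
  filter_upwards [hc, h1, Lp.coeFn_zero ℝ 2 (volume.restrict Ω)] with x hx h2 h3
  rw [← T.iUnion_cell] at hx
  obtain ⟨K, hK, hxK⟩ := mem_iUnion₂.1 hx
  rw [h2 K hK hxK]
  exact h3.symm

/-- The `L²`-orthogonal projection `Π_H` of `L²(Ω)` onto `V_H`. -/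
def Mesh.proj (T : Mesh Ω) (p : ℕ) : L2 Ω →L[ℝ] L2 Ω :=
  (T.polySpace p).starProjection

/-- The space `W`, the kernel of `Π_H` in `H¹₀(Ω)`. -/
def Mesh.kerProj (T : Mesh Ω) (p : ℕ) : Submodule ℝ (H10 Ω) :=
  LinearMap.ker ((T.proj p).comp H10.toL2).toLinearMap

/-- The space `W(S)` of the functions in `W` with support in `S`. -/
def Mesh.kerProjOn (T : Mesh Ω) (p : ℕ) (S : Set (EuclideanSpace ℝ (Fin d))) :
    Submodule ℝ (H10 Ω) where
  carrier := {w | w ∈ T.kerProj p ∧ ∀ᵐ x ∂(volume.restrict Ω), x ∉ S → H10.toL2 w x = 0}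
  zero_mem' := by
    refine ⟨Submodule.zero_mem _, ?_⟩
    rw [map_zero]
    filter_upwards [Lp.coeFn_zero ℝ 2 (volume.restrict Ω)] with x hx _
    rw [hx]; rfl
  add_mem' := by
    rintro u v ⟨hu, hu'⟩ ⟨hv, hv'⟩
    refine ⟨Submodule.add_mem _ hu hv, ?_⟩
    rw [map_add]
    filter_upwards [hu', hv', Lp.coeFn_add (H10.toL2 u) (H10.toL2 v)] with x h1 h2 h3 hx
    rw [h3, Pi.add_apply, h1 hx, h2 hx, add_zero]
  smul_mem' := by
    rintro c u ⟨hu, hu'⟩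
    refine ⟨Submodule.smul_mem _ c hu, ?_⟩
    rw [map_smul]
    filter_upwards [hu', Lp.coeFn_smul c (H10.toL2 u)] with x h1 h3 hx
    rw [h3, Pi.smul_apply, h1 hx, smul_zero]

/-- A scalar coefficient `A ∈ L^∞(Ω)` with `0 < α ≤ A ≤ β < ∞` almost everywhere. -/
structure Coefficient (Ω : Set (EuclideanSpace ℝ (Fin d))) (α β : ℝ) where
  toFun : EuclideanSpace ℝ (Fin d) → ℝ
  aestronglyMeasurable : AEStronglyMeasurable toFun (volume.restrict Ω)
  pos : 0 < α
  bounds : ∀ᵐ x ∂(volume.restrict Ω), α ≤ toFun x ∧ toFun x ≤ β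

/-- The form `a_S(u, w) = (A ∇u, ∇w)` in `L²(S)`. -/
def Coefficient.form {α β : ℝ} (A : Coefficient Ω α β) (S : Set (EuclideanSpace ℝ (Fin d)))
    (u w : H10 Ω) : ℝ :=
  ∫ x in S, A.toFun x * inner ℝ (H10.grad u x) (H10.grad w x) ∂(volume.restrict Ω)

/-- `z ∈ W(S)` solves `a_S(z, w) = -(v, w)_{L²(G)}` for all `w ∈ W(S)`. -/
def IsEnrichedCorrection {α β : ℝ} (A : Coefficient Ω α β) (T : Mesh Ω) (p : ℕ)
    (S : Set (EuclideanSpace ℝ (Fin d))) (G : BoxIntegral.Box (Fin d)) (v : L2 Ω)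
    (z : H10 Ω) : Prop :=
  z ∈ T.kerProjOn p S ∧ ∀ w ∈ T.kerProjOn p S,
    A.form S z w = -∫ x in cell G, v x * H10.toL2 w x ∂(volume.restrict Ω)

/-! ### Well-posedness of the corrector problems -/

theorem inner_gradient (φ : EuclideanSpace ℝ (Fin d) → ℝ) (x e : EuclideanSpace ℝ (Fin d)) :
    inner ℝ (∇ φ x) e = fderiv ℝ φ x e := by
  simp [gradient]

theorem setIntegral_eq_of_ae {f g : EuclideanSpace ℝ (Fin d) → ℝ}
    (h : f =ᵐ[volume.restrict Ω] g) (h0 : ∀ x, x ∉ Ω → g x = 0) :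
    ∫ x, f x ∂(volume.restrict Ω) = ∫ x, g x :=
  (integral_congr_ae h).trans (setIntegral_eq_integral_of_forall_compl_eq_zero h0)

/-- Integration by parts: `u.1.snd` is the weak gradient of the extension of `u` by zero. -/
theorem H10.integral_weak_grad (u : H10 Ω) {ψ : EuclideanSpace ℝ (Fin d) → ℝ}
    (hψ : ContDiff ℝ ∞ ψ) (hc : HasCompactSupport ψ) (e : EuclideanSpace ℝ (Fin d)) :
    ∫ x, ψ x * inner ℝ (H10.grad u x) e ∂(volume.restrict Ω) =
      -∫ x, H10.toL2 u x * fderiv ℝ ψ x e ∂(volume.restrict Ω) := by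
  have m1 : MemLp (fun x => ψ x • e) 2 (volume.restrict Ω) :=
    (hψ.continuous.smul continuous_const).memLp_of_hasCompactSupport (hc.smul_right)
  have hcont : Continuous fun x => fderiv ℝ ψ x e :=
    (hψ.continuous_fderiv (by simp)).clm_apply continuous_const
  have hcs : HasCompactSupport fun x => fderiv ℝ ψ x e :=
    (hc.fderiv ℝ).comp_left (g := fun l : EuclideanSpace ℝ (Fin d) →L[ℝ] ℝ => l e) rfl
  have m2 : MemLp (fun x => fderiv ℝ ψ x e) 2 (volume.restrict Ω) :=
    hcont.memLp_of_hasCompactSupport hcs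
  have e1 : ∀ g : L2Vec Ω, ∫ x, ψ x * inner ℝ (g x) e ∂(volume.restrict Ω) =
      inner ℝ g (m1.toLp _) := by
    intro g
    rw [L2.inner_def]
    refine integral_congr_ae ?_
    filter_upwards [m1.coeFn_toLp] with x hx
    rw [hx, inner_smul_right]
  have e2 : ∀ g : L2 Ω, ∫ x, g x * fderiv ℝ ψ x e ∂(volume.restrict Ω) =
      inner ℝ g (m2.toLp _) := by
    intro g
    rw [L2.inner_def]
    refine integral_congr_ae ?_
    filter_upwards [m2.coeFn_toLp] with x hx
    rw [hx]; simp [mul_comm]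
  have key : ∀ x ∈ (testGraph Ω).topologicalClosure,
      (inner ℝ x.snd (m1.toLp _) : ℝ) = -inner ℝ x.fst (m2.toLp _) := by
    intro x hx
    have hclosed : IsClosed {x : WithLp 2 (L2 Ω × L2Vec Ω) |
        (inner ℝ x.snd (m1.toLp _) : ℝ) = -inner ℝ x.fst (m2.toLp _)} :=
      isClosed_eq ((WithLp.sndL 2 ℝ (L2 Ω) (L2Vec Ω)).continuous.inner continuous_const)
        ((WithLp.fstL 2 ℝ (L2 Ω) (L2Vec Ω)).continuous.inner continuous_const).neg
    refine closure_minimal ?_ hclosed hx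
    rintro y ⟨φ, h1, h2, h3, h4, h5⟩
    change (inner ℝ y.snd (m1.toLp _) : ℝ) = -inner ℝ y.fst (m2.toLp _)
    rw [← e1, ← e2]
    have i1 : ∫ x, ψ x * inner ℝ (y.snd x) e ∂(volume.restrict Ω) =
        ∫ x, ψ x * fderiv ℝ φ x e := by
      refine setIntegral_eq_of_ae ?_ ?_
      · filter_upwards [h5] with x hx
        rw [hx, inner_gradient]
      · intro x hx
        have : x ∉ tsupport (fderiv ℝ φ) := fun h => hx (h3 (tsupport_fderiv_subset (𝕜 := ℝ) h))
        rw [image_eq_zero_of_notMem_tsupport this]; simp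
    have i2 : ∫ x, y.fst x * fderiv ℝ ψ x e ∂(volume.restrict Ω) =
        ∫ x, φ x * fderiv ℝ ψ x e := by
      refine setIntegral_eq_of_ae ?_ ?_
      · filter_upwards [h4] with x hx
        rw [hx]
      · intro x hx
        have : x ∉ tsupport φ := fun h => hx (h3 h)
        rw [image_eq_zero_of_notMem_tsupport this]; simp
    rw [i1, i2]
    have hcont' : Continuous fun x => fderiv ℝ φ x e :=
      (h1.continuous_fderiv (by simp)).clm_apply continuous_const
    have := integral_mul_fderiv_eq_neg_fderiv_mul_of_integrable
      (μ := (volume : Measure (EuclideanSpace ℝ (Fin d)))) (f := ψ) (g := φ) (v := e)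
      ((hcont.mul h1.continuous).integrable_of_hasCompactSupport h2.mul_left)
      ((hψ.continuous.mul hcont').integrable_of_hasCompactSupport hc.mul_right)
      ((hψ.continuous.mul h1.continuous).integrable_of_hasCompactSupport hc.mul_right)
      (fun x _ => hψ.differentiable (by simp) x) (fun x _ => h1.differentiable (by simp) x)
    rw [this]
    simp only [mul_comm]
  rw [e1, e2]
  exact key u.1 u.2

/-- The weak gradient of a function that vanishes outside of a closed set vanishes there, too. -/
theorem H10.grad_eq_zero (u : H10 Ω) {S : Set (EuclideanSpace ℝ (Fin d))} (hS : IsClosed S)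
    (h : ∀ᵐ x ∂(volume.restrict Ω), x ∉ S → H10.toL2 u x = 0) :
    ∀ᵐ x ∂(volume.restrict Ω), x ∉ S → H10.grad u x = 0 := by
  have hi : ∀ i : Fin d, ∀ᵐ x ∂(volume.restrict Ω), x ∈ Sᶜ →
      inner ℝ (H10.grad u x) (EuclideanSpace.single i (1 : ℝ)) = 0 := by
    intro i
    have hloc : LocallyIntegrable (fun x => inner ℝ (H10.grad u x)
        (EuclideanSpace.single i (1 : ℝ))) (volume.restrict Ω) :=
      ((Lp.memLp (H10.grad u)).inner_const _).locallyIntegrable (by norm_num)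
    refine hS.isOpen_compl.ae_eq_zero_of_integral_contDiff_smul_eq_zero
      (hloc.locallyIntegrableOn _) ?_
    intro ψ hψ hc hsub
    simp only [smul_eq_mul]
    rw [H10.integral_weak_grad u hψ hc, neg_eq_zero]
    refine integral_eq_zero_of_ae ?_
    filter_upwards [h] with x hx
    by_cases hxS : x ∈ S
    · have : x ∉ tsupport (fderiv ℝ ψ) := fun h => (hsub (tsupport_fderiv_subset (𝕜 := ℝ) h)) hxS
      rw [image_eq_zero_of_notMem_tsupport this]; simp
    · rw [hx hxS]; simp
  filter_upwards [ae_all_iff.2 hi] with x hx hxS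
  ext i
  have := hx i hxS
  simpa [EuclideanSpace.inner_single_right] using this

theorem friedrichs_aux [NeZero d] {R : ℝ} (hR0 : 0 < R) (hR : ∀ x ∈ Ω, ‖x‖ ≤ R)
    {φ : EuclideanSpace ℝ (Fin d) → ℝ} (h1 : ContDiff ℝ ∞ φ) (h2 : HasCompactSupport φ)
    (h3 : tsupport φ ⊆ Ω) :
    ∫ x, φ x ^ 2 ≤ (2 * R) ^ 2 * ∫ x, ‖fderiv ℝ φ x‖ ^ 2 := by
  obtain ⟨e, he⟩ : ∃ e : EuclideanSpace ℝ (Fin d), ‖e‖ = 1 :=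
    ⟨EuclideanSpace.single 0 1, by simp⟩
  obtain ⟨ξ, hξ⟩ : ∃ ξ : EuclideanSpace ℝ (Fin d) →L[ℝ] ℝ, ∀ x, ξ x = inner ℝ e x :=
    ⟨innerSL ℝ e, fun x => rfl⟩
  have hξe : ξ e = 1 := by rw [hξ, real_inner_self_eq_norm_sq, he, one_pow]
  have hd : ∀ x, fderiv ℝ (fun x => φ x ^ 2) x e = 2 * φ x * fderiv ℝ φ x e := by
    intro x
    have := ((h1.differentiable (by simp) x).hasFDerivAt.pow 2).fderiv
    rw [this]; simp
  have hcont' : Continuous fun x => fderiv ℝ φ x e :=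
    (h1.continuous_fderiv (by simp)).clm_apply continuous_const
  have hsq : HasCompactSupport fun x => φ x ^ 2 :=
    h2.comp_left (g := fun t : ℝ => t ^ 2) (by simp)
  have hcsq : Continuous fun x => φ x ^ 2 := h1.continuous.pow 2
  have isq : Integrable (fun x => φ x ^ 2) (volume : Measure (EuclideanSpace ℝ (Fin d))) :=
    hcsq.integrable_of_hasCompactSupport hsq
  have ifd : Integrable (fun x => ‖fderiv ℝ φ x‖ ^ 2)
      (volume : Measure (EuclideanSpace ℝ (Fin d))) := by
    have c1 : Continuous fun x => ‖fderiv ℝ φ x‖ ^ 2 :=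
      (h1.continuous_fderiv (by simp)).norm.pow 2
    refine c1.integrable_of_hasCompactSupport ((h2.fderiv (𝕜 := ℝ)).mono ?_)
    intro x hx hx'
    exact hx (by simp [hx'])
  have ib : Integrable (fun x => ξ x * (2 * φ x * fderiv ℝ φ x e))
      (volume : Measure (EuclideanSpace ℝ (Fin d))) := by
    have c1 : Continuous (fun x => ξ x * (2 * φ x * fderiv ℝ φ x e)) :=
      ξ.continuous.mul ((continuous_const.mul h1.continuous).mul hcont')
    refine c1.integrable_of_hasCompactSupport (h2.mono ?_)
    intro x hx hx'
    exact hx (by simp [hx'])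
  have ia : Integrable (fun x => ξ x * φ x ^ 2)
      (volume : Measure (EuclideanSpace ℝ (Fin d))) := by
    refine (ξ.continuous.mul hcsq).integrable_of_hasCompactSupport (h2.mono ?_)
    intro x hx hx'
    exact hx (by simp [hx'])
  have ipart := integral_mul_fderiv_eq_neg_fderiv_mul_of_integrable
      (μ := (volume : Measure (EuclideanSpace ℝ (Fin d)))) (f := ξ) (g := fun x => φ x ^ 2)
      (v := e) (by simp only [ContinuousLinearMap.fderiv, hξe, one_mul]; exact isq)
      (by
        simp only [hd]
        exact ib)
      ia
      (fun x _ => ξ.differentiableAt)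
      (fun x _ => (h1.differentiable (by simp) x).pow 2)
  simp only [hd, ContinuousLinearMap.fderiv, hξe, one_mul] at ipart
  have i2 : Integrable (fun x => φ x ^ 2 / 2)
      (volume : Measure (EuclideanSpace ℝ (Fin d))) := isq.div_const 2
  have i3 : Integrable (fun x => 2 * R ^ 2 * ‖fderiv ℝ φ x‖ ^ 2)
      (volume : Measure (EuclideanSpace ℝ (Fin d))) := ifd.const_mul (2 * R ^ 2)
  have ir : Integrable (fun x => φ x ^ 2 / 2 + 2 * R ^ 2 * ‖fderiv ℝ φ x‖ ^ 2)
      (volume : Measure (EuclideanSpace ℝ (Fin d))) := i2.add i3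
  have hle : ∫ x, φ x ^ 2 ≤ ∫ x, (φ x ^ 2 / 2 + 2 * R ^ 2 * ‖fderiv ℝ φ x‖ ^ 2) := by
    have : ∫ x, φ x ^ 2 = ∫ x, -(ξ x * (2 * φ x * fderiv ℝ φ x e)) := by
      rw [integral_neg, ipart, neg_neg]
    rw [this]
    have ic : Integrable (fun x => -(ξ x * (2 * φ x * fderiv ℝ φ x e)))
        (volume : Measure (EuclideanSpace ℝ (Fin d))) := ib.neg
    have pw : ∀ x, -(ξ x * (2 * φ x * fderiv ℝ φ x e)) ≤
        φ x ^ 2 / 2 + 2 * R ^ 2 * ‖fderiv ℝ φ x‖ ^ 2 := by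
      intro x
      by_cases hx : x ∈ Ω
      · have b1 : |ξ x| ≤ R := by
          have := abs_real_inner_le_norm e x
          rw [he, one_mul] at this
          rw [hξ]
          exact this.trans (hR x hx)
        have b2 : |fderiv ℝ φ x e| ≤ ‖fderiv ℝ φ x‖ := by
          have := (fderiv ℝ φ x).le_opNorm e
          rwa [he, mul_one] at this
        have b3 : |ξ x * fderiv ℝ φ x e| ≤ R * ‖fderiv ℝ φ x‖ := by
          rw [abs_mul]
          exact mul_le_mul b1 b2 (abs_nonneg _) hR0.le
        have b4 : (ξ x * fderiv ℝ φ x e) ^ 2 ≤ (R * ‖fderiv ℝ φ x‖) ^ 2 :=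
          sq_le_sq' (by linarith [neg_abs_le (ξ x * fderiv ℝ φ x e)])
            ((le_abs_self _).trans b3)
        nlinarith [sq_nonneg (φ x + 2 * (ξ x * fderiv ℝ φ x e))]
      · have : x ∉ tsupport φ := fun h => hx (h3 h)
        rw [image_eq_zero_of_notMem_tsupport this]
        have : 0 ≤ 2 * R ^ 2 * ‖fderiv ℝ φ x‖ ^ 2 := by positivity
        simpa using this
    exact integral_mono ic ir pw
  rw [integral_add i2 i3, integral_div, integral_const_mul] at hle
  linarith

/-- The Friedrichs inequality. -/
theorem H10.norm_le_grad [NeZero d] (hb : Bornology.IsBounded Ω) :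
    ∃ R : ℝ, 0 ≤ R ∧ ∀ u : H10 Ω, ‖H10.toL2 u‖ ≤ R * ‖H10.grad u‖ := by
  obtain ⟨R, hR0, hR⟩ := hb.exists_pos_norm_le
  refine ⟨2 * R, by positivity, ?_⟩
  suffices h : ∀ x ∈ (testGraph Ω).topologicalClosure, ‖x.fst‖ ≤ 2 * R * ‖x.snd‖ from
    fun u => h u.1 u.2
  intro x hx
  have hclosed : IsClosed {x : WithLp 2 (L2 Ω × L2Vec Ω) | ‖x.fst‖ ≤ 2 * R * ‖x.snd‖} :=
    isClosed_le (WithLp.fstL 2 ℝ (L2 Ω) (L2Vec Ω)).continuous.norm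
      (continuous_const.mul (WithLp.sndL 2 ℝ (L2 Ω) (L2Vec Ω)).continuous.norm)
  refine closure_minimal ?_ hclosed hx
  rintro y ⟨φ, h1, h2, h3, h4, h5⟩
  change ‖y.fst‖ ≤ 2 * R * ‖y.snd‖
  have n1 : ‖y.fst‖ ^ 2 = ∫ x, φ x ^ 2 := by
    rw [← real_inner_self_eq_norm_sq, L2.inner_def]
    refine setIntegral_eq_of_ae ?_ ?_
    · filter_upwards [h4] with x hx
      rw [hx]; simp [sq]
    · intro x hx
      have : x ∉ tsupport φ := fun h => hx (h3 h)
      rw [image_eq_zero_of_notMem_tsupport this]; simp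
  have n2 : ‖y.snd‖ ^ 2 = ∫ x, ‖fderiv ℝ φ x‖ ^ 2 := by
    rw [← real_inner_self_eq_norm_sq, L2.inner_def]
    refine setIntegral_eq_of_ae ?_ ?_
    · filter_upwards [h5] with x hx
      rw [hx, real_inner_self_eq_norm_sq]; simp [gradient]
    · intro x hx
      have : x ∉ tsupport (fderiv ℝ φ) := fun h => hx (h3 (tsupport_fderiv_subset (𝕜 := ℝ) h))
      rw [image_eq_zero_of_notMem_tsupport this]; simp
  have := friedrichs_aux hR0 hR h1 h2 h3
  rw [← n1, ← n2, ← mul_pow] at this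
  exact le_of_sq_le_sq this (by positivity)

theorem Mesh.isBounded (T : Mesh Ω) : Bornology.IsBounded Ω := by
  refine Bornology.IsBounded.subset ?_ (subset_closure (s := Ω))
  rw [← T.iUnion_cell]
  refine (Bornology.isBounded_biUnion_finset T.cells).2 fun K _ => ?_
  have h : cell K = WithLp.ofLp ⁻¹' (BoxIntegral.Box.Icc K) := by
    ext x; simp [cell, BoxIntegral.Box.Icc_def, Pi.le_def, forall_and]
  rw [h]
  exact (PiLp.antilipschitzWith_ofLp 2 _).isBounded_preimage K.isBounded_Icc

theorem Mesh.isClosed_kerProjOn (T : Mesh Ω) (p : ℕ) {S : Set (EuclideanSpace ℝ (Fin d))}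
    (hS : IsClosed S) : IsClosed (T.kerProjOn p S : Set (H10 Ω)) := by
  have h1 : IsClosed {w : H10 Ω | T.proj p (H10.toL2 w) = 0} :=
    isClosed_eq ((T.proj p).continuous.comp H10.toL2.continuous) continuous_const
  let r : L2 Ω →L[ℝ] Lp ℝ 2 ((volume.restrict Ω).restrict Sᶜ) :=
    LpToLpRestrictCLM (EuclideanSpace ℝ (Fin d)) ℝ ℝ (volume.restrict Ω) 2 Sᶜ
  have h2 : IsClosed {w : H10 Ω | r (H10.toL2 w) = 0} :=
    isClosed_eq (r.continuous.comp H10.toL2.continuous) continuous_const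
  convert h1.inter h2 using 1
  ext w
  refine and_congr Iff.rfl ?_
  change _ ↔ r (H10.toL2 w) = 0
  rw [Lp.eq_zero_iff_ae_eq_zero]
  have h3 := LpToLpRestrictCLM_coeFn (X := EuclideanSpace ℝ (Fin d)) (F := ℝ) ℝ
    (p := 2) (μ := volume.restrict Ω) Sᶜ (H10.toL2 w)
  change _ ↔ ∀ᵐ x ∂((volume.restrict Ω).restrict Sᶜ), r (H10.toL2 w) x = 0
  have h4 : (∀ᵐ x ∂((volume.restrict Ω).restrict Sᶜ), r (H10.toL2 w) x = 0) ↔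
      ∀ᵐ x ∂((volume.restrict Ω).restrict Sᶜ), H10.toL2 w x = 0 :=
    eventually_congr (h3.mono fun x hx => by rw [hx])
  rw [h4, ae_restrict_iff' hS.isOpen_compl.measurableSet]
  rfl

section form

variable {α β : ℝ} (A : Coefficient Ω α β) (S : Set (EuclideanSpace ℝ (Fin d)))

theorem Coefficient.integrable_form (u w : H10 Ω) :
    Integrable (fun x => A.toFun x * inner ℝ (H10.grad u x) (H10.grad w x))
      (volume.restrict Ω) := by
  refine (L2.integrable_inner (𝕜 := ℝ) (H10.grad u) (H10.grad w)).bdd_mul (c := max |α| |β|)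
    A.aestronglyMeasurable ?_
  filter_upwards [A.bounds] with x hx
  exact abs_le_max_abs_abs hx.1 hx.2

theorem Coefficient.form_comm (u w : H10 Ω) : A.form S u w = A.form S w u := by
  unfold Coefficient.form
  exact integral_congr_ae (Eventually.of_forall fun x => by
    change _ * _ = _ * _
    rw [real_inner_comm])

theorem Coefficient.form_add (u u' w : H10 Ω) :
    A.form S (u + u') w = A.form S u w + A.form S u' w := by
  unfold Coefficient.form
  rw [← integral_add (A.integrable_form u w).integrableOn (A.integrable_form u' w).integrableOn,
    map_add]
  refine integral_congr_ae (ae_restrict_of_ae ?_)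
  filter_upwards [Lp.coeFn_add (H10.grad u) (H10.grad u')] with x hx
  rw [hx, Pi.add_apply, inner_add_left, mul_add]

theorem Coefficient.form_smul (c : ℝ) (u w : H10 Ω) :
    A.form S (c • u) w = c * A.form S u w := by
  unfold Coefficient.form
  rw [← integral_const_mul, map_smul]
  refine integral_congr_ae (ae_restrict_of_ae ?_)
  filter_upwards [Lp.coeFn_smul c (H10.grad u)] with x hx
  rw [hx, Pi.smul_apply, inner_smul_left]
  simp only [conj_trivial]
  ring

theorem Coefficient.form_self_nonneg (u : H10 Ω) : 0 ≤ A.form S u u := by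
  refine integral_nonneg_of_ae (ae_restrict_of_ae ?_)
  filter_upwards [A.bounds] with x hx
  exact mul_nonneg (A.pos.le.trans hx.1) real_inner_self_nonneg

theorem Coefficient.form_self_le (u : H10 Ω) : A.form S u u ≤ β * ‖H10.grad u‖ ^ 2 := by
  rw [← real_inner_self_eq_norm_sq, L2.inner_def, ← integral_const_mul]
  have hi := A.integrable_form u u
  have hj : Integrable (fun x => β * inner ℝ (H10.grad u x) (H10.grad u x))
      (volume.restrict Ω) := (L2.integrable_inner (𝕜 := ℝ) _ _).const_mul β
  refine (setIntegral_le_integral hi ?_).trans (integral_mono_ae hi hj ?_)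
  · filter_upwards [A.bounds] with x hx
    exact mul_nonneg (A.pos.le.trans hx.1) real_inner_self_nonneg
  · filter_upwards [A.bounds] with x hx
    exact mul_le_mul_of_nonneg_right hx.2 real_inner_self_nonneg

theorem Coefficient.le_form_self (u : H10 Ω) (hS : IsClosed S)
    (h : ∀ᵐ x ∂(volume.restrict Ω), x ∉ S → H10.toL2 u x = 0) :
    α * ‖H10.grad u‖ ^ 2 ≤ A.form S u u := by
  have hi := A.integrable_form u u
  have hj : Integrable (fun x => α * inner ℝ (H10.grad u x) (H10.grad u x))
      (volume.restrict Ω) := (L2.integrable_inner (𝕜 := ℝ) _ _).const_mul α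
  have : A.form S u u =
      ∫ x, A.toFun x * inner ℝ (H10.grad u x) (H10.grad u x) ∂(volume.restrict Ω) := by
    refine setIntegral_eq_integral_of_ae_compl_eq_zero ?_
    filter_upwards [H10.grad_eq_zero u hS h] with x hx hxS
    rw [hx hxS]; simp
  rw [this, ← real_inner_self_eq_norm_sq, L2.inner_def, ← integral_const_mul]
  refine integral_mono_ae hj hi ?_
  filter_upwards [A.bounds] with x hx
  exact mul_le_mul_of_nonneg_right hx.1 real_inner_self_nonneg

end form

/-- The form `a_S` as a bilinear map. -/
def Coefficient.bilinForm {α β : ℝ} (A : Coefficient Ω α β)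
    (S : Set (EuclideanSpace ℝ (Fin d))) : LinearMap.BilinForm ℝ (H10 Ω) :=
  LinearMap.mk₂ ℝ (A.form S) (A.form_add S) (fun c u w => A.form_smul S c u w)
    (fun u w w' => by
      rw [A.form_comm S u, A.form_add, A.form_comm S w, A.form_comm S w'])
    (fun c u w => by
      rw [A.form_comm S u, A.form_smul, A.form_comm S w]; rfl)

theorem H10.norm_sq (u : H10 Ω) : ‖u‖ ^ 2 = ‖H10.toL2 u‖ ^ 2 + ‖H10.grad u‖ ^ 2 :=
  WithLp.prod_norm_sq_eq_of_L2 u.1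

theorem Coefficient.abs_form_le {α β : ℝ} (A : Coefficient Ω α β)
    (S : Set (EuclideanSpace ℝ (Fin d))) (u w : H10 Ω) :
    |A.form S u w| ≤ |β| * ‖u‖ * ‖w‖ := by
  have hb : ∀ u : H10 Ω, A.form S u u ≤ |β| * ‖u‖ ^ 2 := fun u =>
    (A.form_self_le S u).trans (mul_le_mul (le_abs_self β)
      (by rw [H10.norm_sq u]; linarith [sq_nonneg ‖H10.toL2 u‖]) (by positivity) (abs_nonneg β))
  have hcs : A.form S u w * A.form S w u ≤ A.form S u u * A.form S w w :=
    LinearMap.BilinForm.apply_mul_apply_le_of_forall_zero_le (A.bilinForm S)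
      (A.form_self_nonneg S) u w
  rw [A.form_comm S w u] at hcs
  refine abs_le_of_sq_le_sq ?_ (by positivity)
  calc A.form S u w ^ 2 ≤ A.form S u u * A.form S w w := by rw [sq]; exact hcs
    _ ≤ (|β| * ‖u‖ ^ 2) * (|β| * ‖w‖ ^ 2) :=
        mul_le_mul (hb u) (hb w) (A.form_self_nonneg S w) (by positivity)
    _ = (|β| * ‖u‖ * ‖w‖) ^ 2 := by ring

theorem exists_rhs (G : BoxIntegral.Box (Fin d)) (v : L2 Ω) :
    ∃ F : H10 Ω →L[ℝ] ℝ, ∀ w, F w =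
      -∫ x in cell G, v x * H10.toL2 w x ∂(volume.restrict Ω) := by
  let r : L2 Ω →L[ℝ] Lp ℝ 2 ((volume.restrict Ω).restrict (cell G)) :=
    LpToLpRestrictCLM (EuclideanSpace ℝ (Fin d)) ℝ ℝ (volume.restrict Ω) 2 (cell G)
  refine ⟨-((innerSL ℝ (r v)).comp (r.comp H10.toL2)), fun w => ?_⟩
  change -(inner ℝ (r v) (r (H10.toL2 w)) : ℝ) = _
  rw [L2.inner_def]
  congr 1
  refine integral_congr_ae ?_
  have h3 := fun g : L2 Ω => LpToLpRestrictCLM_coeFn (X := EuclideanSpace ℝ (Fin d)) (F := ℝ) ℝ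
    (p := 2) (μ := volume.restrict Ω) (cell G) g
  filter_upwards [h3 v, h3 (H10.toL2 w)] with x h1 h2
  change inner ℝ (r v x) (r (H10.toL2 w) x) = _
  rw [h1, h2]
  simp [mul_comm]

instance : CompleteSpace (H10 Ω) :=
  (Submodule.isClosed_topologicalClosure (testGraph Ω)).completeSpace_coe

theorem existsUnique_of_coercive {E : Type*} [NormedAddCommGroup E] [InnerProductSpace ℝ E]
    (V : Submodule ℝ E) [CompleteSpace V] (a : LinearMap.BilinForm ℝ E) {M c : ℝ}
    (hM : ∀ u w, |a u w| ≤ M * ‖u‖ * ‖w‖) (hc : 0 < c) (hcoer : ∀ u ∈ V, c * ‖u‖ * ‖u‖ ≤ a u u)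
    (F : E →L[ℝ] ℝ) : ∃! z, z ∈ V ∧ ∀ w ∈ V, a z w = F w := by
  let B : V →L[ℝ] V →L[ℝ] ℝ :=
    LinearMap.mkContinuous₂ (a.compl₁₂ V.subtype V.subtype) M (fun u w => hM u.1 w.1)
  have hB : ∀ u w : V, B u w = a u.1 w.1 := fun u w => rfl
  have hBc : IsCoercive B := ⟨c, hc, fun u => hcoer u.1 u.2⟩
  let f : V := (InnerProductSpace.toDual ℝ V).symm (F.comp V.subtypeL)
  let z : V := hBc.continuousLinearEquivOfBilin.symm f
  have hz : ∀ w : V, a z.1 w.1 = F w.1 := by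
    intro w
    rw [← hB, ← hBc.continuousLinearEquivOfBilin_apply]
    simp only [z, ContinuousLinearEquiv.apply_symm_apply]
    simp [f]
  refine ⟨z.1, ⟨z.2, fun w hw => hz ⟨w, hw⟩⟩, ?_⟩
  rintro y ⟨hy, hy'⟩
  have hyz : y - z.1 ∈ V := V.sub_mem hy z.2
  have h5 := hcoer _ hyz
  rw [LinearMap.map_sub₂, hy' _ hyz, hz ⟨_, hyz⟩, sub_self] at h5
  by_contra hne
  have : 0 < ‖y - z.1‖ := norm_pos_iff.2 (sub_ne_zero.2 hne)
  have : 0 < c * ‖y - z.1‖ * ‖y - z.1‖ := by positivity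
  linarith

theorem existsUnique_enrichedCorrection [NeZero d] {α β : ℝ} (A : Coefficient Ω α β) (T : Mesh Ω)
    (p : ℕ) {S : Set (EuclideanSpace ℝ (Fin d))} (hS : IsClosed S)
    (G : BoxIntegral.Box (Fin d)) (v : L2 Ω) :
    ∃! z, IsEnrichedCorrection A T p S G v z := by
  have hV : CompleteSpace (T.kerProjOn p S) := (T.isClosed_kerProjOn p hS).completeSpace_coe
  obtain ⟨R, hR0, hR⟩ := H10.norm_le_grad (Ω := Ω) T.isBounded
  obtain ⟨F, hF⟩ := exists_rhs G v
  have h := existsUnique_of_coercive (T.kerProjOn p S) (A.bilinForm S) (A.abs_form_le S)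
    (div_pos A.pos (by positivity : 0 < R ^ 2 + 1)) (fun u hu => ?_) F
  · simp only [hF] at h
    exact h
  · have h1 := A.le_form_self S u hS hu.2
    have h2 := H10.norm_sq u
    have h3 : ‖H10.toL2 u‖ ^ 2 ≤ (R * ‖H10.grad u‖) ^ 2 :=
      pow_le_pow_left₀ (norm_nonneg _) (hR u) 2
    refine le_trans ?_ h1
    have h4 : ‖u‖ * ‖u‖ ≤ (R ^ 2 + 1) * ‖H10.grad u‖ ^ 2 := by
      rw [← sq, h2]
      nlinarith
    rw [mul_assoc, div_mul_eq_mul_div, div_le_iff₀ (by positivity)]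
    nlinarith [A.pos]

/-- The localized element-wise enriched correction operator `D_G^[ℓ]`: the unique
`D_G^[ℓ] v ∈ W(N^ℓ(G))` with `a_{N^ℓ(G)}(D_G^[ℓ] v, w) = -(v, w)_{L²(G)}` for all
`w ∈ W(N^ℓ(G))`. -/
def localEnrichedCorrector [NeZero d] {α β : ℝ} (A : Coefficient Ω α β) (T : Mesh Ω) (p : ℕ)
    (G : BoxIntegral.Box (Fin d)) (ℓ : ℕ) (v : L2 Ω) : H10 Ω :=
  (existsUnique_enrichedCorrection A T p (T.isClosed_patch (cell G) ℓ) G v).choose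

theorem localEnrichedCorrector_spec [NeZero d] {α β : ℝ} (A : Coefficient Ω α β) (T : Mesh Ω)
    (p : ℕ) (G : BoxIntegral.Box (Fin d)) (ℓ : ℕ) (v : L2 Ω) :
    IsEnrichedCorrection A T p (T.patch (cell G) ℓ) G v (localEnrichedCorrector A T p G ℓ v) :=
  (existsUnique_enrichedCorrection A T p (T.isClosed_patch (cell G) ℓ) G v).choose_spec.1

/-- The global element-wise enriched correction operator `D_G`, whose patch is the whole domain:
the unique `D_G v ∈ W` with `a(D_G v, w) = -(v, w)_{L²(G)}` for all `w ∈ W`. -/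
def enrichedCorrector [NeZero d] {α β : ℝ} (A : Coefficient Ω α β) (T : Mesh Ω) (p : ℕ)
    (G : BoxIntegral.Box (Fin d)) (v : L2 Ω) : H10 Ω :=
  (existsUnique_enrichedCorrection A T p (isClosed_closure (s := Ω)) G v).choose

theorem enrichedCorrector_spec [NeZero d] {α β : ℝ} (A : Coefficient Ω α β) (T : Mesh Ω) (p : ℕ)
    (G : BoxIntegral.Box (Fin d)) (v : L2 Ω) :
    IsEnrichedCorrection A T p (closure Ω) G v (enrichedCorrector A T p G v) :=
  (existsUnique_enrichedCorrection A T p (isClosed_closure (s := Ω)) G v).choose_spec.1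

end LOD

end

namespace LOD

variable {d : ℕ} {Ω : Set (EuclideanSpace ℝ (Fin d))}

/-! ### Geometry of the mesh -/

/-! Write z for the global corrector D_G v. Outside G it solves a homogeneous problem in W. Its
energy outside the patch of order k therefore decays geometrically in k, and the local corrector,
being a Galerkin approximation of z, inherits this decay.

The engine is `exists_localization`. It turns z into some w in W that vanishes on a prescribed set I
of elements and agrees with z on the elements that do not meet I. On each single element the energy
of w is at most a constant times that of z, with a constant independent of the mesh size. The
product μz with a cutoff μ (`exists_cutoff`, `H10.exists_mul`) has the right support but leaves W,
since its polynomial moments need not vanish. Subtracting a combination of bubbles with the same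
moments on every element (`exists_corrector`) repairs this. Where μz is 0 or z, the moments are
already zero and so is the correction; hence it does not spread. The gradient of μ and the gradients
of the bubbles both cost a factor 1/h. That factor is recovered from the Poincaré inequality
(`H10.poincare`), because functions in W have mean zero on every element.

Decay is a hole-filling argument (`energy_outside_le`). Let R_k be the energy of z outside the patch
of order k, and localize with I equal to that patch. Since w vanishes on G, testing the equation of
z with w gives a(z, w) = 0. Elements beyond order k + 1 contribute at least α R_{k+1}, and the layer
between contributes at least -const (R_k - R_{k+1}). Thus R_{k+1} ≤ θ R_k with θ < 1 independent of
k and of the mesh.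

For the conclusion, `norm_grad_sub_sq_le` is Céa's lemma for W(N^ℓ(G)) inside W. With ℓ = k + 1, the
competitor z - w is supported in N^ℓ(G), and its error is w, whose energy is at most a constant
times R_k.

The geometric input is conformity. In each coordinate, touching elements are adjacent or aligned
(`Mesh.adjacent_or_aligned`). This bounds the number of neighbours by 3^d and lets the cutoff
respect the adjacency of elements rather than their mere distance. -/

theorem cell_eq_preimage (K : BoxIntegral.Box (Fin d)) :
    cell K = (EuclideanSpace.equiv (Fin d) ℝ).toHomeomorph ⁻¹'
      (Set.univ.pi fun i => Icc (K.lower i) (K.upper i)) := by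
  ext x
  simp only [cell, mem_preimage, Set.mem_pi, mem_univ, true_imp_iff]
  rfl

theorem interior_cell (K : BoxIntegral.Box (Fin d)) :
    interior (cell K) = {x | ∀ i, x i ∈ Ioo (K.lower i) (K.upper i)} := by
  rw [cell_eq_preimage, ← Homeomorph.preimage_interior, interior_pi_set finite_univ]
  ext x; simp

theorem convex_cell (K : BoxIntegral.Box (Fin d)) : Convex ℝ (cell K) := by
  intro x hx y hy a b ha hb hab i
  exact convex_Icc _ _ (hx i) (hy i) ha hb hab

theorem nonempty_interior_cell (K : BoxIntegral.Box (Fin d)) : (interior (cell K)).Nonempty := by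
  rw [interior_cell]
  choose f hf using fun i => nonempty_Ioo.2 (K.lower_lt_upper i)
  exact ⟨WithLp.toLp 2 f, hf⟩

theorem closure_interior_cell (K : BoxIntegral.Box (Fin d)) :
    closure (interior (cell K)) = cell K := by
  rw [(convex_cell K).closure_interior_eq_closure_of_nonempty_interior (nonempty_interior_cell K),
    (isClosed_cell K).closure_eq]

theorem measurableSet_cell (K : BoxIntegral.Box (Fin d)) : MeasurableSet (cell K) :=
  (isClosed_cell K).measurableSet

theorem isBounded_cell (K : BoxIntegral.Box (Fin d)) : Bornology.IsBounded (cell K) := by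
  have h : cell K = WithLp.ofLp ⁻¹' (BoxIntegral.Box.Icc K) := by
    ext x; simp [cell, BoxIntegral.Box.Icc_def, Pi.le_def, forall_and]
  rw [h]
  exact (PiLp.antilipschitzWith_ofLp 2 _).isBounded_preimage K.isBounded_Icc

/-- An open set that misses the interior of K' also misses the closure of that interior, which is
all of K'. -/
theorem Mesh.disjoint_interior_cell (T : Mesh Ω) {K K' : BoxIntegral.Box (Fin d)}
    (hK : K ∈ T.cells) (hK' : K' ∈ T.cells) (h : K ≠ K') :
    Disjoint (interior (cell K)) (cell K') := by
  rw [← closure_interior_cell K']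
  exact (T.disjoint_interior K hK K' hK' h).closure_right isOpen_interior

/-- The overlap lies in the boundary of the convex set K, and boundaries of convex sets are null. -/
theorem Mesh.volume_cell_inter (T : Mesh Ω) {K K' : BoxIntegral.Box (Fin d)}
    (hK : K ∈ T.cells) (hK' : K' ∈ T.cells) (h : K ≠ K') : volume (cell K ∩ cell K') = 0 := by
  refine measure_mono_null ?_ ((convex_cell K).addHaar_frontier volume)
  rintro x ⟨hx, hx'⟩
  refine ⟨subset_closure hx, fun hi => ?_⟩
  exact Set.disjoint_left.1 (T.disjoint_interior_cell hK hK' h) hi hx'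

theorem Mesh.ae_unique_cell (T : Mesh Ω) {K K' : BoxIntegral.Box (Fin d)}
    (hK : K ∈ T.cells) (hK' : K' ∈ T.cells) (h : K ≠ K') :
    ∀ᵐ x ∂(volume.restrict Ω), x ∈ cell K → x ∉ cell K' := by
  refine ae_restrict_of_ae ?_
  rw [ae_iff]
  refine measure_mono_null ?_ (T.volume_cell_inter hK hK' h)
  intro x hx
  simpa using hx

theorem Mesh.exists_cell (T : Mesh Ω) {x : EuclideanSpace ℝ (Fin d)} (hx : x ∈ Ω) :
    ∃ K ∈ T.cells, x ∈ cell K := by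
  have := subset_closure hx
  rw [← T.iUnion_cell] at this
  simpa using this

theorem ae_mem_of_isOpen (hΩ : IsOpen Ω) : ∀ᵐ x ∂(volume.restrict Ω), x ∈ Ω :=
  ae_restrict_mem hΩ.measurableSet

theorem Mesh.integral_eq_sum (T : Mesh Ω) (hΩ : IsOpen Ω) {f : EuclideanSpace ℝ (Fin d) → ℝ}
    (hf : Integrable f (volume.restrict Ω)) :
    ∫ x, f x ∂(volume.restrict Ω) = ∑ K ∈ T.cells, ∫ x in cell K, f x ∂(volume.restrict Ω) := by
  have h1 : ∫ x, f x ∂(volume.restrict Ω) =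
      ∫ x in ⋃ K : T.cells, cell K.1, f x ∂(volume.restrict Ω) := by
    refine (setIntegral_eq_integral_of_ae_compl_eq_zero ?_).symm
    filter_upwards [ae_mem_of_isOpen hΩ] with x hx hxn
    obtain ⟨K, hK, hxK⟩ := T.exists_cell hx
    exact absurd (mem_iUnion.2 ⟨⟨K, hK⟩, hxK⟩) hxn
  rw [h1, integral_iUnion_ae (s := fun K : T.cells => cell K.1)
    (fun K => (measurableSet_cell K.1).nullMeasurableSet) ?_
    hf.integrableOn, tsum_fintype, Finset.sum_coe_sort T.cells
      fun K => ∫ x in cell K, f x ∂(volume.restrict Ω)]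
  intro K K' h
  exact le_antisymm ((Measure.restrict_le_self _).trans
    (T.volume_cell_inter K.2 K'.2 (fun e => h (Subtype.ext e))).le) zero_le

/-- Two elements that meet are, in every coordinate direction, adjacent or aligned. -/
theorem Mesh.adjacent_or_aligned (T : Mesh Ω) {K K' : BoxIntegral.Box (Fin d)}
    (hK : K ∈ T.cells) (hK' : K' ∈ T.cells) (h : (cell K ∩ cell K').Nonempty) (i : Fin d) :
    K'.upper i = K.lower i ∨ K'.lower i = K.upper i ∨
      (K'.lower i = K.lower i ∧ K'.upper i = K.upper i) := by
  obtain ⟨⟨s, hs, hF⟩, ⟨s', hs', hF'⟩⟩ := T.conforming K hK K' hK' h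
  obtain ⟨x₀, hx₀⟩ := h
  -- Moving only the coordinate i of a common point x₀ reads off the factor in direction i of a
  -- product set. Applied to the common face, this identifies s i and s' i with the intersection of
  -- the two intervals.
  have upd : ∀ (S : Fin d → Set ℝ), (∀ j, x₀ j ∈ S j) → ∀ t,
      ((WithLp.toLp 2 (Function.update (WithLp.ofLp x₀) i t) : EuclideanSpace ℝ (Fin d)) ∈
        {x : EuclideanSpace ℝ (Fin d) | ∀ j, x j ∈ S j}) ↔ t ∈ S i := by
    intro S hS t
    constructor
    · intro H
      simpa using H i
    · intro H j
      by_cases hj : j = i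
      · subst hj; simpa using H
      · simpa [hj] using hS j
  have key : ∀ t, t ∈ s i ↔ t ∈ Icc (K.lower i) (K.upper i) ∩ Icc (K'.lower i) (K'.upper i) := by
    intro t
    have h1 : ∀ j, x₀ j ∈ s j := by rw [hF] at hx₀; exact hx₀
    rw [← upd s h1, ← hF, mem_inter_iff, mem_inter_iff]
    exact and_congr (upd (fun j => Icc (K.lower j) (K.upper j)) hx₀.1 t)
      (upd (fun j => Icc (K'.lower j) (K'.upper j)) hx₀.2 t)
  have key' : ∀ t, t ∈ s' i ↔
      t ∈ Icc (K.lower i) (K.upper i) ∩ Icc (K'.lower i) (K'.upper i) := by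
    intro t
    have h1 : ∀ j, x₀ j ∈ s' j := by rw [hF'] at hx₀; exact hx₀
    rw [← upd s' h1, ← hF', mem_inter_iff, mem_inter_iff]
    exact and_congr (upd (fun j => Icc (K.lower j) (K.upper j)) hx₀.1 t)
      (upd (fun j => Icc (K'.lower j) (K'.upper j)) hx₀.2 t)
  have hab := K.lower_lt_upper i
  have hab' := K'.lower_lt_upper i
  rcases hs i with e | e | e
  · left
    simp only [e, mem_singleton_iff, mem_inter_iff, mem_Icc] at key
    have h1 := (key _).1 rfl
    by_contra hne
    -- The right end of the intersection must be its only point K.lower i. It cannot be K.upper i,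
    -- so it is K'.upper i.
    have h2 := (key (min (K.upper i) (K'.upper i))).2
      ⟨⟨le_min hab.le h1.2.2, min_le_left _ _⟩, ⟨le_min (by linarith) hab'.le, min_le_right _ _⟩⟩
    rcases min_choice (K.upper i) (K'.upper i) with h3 | h3 <;> rw [h3] at h2
    · exact hab.ne' h2
    · exact hne h2
  · right; left
    simp only [e, mem_singleton_iff, mem_inter_iff, mem_Icc] at key
    have h1 := (key _).1 rfl
    by_contra hne
    have h2 := (key (max (K.lower i) (K'.lower i))).2
      ⟨⟨le_max_left _ _, max_le hab.le h1.2.1⟩, ⟨le_max_right _ _, max_le (by linarith) hab'.le⟩⟩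
    rcases max_choice (K.lower i) (K'.lower i) with h3 | h3 <;> rw [h3] at h2
    · exact hab.ne h2
    · exact hne h2
  · right; right
    simp only [e, mem_inter_iff, mem_Icc] at key
    have ha := (key _).1 ⟨le_rfl, hab.le⟩
    have hb := (key _).1 ⟨hab.le, le_rfl⟩
    -- The interval of K lies in that of K', so the common face has two distinct points in direction
    -- i. It is then not an endpoint of K', and the two intervals coincide.
    rcases hs' i with e' | e' | e'
    · simp only [e', mem_singleton_iff, mem_inter_iff, mem_Icc] at key'
      exact absurd (((key' _).2 ha).trans ((key' _).2 hb).symm) hab.ne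
    · simp only [e', mem_singleton_iff, mem_inter_iff, mem_Icc] at key'
      exact absurd (((key' _).2 ha).trans ((key' _).2 hb).symm) hab.ne
    · simp only [e', mem_inter_iff, mem_Icc] at key'
      have h1 := (key' _).1 ⟨le_rfl, hab'.le⟩
      have h2 := (key' _).1 ⟨hab'.le, le_rfl⟩
      exact ⟨le_antisymm ha.2.1 h1.1.1, le_antisymm h2.1.2 hb.2.2⟩

/-! ### Layers of elements -/

open Classical in
/-- The elements that meet some element of `I`. -/
noncomputable def Mesh.layer (T : Mesh Ω) (I : Finset (BoxIntegral.Box (Fin d))) :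
    Finset (BoxIntegral.Box (Fin d)) :=
  T.cells.filter fun K => ∃ K' ∈ I, (cell K' ∩ cell K).Nonempty

theorem Mesh.mem_layer {T : Mesh Ω} {I : Finset (BoxIntegral.Box (Fin d))}
    {K : BoxIntegral.Box (Fin d)} :
    K ∈ T.layer I ↔ K ∈ T.cells ∧ ∃ K' ∈ I, (cell K' ∩ cell K).Nonempty := by
  simp [Mesh.layer]

theorem Mesh.subset_layer {T : Mesh Ω} {I : Finset (BoxIntegral.Box (Fin d))}
    (hI : I ⊆ T.cells) : I ⊆ T.layer I := fun K hK =>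
  mem_layer.2 ⟨hI hK, K, hK, by
    rw [inter_self]; exact (nonempty_interior_cell K).mono interior_subset⟩

/-- Record for each direction whether the neighbour lies below, above or is aligned with K. Two
neighbours with the same record overlap in an open interval in each direction, hence have
intersecting interiors and are equal. -/
theorem Mesh.card_layer_singleton_le (T : Mesh Ω) {K : BoxIntegral.Box (Fin d)}
    (hK : K ∈ T.cells) : (T.layer {K}).card ≤ 3 ^ d := by
  classical
  let f : BoxIntegral.Box (Fin d) → (Fin d → Fin 3) := fun K' i =>
    if K'.upper i = K.lower i then 0 else if K'.lower i = K.upper i then 1 else 2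
  have hf : Set.InjOn f (T.layer {K}) := by
    intro K₁ h₁ K₂ h₂ h
    obtain ⟨m₁, K₀, hK₀, n₁⟩ := mem_layer.1 (Finset.mem_coe.1 h₁)
    rw [Finset.mem_singleton.1 hK₀] at n₁
    obtain ⟨m₂, K₁', hK₁', n₂⟩ := mem_layer.1 (Finset.mem_coe.1 h₂)
    rw [Finset.mem_singleton.1 hK₁'] at n₂
    by_contra hne
    have hex : ∀ i, (Ioo (K₁.lower i) (K₁.upper i) ∩ Ioo (K₂.lower i) (K₂.upper i)).Nonempty := by
      intro i
      have hi := congrFun h i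
      have l₁ := K₁.lower_lt_upper i
      have l₂ := K₂.lower_lt_upper i
      rw [Ioo_inter_Ioo, nonempty_Ioo, sup_lt_iff, lt_inf_iff, lt_inf_iff]
      have l₀ := K.lower_lt_upper i
      rcases T.adjacent_or_aligned hK m₁ n₁ i with e₁ | e₁ | ⟨e₁, e₁'⟩ <;>
      rcases T.adjacent_or_aligned hK m₂ n₂ i with e₂ | e₂ | ⟨e₂, e₂'⟩ <;>
      simp only [f] at hi <;> split_ifs at hi <;>
      first
        | (exfalso; simp at hi; done)
        | (refine ⟨⟨?_, ?_⟩, ?_, ?_⟩ <;> linarith)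
    choose t ht using hex
    refine Set.disjoint_left.1 (T.disjoint_interior K₁ m₁ K₂ m₂ hne)
      (show (WithLp.toLp 2 t : EuclideanSpace ℝ (Fin d)) ∈ _ from ?_) ?_
    · rw [interior_cell]; exact fun i => (ht i).1
    · rw [interior_cell]; exact fun i => (ht i).2
  have := Finset.card_le_card_of_injOn (t := Finset.univ) f (fun _ _ => Finset.mem_univ _) hf
  simpa using this

/-- A Lipschitz domain has no slits: moving a boundary point slightly along -e reaches the open
region strictly below the graph, which contains no points of Ω nearby. So that point is not interior
to the closure. -/
theorem IsLipschitzDomain.interior_closure_subset (hΩ : IsLipschitzDomain Ω) :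
    interior (closure Ω) ⊆ Ω := by
  intro x hx
  by_contra hxΩ
  have hfr : x ∈ frontier Ω := by
    rw [hΩ.isOpen.frontier_eq]; exact ⟨interior_subset hx, hxΩ⟩
  obtain ⟨e, he, r, hr, L, f, hf, hy⟩ := hΩ.lipschitz_boundary x hfr
  have hfc := hf.continuous
  have c1 : Continuous fun t : ℝ => x - t • e := by fun_prop
  have ev1 : ∀ᶠ t in 𝓝[>] (0 : ℝ), x - t • e ∈ interior (closure Ω) := by
    refine nhdsWithin_le_nhds (c1.continuousAt.eventually_mem ?_)
    exact isOpen_interior.mem_nhds (by simpa using hx)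
  have ev2 : ∀ᶠ t in 𝓝[>] (0 : ℝ), x - t • e ∈ Metric.ball x r := by
    refine nhdsWithin_le_nhds (c1.continuousAt.eventually_mem ?_)
    exact Metric.isOpen_ball.mem_nhds (by simpa using hr)
  obtain ⟨t, h1, h2, ht⟩ := (ev1.and (ev2.and self_mem_nhdsWithin)).exists
  have ht : 0 < t := ht
  have hee : (inner ℝ e e : ℝ) = 1 := by rw [real_inner_self_eq_norm_sq, he, one_pow]
  have h0 : (inner ℝ e x : ℝ) ≤ f (x - inner ℝ e x • e) :=
    not_lt.1 fun h => hxΩ ((hy x (Metric.mem_ball_self hr)).2 h)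
  have hU : IsOpen {y : EuclideanSpace ℝ (Fin d) | (inner ℝ e y : ℝ) < f (y - inner ℝ e y • e)} :=
    isOpen_lt (by fun_prop) (by fun_prop)
  have hmem : x - t • e ∈ {y : EuclideanSpace ℝ (Fin d) |
      (inner ℝ e y : ℝ) < f (y - inner ℝ e y • e)} := by
    have e1 : (inner ℝ e (x - t • e) : ℝ) = inner ℝ e x - t := by
      rw [inner_sub_right, inner_smul_right, hee, mul_one]
    have e2 : x - t • e - (inner ℝ e x - t) • e = x - inner ℝ e x • e := by
      rw [sub_smul]; abel
    change (inner ℝ e (x - t • e) : ℝ) < f (x - t • e - inner ℝ e (x - t • e) • e)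
    rw [e1, e2]
    linarith
  obtain ⟨y, ⟨hyU, hyb⟩, hyΩ⟩ := mem_closure_iff.1 (interior_subset h1) _
    (hU.inter Metric.isOpen_ball) ⟨hmem, h2⟩
  exact lt_asymm hyU ((hy y hyb).1 hyΩ)

/-- This is what makes bubbles supported in an open element admissible in H¹₀(Ω). -/
theorem Mesh.interior_cell_subset (hΩ : IsLipschitzDomain Ω) (T : Mesh Ω)
    {K : BoxIntegral.Box (Fin d)} (hK : K ∈ T.cells) : interior (cell K) ⊆ Ω := by
  refine subset_trans (interior_mono ?_) hΩ.interior_closure_subset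
  rw [← T.iUnion_cell]
  exact subset_biUnion_of_mem (u := fun K => cell K) hK

/-! ### Cutoff functions -/

theorem exists_bound_deriv_smoothTransition :
    ∃ L : ℝ, 0 ≤ L ∧ ∀ t, |deriv Real.smoothTransition t| ≤ L := by
  have hc : Continuous (deriv Real.smoothTransition) :=
    (Real.smoothTransition.contDiff (n := 1)).continuous_deriv le_rfl
  obtain ⟨L, hL⟩ := isCompact_Icc.exists_bound_of_continuousOn (s := Icc (0 : ℝ) 1) hc.continuousOn
  refine ⟨L, (norm_nonneg _).trans (hL 0 (by simp)), fun t => ?_⟩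
  have h0 := (norm_nonneg _).trans (hL 0 (by simp))
  by_cases ht : t ∈ Icc (0 : ℝ) 1
  · exact hL t ht
  · rw [mem_Icc, not_and_or, not_le, not_le] at ht
    have : deriv Real.smoothTransition t = 0 := by
      rcases ht with ht | ht
      · have : Real.smoothTransition =ᶠ[𝓝 t] fun _ => 0 := by
          filter_upwards [Iio_mem_nhds ht] with s hs
          exact Real.smoothTransition.zero_of_nonpos (le_of_lt hs)
        rw [this.deriv_eq, deriv_const]
      · have : Real.smoothTransition =ᶠ[𝓝 t] fun _ => 1 := by
          filter_upwards [Ioi_mem_nhds ht] with s hs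
          exact Real.smoothTransition.one_of_one_le (le_of_lt hs)
        rw [this.deriv_eq, deriv_const]
    rw [this, abs_zero]; exact h0

/-- By the Leibniz rule each summand contains one derivative, and the remaining factors are at most
1 in modulus. -/
theorem norm_fderiv_prod_le {E ι : Type*} [NormedAddCommGroup E] [NormedSpace ℝ E]
    (s : Finset ι) {f : ι → E → ℝ} {x : E} {B : ι → ℝ}
    (hd : ∀ i ∈ s, DifferentiableAt ℝ (f i) x) (h1 : ∀ i ∈ s, |f i x| ≤ 1)
    (hB : ∀ i ∈ s, ‖fderiv ℝ (f i) x‖ ≤ B i) :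
    ‖fderiv ℝ (fun y => ∏ i ∈ s, f i y) x‖ ≤ ∑ i ∈ s, B i := by
  classical
  rw [(HasFDerivAt.finsetProd fun i hi => (hd i hi).hasFDerivAt).fderiv]
  refine (norm_sum_le _ _).trans (Finset.sum_le_sum fun i hi => ?_)
  rw [norm_smul, norm_prod]
  refine (mul_le_of_le_one_left (norm_nonneg _) ?_).trans (hB i hi)
  exact Finset.prod_le_one (fun _ _ => norm_nonneg _)
    fun j hj => h1 j (Finset.mem_of_mem_erase hj)

/-- A smooth function that is `1` on the rectangle `K` and `0` at distance at least `h / 2`. -/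
noncomputable def hat (K : BoxIntegral.Box (Fin d)) (h : ℝ) (x : EuclideanSpace ℝ (Fin d)) : ℝ :=
  ∏ i, (Real.smoothTransition (2 / h * (x i - K.lower i) + 1) *
    Real.smoothTransition (2 / h * (K.upper i - x i) + 1))

section hat

variable {K : BoxIntegral.Box (Fin d)} {h : ℝ}

theorem contDiff_hat : ContDiff ℝ ∞ (hat K h) := by
  unfold hat
  refine contDiff_prod fun i _ => ContDiff.mul ?_ ?_ <;>
  · refine Real.smoothTransition.contDiff.comp ?_
    fun_prop

theorem hat_factor_mem (x : EuclideanSpace ℝ (Fin d)) (i : Fin d) :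
    Real.smoothTransition (2 / h * (x i - K.lower i) + 1) *
      Real.smoothTransition (2 / h * (K.upper i - x i) + 1) ∈ Icc (0 : ℝ) 1 :=
  ⟨mul_nonneg (Real.smoothTransition.nonneg _) (Real.smoothTransition.nonneg _),
    mul_le_one₀ (Real.smoothTransition.le_one _) (Real.smoothTransition.nonneg _)
      (Real.smoothTransition.le_one _)⟩

theorem hat_mem (x : EuclideanSpace ℝ (Fin d)) : hat K h x ∈ Icc (0 : ℝ) 1 :=
  ⟨Finset.prod_nonneg fun i _ => (hat_factor_mem x i).1,
    Finset.prod_le_one (fun i _ => (hat_factor_mem x i).1) fun i _ => (hat_factor_mem x i).2⟩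

theorem hat_eq_one (hh : 0 < h) {x : EuclideanSpace ℝ (Fin d)} (hx : x ∈ cell K) :
    hat K h x = 1 := by
  refine Finset.prod_eq_one fun i _ => ?_
  obtain ⟨h1, h2⟩ := hx i
  have h1 : 0 ≤ 2 / h * (x i - K.lower i) := mul_nonneg (by positivity) (by linarith)
  have h2 : 0 ≤ 2 / h * (K.upper i - x i) := mul_nonneg (by positivity) (by linarith)
  rw [Real.smoothTransition.one_of_one_le (by linarith),
    Real.smoothTransition.one_of_one_le (by linarith), one_mul]

theorem hat_eq_zero (hh : 0 < h) {x : EuclideanSpace ℝ (Fin d)} {i : Fin d}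
    (hx : x i < K.lower i - h / 2 ∨ K.upper i + h / 2 < x i) : hat K h x = 0 := by
  refine Finset.prod_eq_zero (Finset.mem_univ i) ?_
  have key : ∀ t, t < -(h / 2) → 2 / h * t + 1 ≤ 0 := by
    intro t ht
    have : 2 / h * t ≤ 2 / h * -(h / 2) := mul_le_mul_of_nonneg_left ht.le (by positivity)
    have e : 2 / h * -(h / 2) = -1 := by field_simp
    linarith
  rcases hx with hx | hx
  · rw [Real.smoothTransition.zero_of_nonpos (key _ (by linarith)), zero_mul]
  · rw [mul_comm, Real.smoothTransition.zero_of_nonpos (key _ (by linarith)), zero_mul]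

theorem norm_fderiv_hat_le {L : ℝ} (hL : ∀ t, |deriv Real.smoothTransition t| ≤ L) (hh : 0 < h)
    (x : EuclideanSpace ℝ (Fin d)) : ‖fderiv ℝ (hat K h) x‖ ≤ 4 * d * L / h := by
  have hL0 : 0 ≤ L := (abs_nonneg _).trans (hL 0)
  have dst : Differentiable ℝ Real.smoothTransition :=
    (Real.smoothTransition.contDiff (n := 1)).differentiable (by simp)
  have pr : ∀ i : Fin d, ‖(EuclideanSpace.proj i : EuclideanSpace ℝ (Fin d) →L[ℝ] ℝ)‖ ≤ 1 :=
    fun i => ContinuousLinearMap.opNorm_le_bound _ zero_le_one fun y => by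
      simpa using PiLp.norm_apply_le y i
  have comp : ∀ (g : EuclideanSpace ℝ (Fin d) → ℝ) (g' : EuclideanSpace ℝ (Fin d) →L[ℝ] ℝ),
      HasFDerivAt g g' x → ‖g'‖ ≤ 2 / h →
      ‖fderiv ℝ (fun y => Real.smoothTransition (g y)) x‖ ≤ 2 * L / h := by
    intro g g' hg hn
    have : HasFDerivAt (fun y => Real.smoothTransition (g y))
        (deriv Real.smoothTransition (g x) • g') x :=
      (dst (g x)).hasDerivAt.comp_hasFDerivAt x hg
    rw [this.fderiv, norm_smul]
    calc _ ≤ L * (2 / h) := mul_le_mul (hL _) hn (norm_nonneg _) hL0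
      _ = 2 * L / h := by ring
  have hp : ∀ i : Fin d, HasFDerivAt (fun y : EuclideanSpace ℝ (Fin d) => y i)
      (EuclideanSpace.proj i : EuclideanSpace ℝ (Fin d) →L[ℝ] ℝ) x := fun i =>
    (EuclideanSpace.proj i : EuclideanSpace ℝ (Fin d) →L[ℝ] ℝ).hasFDerivAt
  have habs : |2 / h| = 2 / h := abs_of_pos (by positivity)
  have bd : ∀ i : Fin d, ‖fderiv ℝ (fun y : EuclideanSpace ℝ (Fin d) =>
      Real.smoothTransition (2 / h * (y i - K.lower i) + 1) *
      Real.smoothTransition (2 / h * (K.upper i - y i) + 1)) x‖ ≤ 4 * L / h := by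
    intro i
    have h1 : ‖fderiv ℝ (fun y : EuclideanSpace ℝ (Fin d) =>
        Real.smoothTransition (2 / h * (y i - K.lower i) + 1)) x‖ ≤ 2 * L / h := by
      refine comp _ _ ((((hp i).sub_const (K.lower i)).const_mul (2 / h)).add_const 1) ?_
      rw [norm_smul, Real.norm_eq_abs, habs]
      exact mul_le_of_le_one_right (by positivity) (pr i)
    have h2 : ‖fderiv ℝ (fun y : EuclideanSpace ℝ (Fin d) =>
        Real.smoothTransition (2 / h * (K.upper i - y i) + 1)) x‖ ≤ 2 * L / h := by
      refine comp _ _ ((((hp i).const_sub (K.upper i)).const_mul (2 / h)).add_const 1) ?_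
      rw [norm_smul, Real.norm_eq_abs, habs, norm_neg]
      exact mul_le_of_le_one_right (by positivity) (pr i)
    have hpr := norm_fderiv_prod_le (Finset.univ : Finset (Fin 2)) (x := x)
      (B := fun _ => 2 * L / h)
      (f := ![fun y : EuclideanSpace ℝ (Fin d) =>
        Real.smoothTransition (2 / h * (y i - K.lower i) + 1),
        fun y => Real.smoothTransition (2 / h * (K.upper i - y i) + 1)])
      (by
        intro j _
        fin_cases j
        · exact dst.differentiableAt.comp x (by fun_prop)
        · exact dst.differentiableAt.comp x (by fun_prop))
      (by
        intro j _
        fin_cases j <;>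
        · simp only [Fin.zero_eta, Fin.mk_one, Matrix.cons_val_zero, Matrix.cons_val_one]
          rw [abs_of_nonneg (Real.smoothTransition.nonneg _)]
          exact Real.smoothTransition.le_one _)
      (by
        intro j _
        fin_cases j
        · exact h1
        · exact h2)
    simp only [Fin.prod_univ_two, Fin.sum_univ_two, Matrix.cons_val_zero, Matrix.cons_val_one]
      at hpr
    refine hpr.trans (le_of_eq (by ring))
  have := norm_fderiv_prod_le (Finset.univ : Finset (Fin d)) (x := x) (B := fun _ => 4 * L / h)
    (f := fun i (y : EuclideanSpace ℝ (Fin d)) =>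
      Real.smoothTransition (2 / h * (y i - K.lower i) + 1) *
      Real.smoothTransition (2 / h * (K.upper i - y i) + 1))
    (fun i _ => (dst.differentiableAt.comp x (by fun_prop)).mul
      (dst.differentiableAt.comp x (by fun_prop)))
    (fun i _ => by
      rw [abs_of_nonneg (hat_factor_mem x i).1]
      exact (hat_factor_mem x i).2)
    (fun i _ => bd i)
  refine this.trans (le_of_eq ?_)
  rw [Finset.sum_const, Finset.card_univ, Fintype.card_fin, nsmul_eq_mul]
  ring

end hat

/-! ### Cutoffs that respect the adjacency of elements -/

/-- Two elements can be close without touching, across a gap of Ω, so distance to K alone does not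
decide adjacency. Near K, however, touching K is shared by all elements through a common point x. In
a direction in which x leaves K by less than h, x is strictly inside the interval of K₁, because K₁
is at least h wide. This forces K₂ to be aligned with K₁, so K₂ also reaches K in that direction. -/
theorem Mesh.touches_of_near (T : Mesh Ω) {h : ℝ}
    (hside : ∀ K ∈ T.cells, ∀ i, h ≤ K.upper i - K.lower i)
    {K K₁ K₂ : BoxIntegral.Box (Fin d)} (hK : K ∈ T.cells) (hK₁ : K₁ ∈ T.cells)
    (hK₂ : K₂ ∈ T.cells) (ht : (cell K ∩ cell K₁).Nonempty) {x : EuclideanSpace ℝ (Fin d)}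
    (hx₁ : x ∈ cell K₁) (hx₂ : x ∈ cell K₂)
    (hx : ∀ i, K.lower i - h < x i ∧ x i < K.upper i + h) : (cell K ∩ cell K₂).Nonempty := by
  have hex : ∀ i, ∃ t, t ∈ Icc (K.lower i) (K.upper i) ∧ t ∈ Icc (K₂.lower i) (K₂.upper i) := by
    intro i
    obtain ⟨a₁, b₁⟩ := hx₁ i
    obtain ⟨a₂, b₂⟩ := hx₂ i
    obtain ⟨l, u⟩ := hx i
    have s₁ := hside K₁ hK₁ i
    have l₀ := K.lower_lt_upper i
    have l₁ := K₁.lower_lt_upper i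
    have l₂ := K₂.lower_lt_upper i
    simp only [mem_Icc]
    by_cases hin : K.lower i ≤ x i ∧ x i ≤ K.upper i
    · exact ⟨x i, hin, a₂, b₂⟩
    rw [not_and_or, not_le, not_le] at hin
    rcases T.adjacent_or_aligned hK hK₁ ht i with e | e | ⟨e, e'⟩
    · refine ⟨K.lower i, ⟨le_rfl, l₀.le⟩, ?_⟩
      rcases T.adjacent_or_aligned hK₁ hK₂ ⟨x, hx₁, hx₂⟩ i with e₂ | e₂ | ⟨e₂, e₂'⟩
      · linarith
      · rcases hin with hin | hin <;> linarith
      · constructor <;> linarith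
    · refine ⟨K.upper i, ⟨l₀.le, le_rfl⟩, ?_⟩
      rcases T.adjacent_or_aligned hK₁ hK₂ ⟨x, hx₁, hx₂⟩ i with e₂ | e₂ | ⟨e₂, e₂'⟩
      · rcases hin with hin | hin <;> linarith
      · linarith
      · constructor <;> linarith
    · rcases hin with hin | hin <;> linarith
  choose t ht₁ ht₂ using hex
  exact ⟨WithLp.toLp 2 t, ht₁, ht₂⟩

open Classical in
/-- The function `hat K h`, cut off outside of the elements that meet `K`. -/
noncomputable def Mesh.hat (T : Mesh Ω) (K : BoxIntegral.Box (Fin d)) (h : ℝ)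
    (x : EuclideanSpace ℝ (Fin d)) : ℝ :=
  if ∀ K' ∈ T.cells, x ∈ cell K' → (cell K ∩ cell K').Nonempty then LOD.hat K h x else 0

section meshHat

variable (T : Mesh Ω) {K : BoxIntegral.Box (Fin d)} {h : ℝ}

theorem Mesh.hat_mem (x : EuclideanSpace ℝ (Fin d)) : T.hat K h x ∈ Icc (0 : ℝ) 1 := by
  unfold Mesh.hat
  split_ifs
  · exact LOD.hat_mem x
  · simp

theorem Mesh.hat_eq_one (hh : 0 < h) {x : EuclideanSpace ℝ (Fin d)} (hx : x ∈ cell K) :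
    T.hat K h x = 1 := by
  unfold Mesh.hat
  rw [if_pos fun K' _ hx' => ⟨x, hx, hx'⟩, LOD.hat_eq_one hh hx]

theorem Mesh.hat_eq_zero {K' : BoxIntegral.Box (Fin d)} (hK' : K' ∈ T.cells)
    (hn : ¬ (cell K ∩ cell K').Nonempty) {x : EuclideanSpace ℝ (Fin d)} (hx : x ∈ cell K') :
    T.hat K h x = 0 := by
  unfold Mesh.hat
  rw [if_neg fun H => hn (H K' hK' hx)]

/-- There are finitely many elements and they are closed, so those not containing x stay away from
x. -/
theorem Mesh.eventually_mem_cell (x : EuclideanSpace ℝ (Fin d)) :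
    ∀ᶠ y in 𝓝 x, ∀ K ∈ T.cells, y ∈ cell K → x ∈ cell K := by
  refine (Filter.eventually_all_finset T.cells).2 fun K _ => ?_
  by_cases hx : x ∈ cell K
  · exact Eventually.of_forall fun _ _ => hx
  · filter_upwards [(isClosed_cell K).isOpen_compl.mem_nhds hx] with y hy hy'
    exact absurd hy' hy

/-- Truncation by adjacency creates no jump inside Ω. Near K either all elements through x touch K
or none does, and far from K the untruncated function is already zero. -/
theorem Mesh.hat_eventuallyEq (hΩ : IsOpen Ω) (hh : 0 < h)
    (hside : ∀ K ∈ T.cells, ∀ i, h ≤ K.upper i - K.lower i) (hK : K ∈ T.cells)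
    {x : EuclideanSpace ℝ (Fin d)} (hx : x ∈ Ω) :
    T.hat K h =ᶠ[𝓝 x] LOD.hat K h ∨ T.hat K h =ᶠ[𝓝 x] fun _ => 0 := by
  by_cases hall : ∀ K' ∈ T.cells, x ∈ cell K' → (cell K ∩ cell K').Nonempty
  · left
    filter_upwards [T.eventually_mem_cell x] with y hy
    unfold Mesh.hat
    rw [if_pos fun K' hK' hy' => hall K' hK' (hy K' hK' hy')]
  right
  push Not at hall
  obtain ⟨K₂, hK₂, hx₂, hn⟩ := hall
  by_cases hnear : ∀ i, K.lower i - h < x i ∧ x i < K.upper i + h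
  · filter_upwards [T.eventually_mem_cell x, hΩ.mem_nhds hx] with y hy hyΩ
    obtain ⟨K₁, hK₁, hy₁⟩ := T.exists_cell hyΩ
    refine T.hat_eq_zero hK₁ (fun ht => ?_) hy₁
    exact (T.touches_of_near hside hK hK₁ hK₂ ht (hy K₁ hK₁ hy₁) hx₂ hnear).ne_empty hn
  -- Here x leaves K by at least h in some direction, while `LOD.hat K h` already vanishes beyond h
  -- / 2. The gap leaves room for a neighbourhood of x.
  · push Not at hnear
    obtain ⟨i, hi⟩ := hnear
    have hc : Continuous fun y : EuclideanSpace ℝ (Fin d) => y i := by fun_prop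
    have : ∀ᶠ y : EuclideanSpace ℝ (Fin d) in 𝓝 x,
        y i < K.lower i - h / 2 ∨ K.upper i + h / 2 < y i := by
      refine ((isOpen_lt hc continuous_const).union (isOpen_lt continuous_const hc)).mem_nhds ?_
      rcases le_or_gt (x i) (K.lower i - h) with h1 | h1
      · left; change x i < _; linarith
      · right; change _ < x i; linarith [hi h1]
    filter_upwards [this] with y hy
    unfold Mesh.hat
    split_ifs
    · exact LOD.hat_eq_zero hh hy
    · rfl

end meshHat

/-- A cutoff function that vanishes on the elements in `I` and is `1` on the elements that do not
meet any of them. -/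
theorem exists_cutoff (d : ℕ) : ∃ C : ℝ, 0 ≤ C ∧ ∀ (Ω : Set (EuclideanSpace ℝ (Fin d)))
    (_ : IsOpen Ω) (T : Mesh Ω) (h : ℝ) (_ : 0 < h)
    (_ : ∀ K ∈ T.cells, ∀ i, h ≤ K.upper i - K.lower i)
    (I : Finset (BoxIntegral.Box (Fin d))) (_ : I ⊆ T.cells),
    ∃ μ : EuclideanSpace ℝ (Fin d) → ℝ, ContDiffOn ℝ ∞ μ Ω ∧ (∀ x, μ x ∈ Icc (0 : ℝ) 1) ∧
      (∀ K ∈ I, ∀ x ∈ cell K, μ x = 0) ∧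
      (∀ K ∈ T.cells, K ∉ T.layer I → ∀ x ∈ cell K, μ x = 1) ∧
      ∀ x ∈ Ω, ‖fderiv ℝ μ x‖ ≤ C / h := by
  classical
  obtain ⟨L, hL0, hL⟩ := exists_bound_deriv_smoothTransition
  -- At most 3^d factors of the product below have a nonzero gradient at a given point, and each
  -- gradient is at most 4dL / h.
  refine ⟨3 ^ d * (4 * d * L), by positivity, ?_⟩
  intro Ω hΩ T h hh hside I hI
  have hloc := fun {K} (hK : K ∈ I) {x} (hx : x ∈ Ω) =>
    T.hat_eventuallyEq hΩ hh hside (hI hK) (K := K) hx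
  have hcd : ∀ K ∈ I, ∀ x ∈ Ω, ContDiffAt ℝ ∞ (T.hat K h) x := by
    intro K hK x hx
    rcases hloc hK hx with e | e
    · exact contDiff_hat.contDiffAt.congr_of_eventuallyEq e
    · exact contDiffAt_const.congr_of_eventuallyEq e
  have hfd : ∀ K ∈ I, ∀ x ∈ Ω, ‖fderiv ℝ (T.hat K h) x‖ ≤ 4 * d * L / h := by
    intro K hK x hx
    rcases hloc hK hx with e | e
    · rw [e.fderiv_eq]; exact norm_fderiv_hat_le hL hh x
    · rw [e.fderiv_eq]; simp only [fderiv_fun_const, Pi.zero_apply, norm_zero]; positivity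
  have h01 : ∀ K x, 1 - T.hat K h x ∈ Icc (0 : ℝ) 1 := fun K x =>
    ⟨by linarith [(T.hat_mem (K := K) (h := h) x).2],
      by linarith [(T.hat_mem (K := K) (h := h) x).1]⟩
  refine ⟨fun x => ∏ K ∈ I, (1 - T.hat K h x), ?_, ?_, ?_, ?_, ?_⟩
  · intro x hx
    exact (ContDiffAt.contDiffWithinAt
      (contDiffAt_prod fun K hK => contDiffAt_const.sub (hcd K hK x hx)))
  · exact fun x => ⟨Finset.prod_nonneg fun K _ => (h01 K x).1,
      Finset.prod_le_one (fun K _ => (h01 K x).1) fun K _ => (h01 K x).2⟩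
  · intro K hK x hx
    exact Finset.prod_eq_zero hK (by rw [T.hat_eq_one hh hx, sub_self])
  · intro K hK hKn x hx
    refine Finset.prod_eq_one fun K' hK' => ?_
    rw [T.hat_eq_zero hK (fun ht => hKn (Mesh.mem_layer.2 ⟨hK, K', hK', ht⟩)) hx, sub_zero]
  · intro x hx
    obtain ⟨K, hK, hxK⟩ := T.exists_cell hx
    -- For x in K only the elements of I that touch K contribute, which keeps the bound independent
    -- of the size of I.
    have hb := norm_fderiv_prod_le I (x := x) (f := fun K y => 1 - T.hat K h y)
      (B := fun K' => if K' ∈ T.layer {K} then 4 * d * L / h else 0)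
      (fun K' hK' => (differentiableAt_const _).sub ((hcd K' hK' x hx).differentiableAt (by simp)))
      (fun K' _ => by rw [abs_of_nonneg (h01 K' x).1]; exact (h01 K' x).2)
      (fun K' hK' => by
        rw [fderiv_const_sub, norm_neg]
        split_ifs with hm
        · exact hfd K' hK' x hx
        · have h0 : T.hat K' h x = 0 := by
            refine T.hat_eq_zero hK (fun ht => hm (Mesh.mem_layer.2 ⟨hI hK', K, by simp, ?_⟩)) hxK
            rwa [inter_comm]
          -- A nonnegative function has zero derivative at each of its zeros; this also covers
          -- points on the boundary of K.
          have hmin : IsLocalMin (T.hat K' h) x :=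
            Eventually.of_forall fun y => by rw [h0]; exact (T.hat_mem y).1
          rw [hmin.fderiv_eq_zero, norm_zero])
    refine hb.trans ?_
    have hc := T.card_layer_singleton_le hK
    have : (I.filter fun K' => K' ∈ T.layer {K}).card ≤ 3 ^ d :=
      (Finset.card_le_card fun K' hK' => (Finset.mem_filter.1 hK').2).trans hc
    have hc' : ((I.filter fun K' => K' ∈ T.layer {K}).card : ℝ) ≤ 3 ^ d := mod_cast this
    rw [← Finset.sum_filter, Finset.sum_const, nsmul_eq_mul]
    calc _ ≤ (3 : ℝ) ^ d * (4 * d * L / h) := mul_le_mul_of_nonneg_right hc' (by positivity)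
      _ = _ := by ring

/-! ### The Poincaré inequality -/

/-- The variance of g on the unit interval is nonnegative. -/
theorem sq_intervalIntegral_le {g : ℝ → ℝ} (hg : Continuous g) :
    (∫ t in (0 : ℝ)..1, g t) ^ 2 ≤ ∫ t in (0 : ℝ)..1, g t ^ 2 := by
  set m := ∫ t in (0 : ℝ)..1, g t with hm
  have h0 : 0 ≤ ∫ t in (0 : ℝ)..1, (g t - m) ^ 2 :=
    intervalIntegral.integral_nonneg zero_le_one fun t _ => sq_nonneg _
  have h1 : ∫ t in (0 : ℝ)..1, (g t - m) ^ 2 = (∫ t in (0 : ℝ)..1, g t ^ 2) - m ^ 2 := by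
    have e : ∀ t, (g t - m) ^ 2 = g t ^ 2 - 2 * m * g t + m ^ 2 := fun t => by ring
    simp only [e]
    rw [intervalIntegral.integral_add ((by fun_prop : Continuous fun t =>
        g t ^ 2 - 2 * m * g t).intervalIntegrable _ _) (by simp),
      intervalIntegral.integral_sub ((by fun_prop : Continuous fun t => g t ^ 2).intervalIntegrable
        _ _) ((by fun_prop : Continuous fun t => 2 * m * g t).intervalIntegrable _ _),
      intervalIntegral.integral_const_mul, ← hm]
    simp
    ring
  linarith

theorem lintegral_comp_add_smul (a : EuclideanSpace ℝ (Fin d)) {t : ℝ} (ht : t ≠ 0)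
    {G : EuclideanSpace ℝ (Fin d) → ENNReal} (hG : Measurable G) :
    ∫⁻ y, G (a + t • y) = ENNReal.ofReal |(t ^ d)⁻¹| * ∫⁻ y, G y := by
  have h1 : ∫⁻ y, G (a + t • y) =
      ∫⁻ z, G (a + z) ∂(Measure.map (t • ·) (volume : Measure (EuclideanSpace ℝ (Fin d)))) := by
    rw [lintegral_map (by fun_prop) (by fun_prop)]
  rw [h1, Measure.map_addHaar_smul _ ht, lintegral_smul_measure, lintegral_add_left_eq_self,
    finrank_euclideanSpace_fin, smul_eq_mul]

/-- Substitute for whichever endpoint has weight at least 1/2: y if t ≥ 1/2, otherwise x. The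
Jacobian then costs at most 2^d, uniformly in t, and the other variable contributes the volume of S.
-/
theorem lintegral_lintegral_segment_le {S : Set (EuclideanSpace ℝ (Fin d))}
    {G : EuclideanSpace ℝ (Fin d) → ENNReal} (hG : Measurable G) (t : ℝ) :
    ∫⁻ x in S, ∫⁻ y in S, G (x + t • (y - x)) ≤ 2 ^ d * volume S * ∫⁻ y, G y := by
  have half : ∀ s : ℝ, 1 / 2 ≤ s → ∀ a : EuclideanSpace ℝ (Fin d),
      ∫⁻ y in S, G (a + s • y) ≤ 2 ^ d * ∫⁻ y, G y := by
    intro s hs a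
    refine (setLIntegral_le_lintegral _ _).trans ?_
    rw [lintegral_comp_add_smul a (by linarith) hG]
    gcongr
    have : |(s ^ d)⁻¹| ≤ 2 ^ d := by
      rw [abs_of_pos (by positivity), ← inv_pow]
      refine pow_le_pow_left₀ (by positivity) ?_ d
      rw [inv_le_comm₀ (by linarith) two_pos]
      linarith
    calc ENNReal.ofReal |(s ^ d)⁻¹| ≤ ENNReal.ofReal (2 ^ d) := ENNReal.ofReal_le_ofReal this
      _ = 2 ^ d := by rw [ENNReal.ofReal_pow two_pos.le]; simp
  have bound : ∀ F : EuclideanSpace ℝ (Fin d) → ENNReal, (∀ x, F x ≤ 2 ^ d * ∫⁻ y, G y) →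
      ∫⁻ x in S, F x ≤ 2 ^ d * volume S * ∫⁻ y, G y := by
    intro F hF
    refine (lintegral_mono hF).trans ?_
    rw [lintegral_const, Measure.restrict_apply_univ]
    exact le_of_eq (by ring)
  rcases le_total (1 / 2) t with h | h
  · refine bound _ fun x => ?_
    have e : ∀ y, x + t • (y - x) = (x - t • x) + t • y := fun y => by rw [smul_sub]; abel
    simp only [e]
    exact half t h _
  · rw [lintegral_lintegral_swap (by fun_prop)]
    refine bound _ fun y => ?_
    have e : ∀ x, x + t • (y - x) = t • y + (1 - t) • x := fun x => by
      rw [smul_sub, sub_smul, one_smul]; abel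
    simp only [e]
    exact half (1 - t) (by linarith) _

/-- The fundamental theorem of calculus along the segment, followed by Cauchy–Schwarz in t. -/
theorem sq_sub_le_integral_segment {φ : EuclideanSpace ℝ (Fin d) → ℝ} (hφ : ContDiff ℝ 1 φ)
    (x y : EuclideanSpace ℝ (Fin d)) {D : ℝ} (hD : ‖y - x‖ ≤ D) :
    (φ x - φ y) ^ 2 ≤ D ^ 2 * ∫ t in (0 : ℝ)..1, ‖fderiv ℝ φ (x + t • (y - x))‖ ^ 2 := by
  have hc : Continuous (fderiv ℝ φ) := hφ.continuous_fderiv (by simp)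
  have hline : Continuous fun t : ℝ => x + t • (y - x) := by fun_prop
  have hc1 : Continuous fun t : ℝ => fderiv ℝ φ (x + t • (y - x)) (y - x) :=
    (hc.comp hline).clm_apply continuous_const
  have hd : ∀ t ∈ uIcc (0 : ℝ) 1, HasDerivAt (fun t : ℝ => φ (x + t • (y - x)))
      (fderiv ℝ φ (x + t • (y - x)) (y - x)) t := by
    intro t _
    have h1 : HasDerivAt (fun t : ℝ => x + t • (y - x)) (y - x) t := by
      simpa using ((hasDerivAt_id t).smul_const (y - x)).const_add x
    exact ((hφ.differentiable (by simp) _).hasFDerivAt).comp_hasDerivAt t h1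
  have hftc := intervalIntegral.integral_eq_sub_of_hasDerivAt hd (hc1.intervalIntegrable _ _)
  have e : (φ x - φ y) ^ 2 = (∫ t in (0 : ℝ)..1, fderiv ℝ φ (x + t • (y - x)) (y - x)) ^ 2 := by
    rw [hftc]; simp; ring
  rw [e, ← intervalIntegral.integral_const_mul]
  refine (sq_intervalIntegral_le hc1).trans ?_
  refine intervalIntegral.integral_mono_on zero_le_one ((hc1.pow 2).intervalIntegrable _ _)
    ((continuous_const.mul ((hc.comp hline).norm.pow 2)).intervalIntegrable _ _) fun t _ => ?_
  rw [← mul_pow, ← sq_abs]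
  refine pow_le_pow_left₀ (abs_nonneg _) ?_ 2
  rw [mul_comm]
  exact ((fderiv ℝ φ _).le_opNorm _).trans (mul_le_mul_of_nonneg_left hD (norm_nonneg _))

/-- The left-hand side is the double integral of (φ x - φ y)² over S × S. Bound the integrand by the
squared gradient along the segment, which stays in S by convexity, and exchange the integrals.
Extended nonnegative integrals make Tonelli applicable without integrability conditions. -/
theorem poincare_of_contDiff {S : Set (EuclideanSpace ℝ (Fin d))} (hS : IsCompact S)
    (hconv : Convex ℝ S) {D : ℝ} (hD : ∀ x ∈ S, ∀ y ∈ S, ‖y - x‖ ≤ D)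
    {φ : EuclideanSpace ℝ (Fin d) → ℝ} (hφ : ContDiff ℝ 1 φ) :
    2 * (volume.real S * (∫ x in S, φ x ^ 2) - (∫ x in S, φ x) ^ 2) ≤
      2 ^ d * D ^ 2 * volume.real S * ∫ x in S, ‖fderiv ℝ φ x‖ ^ 2 := by
  have hSm := hS.measurableSet
  have hSf : volume S ≠ ⊤ := hS.measure_lt_top.ne
  have hc : Continuous (fderiv ℝ φ) := hφ.continuous_fderiv (by simp)
  -- Extension by zero outside S lets the substitution run over the whole space and still return an
  -- integral over S.
  let G : EuclideanSpace ℝ (Fin d) → ENNReal :=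
    S.indicator fun z => ENNReal.ofReal (‖fderiv ℝ φ z‖ ^ 2)
  have hG : Measurable G :=
    (Measurable.ennreal_ofReal (hc.norm.pow 2).measurable).indicator hSm
  have pt : ∀ x ∈ S, ∀ y ∈ S, ENNReal.ofReal ((φ x - φ y) ^ 2) ≤
      ENNReal.ofReal (D ^ 2) * ∫⁻ t in Ioc (0 : ℝ) 1, G (x + t • (y - x)) := by
    intro x hx y hy
    refine (ENNReal.ofReal_le_ofReal (sq_sub_le_integral_segment hφ x y (hD x hx y hy))).trans ?_
    have hline : Continuous fun t : ℝ => x + t • (y - x) := by fun_prop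
    rw [ENNReal.ofReal_mul (sq_nonneg D), intervalIntegral.integral_of_le zero_le_one,
      ofReal_integral_eq_lintegral_ofReal (Continuous.integrableOn_Ioc (by fun_prop))
        (Eventually.of_forall fun t => sq_nonneg _)]
    gcongr 1
    refine setLIntegral_mono' measurableSet_Ioc fun t ht => ?_
    have : x + t • (y - x) ∈ S := by
      have := hconv hx hy (sub_nonneg.2 ht.2) ht.1.le (by ring)
      convert this using 1
      rw [smul_sub, sub_smul, one_smul]; abel
    simp only [G, indicator_of_mem this, le_refl]
  have main : ∫⁻ x in S, ∫⁻ y in S, ENNReal.ofReal ((φ x - φ y) ^ 2) ≤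
      ENNReal.ofReal (D ^ 2) * (2 ^ d * volume S * ∫⁻ y, G y) := by
    calc _ ≤ ∫⁻ x in S, ∫⁻ y in S, ENNReal.ofReal (D ^ 2) *
          ∫⁻ t in Ioc (0 : ℝ) 1, G (x + t • (y - x)) :=
        setLIntegral_mono' hSm fun x hx => setLIntegral_mono' hSm fun y hy => pt x hx y hy
      _ = ENNReal.ofReal (D ^ 2) * ∫⁻ x in S, ∫⁻ y in S,
          ∫⁻ t in Ioc (0 : ℝ) 1, G (x + t • (y - x)) := by
        simp_rw [lintegral_const_mul' _ _ ENNReal.ofReal_ne_top]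
      _ = ENNReal.ofReal (D ^ 2) * ∫⁻ t in Ioc (0 : ℝ) 1, ∫⁻ x in S, ∫⁻ y in S,
          G (x + t • (y - x)) := by
        congr 1
        have e1 : ∀ x, ∫⁻ y in S, ∫⁻ t in Ioc (0 : ℝ) 1, G (x + t • (y - x)) =
            ∫⁻ t in Ioc (0 : ℝ) 1, ∫⁻ y in S, G (x + t • (y - x)) := fun x =>
          lintegral_lintegral_swap (by fun_prop)
        simp_rw [e1]
        refine lintegral_lintegral_swap (Measurable.aemeasurable ?_)
        exact Measurable.lintegral_prod_right' (f := fun q : (EuclideanSpace ℝ (Fin d) × ℝ) ×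
          EuclideanSpace ℝ (Fin d) => G (q.1.1 + q.1.2 • (q.2 - q.1.1))) (by fun_prop)
      _ ≤ ENNReal.ofReal (D ^ 2) * ∫⁻ t in Ioc (0 : ℝ) 1, 2 ^ d * volume S * ∫⁻ y, G y := by
        gcongr 1
        exact setLIntegral_mono' measurableSet_Ioc fun t _ =>
          lintegral_lintegral_segment_le hG t
      _ = _ := by simp
  have i0 : ∀ {f : EuclideanSpace ℝ (Fin d) → ℝ}, Continuous f → Integrable f (volume.restrict S) :=
    fun hf => (hf.continuousOn.integrableOn_compact hS)
  have hφc := hφ.continuous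
  have inner_int : ∀ x, ∫ y in S, (φ x - φ y) ^ 2 =
      volume.real S * φ x ^ 2 - 2 * φ x * (∫ y in S, φ y) + ∫ y in S, φ y ^ 2 := by
    intro x
    have e : ∀ y, (φ x - φ y) ^ 2 = (φ x ^ 2 - 2 * φ x * φ y) + φ y ^ 2 := fun y => by ring
    simp only [e]
    rw [integral_add (i0 (by fun_prop)) (i0 (by fun_prop)),
      integral_sub (i0 (by fun_prop)) (i0 (by fun_prop)), integral_const_mul, integral_const]
    simp
  have inner_eq : ∀ x, ∫⁻ y in S, ENNReal.ofReal ((φ x - φ y) ^ 2) =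
      ENNReal.ofReal (volume.real S * φ x ^ 2 - 2 * φ x * (∫ y in S, φ y) +
        ∫ y in S, φ y ^ 2) := by
    intro x
    rw [← ofReal_integral_eq_lintegral_ofReal (i0 (by fun_prop))
      (Eventually.of_forall fun t => sq_nonneg _), inner_int]
  have outer : ∫⁻ x in S, ∫⁻ y in S, ENNReal.ofReal ((φ x - φ y) ^ 2) =
      ENNReal.ofReal (2 * (volume.real S * (∫ x in S, φ x ^ 2) - (∫ x in S, φ x) ^ 2)) := by
    simp_rw [inner_eq]
    rw [← ofReal_integral_eq_lintegral_ofReal (i0 (by fun_prop))]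
    · congr 1
      rw [integral_add (i0 (by fun_prop)) (i0 (by fun_prop)),
        integral_sub (i0 (by fun_prop)) (i0 (by fun_prop)), integral_const_mul, integral_const,
        integral_mul_const, integral_const_mul]
      simp
      ring
    · exact Eventually.of_forall fun x =>
        (integral_nonneg fun y => sq_nonneg _).trans_eq (inner_int x)
  have hGint : ∫⁻ y, G y = ENNReal.ofReal (∫ x in S, ‖fderiv ℝ φ x‖ ^ 2) := by
    rw [ofReal_integral_eq_lintegral_ofReal (i0 (by fun_prop))
      (Eventually.of_forall fun t => sq_nonneg _), lintegral_indicator hSm]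
  have hI : 0 ≤ ∫ x in S, ‖fderiv ℝ φ x‖ ^ 2 := integral_nonneg fun y => sq_nonneg _
  rw [outer, hGint, ← ENNReal.ofReal_toReal hSf, ← Measure.real] at main
  have e2 : (2 : ENNReal) ^ d = ENNReal.ofReal (2 ^ d) := by
    rw [ENNReal.ofReal_pow two_pos.le]; simp
  rw [e2, ← ENNReal.ofReal_mul (by positivity), ← ENNReal.ofReal_mul (by positivity),
    ← ENNReal.ofReal_mul (by positivity), ENNReal.ofReal_le_ofReal_iff (by positivity)] at main
  exact main.trans (le_of_eq (by ring))

/-! ### Elements of `H¹₀` -/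

/-- The smooth function `φ` with compact support in `Ω` and its gradient represent `u`. -/
def H10.IsTest (u : H10 Ω) (φ : EuclideanSpace ℝ (Fin d) → ℝ) : Prop :=
  ContDiff ℝ ∞ φ ∧ HasCompactSupport φ ∧ tsupport φ ⊆ Ω ∧
    H10.toL2 u =ᵐ[volume.restrict Ω] φ ∧ H10.grad u =ᵐ[volume.restrict Ω] ∇ φ

/-- H¹₀ is the closure of the test functions, so a closed condition has to be checked on them only.
-/
theorem H10.induction_closed {P : H10 Ω → Prop} (hP : IsClosed {u | P u})
    (h : ∀ u φ, H10.IsTest u φ → P u) (u : H10 Ω) : P u := by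
  have hd : DenseRange (Set.inclusion (testGraph Ω).le_topologicalClosure) :=
    (denseRange_inclusion_iff _).2 subset_rfl
  refine hd.induction_on (p := P) u hP ?_
  rintro ⟨y, φ, h1, h2, h3, h4, h5⟩
  exact h _ φ ⟨h1, h2, h3, h4, h5⟩

theorem H10.exists_isTest {φ : EuclideanSpace ℝ (Fin d) → ℝ} (h1 : ContDiff ℝ ∞ φ)
    (h2 : HasCompactSupport φ) (h3 : tsupport φ ⊆ Ω) : ∃ u : H10 Ω, H10.IsTest u φ := by
  have m1 : MemLp φ 2 (volume.restrict Ω) := h1.continuous.memLp_of_hasCompactSupport h2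
  have m2 := memLp_gradient h1 h2 (volume.restrict Ω)
  exact ⟨⟨WithLp.toLp 2 (m1.toLp φ, m2.toLp (∇ φ)), (testGraph Ω).le_topologicalClosure
    ⟨φ, h1, h2, h3, m1.coeFn_toLp, m2.coeFn_toLp⟩⟩, h1, h2, h3, m1.coeFn_toLp, m2.coeFn_toLp⟩

theorem norm_gradient (φ : EuclideanSpace ℝ (Fin d) → ℝ) (x : EuclideanSpace ℝ (Fin d)) :
    ‖∇ φ x‖ = ‖fderiv ℝ φ x‖ := by simp [gradient]

theorem gradient_mul {η φ : EuclideanSpace ℝ (Fin d) → ℝ} {x : EuclideanSpace ℝ (Fin d)}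
    (hη : DifferentiableAt ℝ η x) (hφ : DifferentiableAt ℝ φ x) :
    ∇ (fun y => η y * φ y) x = η x • ∇ φ x + φ x • ∇ η x := by
  simp only [gradient]
  rw [fderiv_fun_mul hη hφ, map_add, map_smulₛₗ, map_smulₛₗ]
  simp

/-- The product of a function in `H¹₀(Ω)` with a bounded smooth function with bounded gradient. -/
theorem H10.exists_mul (hΩ : IsOpen Ω) {η : EuclideanSpace ℝ (Fin d) → ℝ}
    (hη : ContDiffOn ℝ ∞ η Ω) {M N : ℝ} (hM : ∀ x ∈ Ω, |η x| ≤ M)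
    (hN : ∀ x ∈ Ω, ‖fderiv ℝ η x‖ ≤ N) (u : H10 Ω) :
    ∃ w : H10 Ω, (H10.toL2 w =ᵐ[volume.restrict Ω] fun x => η x * H10.toL2 u x) ∧
      H10.grad w =ᵐ[volume.restrict Ω] fun x => η x • H10.grad u x + H10.toL2 u x • ∇ η x := by
  have hΩm := ae_mem_of_isOpen hΩ
  have hat : ∀ x ∈ Ω, ContDiffAt ℝ ∞ η x := fun x hx => hη.contDiffAt (hΩ.mem_nhds hx)
  have hgc : ContinuousOn (∇ η) Ω :=
    (InnerProductSpace.toDual ℝ _).symm.continuous.comp_continuousOn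
      (hη.continuousOn_fderiv_of_isOpen hΩ (by simp))
  have mη : MemLp η ⊤ (volume.restrict Ω) :=
    memLp_top_of_bound (hη.continuousOn.aestronglyMeasurable hΩ.measurableSet) M
      (hΩm.mono fun x hx => hM x hx)
  have mg : MemLp (∇ η) ⊤ (volume.restrict Ω) :=
    memLp_top_of_bound (hgc.aestronglyMeasurable hΩ.measurableSet) N
      (hΩm.mono fun x hx => by rw [norm_gradient]; exact hN x hx)
  let B1 : L2 Ω →L[ℝ] L2 Ω :=
    (ContinuousLinearMap.lsmul ℝ ℝ).holderL (volume.restrict Ω) ⊤ 2 2 (mη.toLp η)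
  let B2 : L2Vec Ω →L[ℝ] L2Vec Ω :=
    (ContinuousLinearMap.lsmul ℝ ℝ).holderL (volume.restrict Ω) ⊤ 2 2 (mη.toLp η)
  let B3 : L2 Ω →L[ℝ] L2Vec Ω :=
    (ContinuousLinearMap.lsmul ℝ ℝ).flip.holderL (volume.restrict Ω) ⊤ 2 2 (mg.toLp (∇ η))
  have b1 : ∀ f, B1 f =ᵐ[volume.restrict Ω] fun x => η x * f x := fun f => by
    filter_upwards [(ContinuousLinearMap.lsmul ℝ ℝ).coeFn_holder (r := 2) (mη.toLp η) f,
      mη.coeFn_toLp] with x hx h2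
    refine hx.trans ?_
    rw [h2]; rfl
  have b2 : ∀ f, B2 f =ᵐ[volume.restrict Ω] fun x => η x • f x := fun f => by
    filter_upwards [(ContinuousLinearMap.lsmul ℝ ℝ).coeFn_holder (r := 2) (mη.toLp η) f,
      mη.coeFn_toLp] with x hx h2
    refine hx.trans ?_
    rw [h2]; rfl
  have b3 : ∀ f, B3 f =ᵐ[volume.restrict Ω] fun x => f x • ∇ η x := fun f => by
    filter_upwards [(ContinuousLinearMap.lsmul ℝ ℝ).flip.coeFn_holder (r := 2)
      (mg.toLp (∇ η)) f, mg.coeFn_toLp] with x hx h2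
    refine hx.trans ?_
    rw [h2]; rfl
  -- The product rule as a continuous map on pairs of a function and its gradient. It preserves the
  -- graph of test functions, hence also its closure.
  let F : WithLp 2 (L2 Ω × L2Vec Ω) → WithLp 2 (L2 Ω × L2Vec Ω) := fun y =>
    WithLp.toLp 2 (B1 y.fst, B2 y.snd + B3 y.fst)
  have hF : Continuous F := by
    have c1 : Continuous fun y : WithLp 2 (L2 Ω × L2Vec Ω) => y.fst :=
      (WithLp.fstL 2 ℝ (L2 Ω) (L2Vec Ω)).continuous
    have c2 : Continuous fun y : WithLp 2 (L2 Ω × L2Vec Ω) => y.snd :=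
      (WithLp.sndL 2 ℝ (L2 Ω) (L2Vec Ω)).continuous
    exact (WithLp.prod_continuous_toLp 2 _ _).comp
      ((B1.continuous.comp c1).prodMk ((B2.continuous.comp c2).add (B3.continuous.comp c1)))
  have s3 : ∀ y, (F y).snd =ᵐ[volume.restrict Ω] fun x => η x • y.snd x + y.fst x • ∇ η x := by
    intro y
    filter_upwards [Lp.coeFn_add (B2 y.snd) (B3 y.fst), b2 y.snd, b3 y.fst] with x h1 h2 h3
    rw [← h2, ← h3]; exact h1
  have hmaps : MapsTo F (testGraph Ω) (testGraph Ω) := by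
    rintro y ⟨φ, h1, h2, h3, h4, h5⟩
    have hsup : tsupport (fun x => η x * φ x) ⊆ tsupport φ := by
      refine closure_mono fun x hx hx' => hx ?_
      simp [hx']
    refine ⟨fun x => η x * φ x, ?_, h2.mul_left, hsup.trans h3, ?_, ?_⟩
    -- η is smooth on Ω only; off the support of the product, which lies in Ω, the product is
    -- locally zero.
    · refine contDiff_iff_contDiffAt.2 fun x => ?_
      by_cases hx : x ∈ tsupport fun x => η x * φ x
      · exact (hat x (h3 (hsup hx))).mul h1.contDiffAt
      · exact contDiffAt_const.congr_of_eventuallyEq (notMem_tsupport_iff_eventuallyEq.1 hx)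
    · filter_upwards [b1 y.fst, h4] with x e1 e2
      rw [← e2]; exact e1
    · filter_upwards [s3 y, h4, h5, hΩm] with x e1 e2 e3 hx
      rw [e1, e2, e3, gradient_mul ((hat x hx).differentiableAt (by simp))
        (h1.differentiable (by simp) x)]
  exact ⟨⟨F u.1, map_mem_closure hF u.2 hmaps⟩, b1 _, s3 _⟩

theorem continuous_setIntegral_norm_sq {F : Type*} [NormedAddCommGroup F] [InnerProductSpace ℝ F]
    (μ : Measure (EuclideanSpace ℝ (Fin d))) (S : Set (EuclideanSpace ℝ (Fin d))) :
    Continuous fun f : Lp F 2 μ => ∫ x in S, ‖f x‖ ^ 2 ∂μ := by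
  let r : Lp F 2 μ →L[ℝ] Lp F 2 (μ.restrict S) :=
    LpToLpRestrictCLM (EuclideanSpace ℝ (Fin d)) F ℝ μ 2 S
  have h : ∀ f : Lp F 2 μ, ∫ x in S, ‖f x‖ ^ 2 ∂μ = ‖r f‖ ^ 2 := by
    intro f
    rw [← real_inner_self_eq_norm_sq, L2.inner_def]
    refine integral_congr_ae ?_
    filter_upwards [LpToLpRestrictCLM_coeFn (X := EuclideanSpace ℝ (Fin d)) (F := F) ℝ
      (p := 2) (μ := μ) S f] with x hx
    change _ = inner ℝ (r f x) (r f x)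
    rw [real_inner_self_eq_norm_sq]
    exact congrArg (fun z => ‖z‖ ^ 2) hx.symm
  simp only [h]
  exact r.continuous.norm.pow 2

theorem integrable_norm_sq {F : Type*} [NormedAddCommGroup F]
    {μ : Measure (EuclideanSpace ℝ (Fin d))} (f : Lp F 2 μ) : Integrable (fun x => ‖f x‖ ^ 2) μ :=
  (Lp.memLp f).integrable_norm_pow (by norm_num)

theorem setIntegral_of_eq_zero {f : EuclideanSpace ℝ (Fin d) → ℝ}
    {S : Set (EuclideanSpace ℝ (Fin d))} (hS : MeasurableSet S) (hf : ∀ x, x ∉ Ω → f x = 0) :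
    ∫ x in S, f x ∂(volume.restrict Ω) = ∫ x in S, f x := by
  rw [← integral_indicator hS, ← integral_indicator hS]
  refine setIntegral_eq_integral_of_forall_compl_eq_zero fun x hx => ?_
  by_cases hxS : x ∈ S
  · rw [indicator_of_mem hxS, hf x hx]
  · rw [indicator_of_notMem hxS]

/-- The Poincaré inequality on an element, for functions in `H¹₀(Ω)` with vanishing mean on it. -/
theorem H10.poincare (K : BoxIntegral.Box (Fin d)) {D : ℝ}
    (hD : ∀ x ∈ cell K, ∀ y ∈ cell K, ‖y - x‖ ≤ D) (u : H10 Ω)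
    (h0 : ∫ x in cell K, H10.toL2 u x ∂(volume.restrict Ω) = 0) :
    ∫ x in cell K, H10.toL2 u x ^ 2 ∂(volume.restrict Ω) ≤
      2 ^ d * D ^ 2 * ∫ x in cell K, ‖H10.grad u x‖ ^ 2 ∂(volume.restrict Ω) := by
  have hcomp : IsCompact (cell K) := Metric.isCompact_of_isClosed_isBounded (isClosed_cell K)
    (isBounded_cell K)
  have hm := measurableSet_cell K
  have hpos : 0 < volume.real (cell K) := by
    refine ENNReal.toReal_pos ?_ hcomp.measure_lt_top.ne
    exact ((isOpen_interior.measure_pos volume (nonempty_interior_cell K)).trans_le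
      (measure_mono interior_subset)).ne'
  have hfin : (volume.restrict Ω) (cell K) ≠ ⊤ :=
    ((Measure.restrict_apply_le _ _).trans_lt hcomp.measure_lt_top).ne
  -- Approximating test functions need not have mean zero on K. The inequality is therefore extended
  -- by density with the mean kept as a term, and the mean is set to zero only afterwards.
  have key : ∀ u : H10 Ω, 2 * (volume.real (cell K) *
      (∫ x in cell K, ‖H10.toL2 u x‖ ^ 2 ∂(volume.restrict Ω)) -
      (∫ x in cell K, H10.toL2 u x ∂(volume.restrict Ω)) ^ 2) ≤
      2 ^ d * D ^ 2 * volume.real (cell K) *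
        ∫ x in cell K, ‖H10.grad u x‖ ^ 2 ∂(volume.restrict Ω) := by
    refine H10.induction_closed ?_ ?_
    · refine isClosed_le (continuous_const.mul ((continuous_const.mul
        ((continuous_setIntegral_norm_sq _ _).comp H10.toL2.continuous)).sub (Continuous.pow ?_ 2)))
        (continuous_const.mul ((continuous_setIntegral_norm_sq _ _).comp H10.grad.continuous))
      have : ∀ f : L2 Ω, ∫ x in cell K, f x ∂(volume.restrict Ω) =
          inner ℝ (indicatorConstLp 2 hm hfin (1 : ℝ)) f := fun f =>
        (L2.inner_indicatorConstLp_one hm hfin f).symm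
      simp only [this]
      exact continuous_const.inner H10.toL2.continuous
    · rintro u φ ⟨h1, h2, h3, h4, h5⟩
      have z1 : ∀ x, x ∉ Ω → φ x = 0 := fun x hx =>
        image_eq_zero_of_notMem_tsupport fun h => hx (h3 h)
      have z2 : ∀ x, x ∉ Ω → fderiv ℝ φ x = 0 := fun x hx =>
        image_eq_zero_of_notMem_tsupport fun h => hx (h3 (tsupport_fderiv_subset (𝕜 := ℝ) h))
      have e1 : ∫ x in cell K, ‖H10.toL2 u x‖ ^ 2 ∂(volume.restrict Ω) =
          ∫ x in cell K, φ x ^ 2 := by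
        rw [← setIntegral_of_eq_zero (Ω := Ω) hm fun x hx => by rw [z1 x hx]; simp]
        refine integral_congr_ae (ae_restrict_of_ae ?_)
        filter_upwards [h4] with x hx
        rw [hx, Real.norm_eq_abs, sq_abs]
      have e2 : ∫ x in cell K, H10.toL2 u x ∂(volume.restrict Ω) = ∫ x in cell K, φ x := by
        rw [← setIntegral_of_eq_zero (Ω := Ω) hm z1]
        exact integral_congr_ae (ae_restrict_of_ae h4)
      have e3 : ∫ x in cell K, ‖H10.grad u x‖ ^ 2 ∂(volume.restrict Ω) =
          ∫ x in cell K, ‖fderiv ℝ φ x‖ ^ 2 := by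
        rw [← setIntegral_of_eq_zero (Ω := Ω) hm fun x hx => by rw [z2 x hx]; simp]
        refine integral_congr_ae (ae_restrict_of_ae ?_)
        filter_upwards [h5] with x hx
        rw [hx, norm_gradient]
      rw [e1, e2, e3]
      exact poincare_of_contDiff hcomp (convex_cell K) hD (h1.of_le (by simp))
  have h := key u
  simp only [h0, Real.norm_eq_abs, sq_abs] at h
  have hI : 0 ≤ ∫ x in cell K, H10.toL2 u x ^ 2 ∂(volume.restrict Ω) :=
    integral_nonneg fun x => sq_nonneg _
  refine le_of_mul_le_mul_left ?_ hpos
  nlinarith [mul_nonneg hpos.le hI]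

/-! ### The kernel of the projection -/

theorem memLp_eval_cell (K : BoxIntegral.Box (Fin d)) (q : MvPolynomial (Fin d) ℝ) :
    MemLp ((cell K).indicator fun x : EuclideanSpace ℝ (Fin d) =>
      MvPolynomial.eval (fun i => x i) q)
      2 (volume.restrict Ω) := by
  have hcomp : IsCompact (cell K) := Metric.isCompact_of_isClosed_isBounded (isClosed_cell K)
    (isBounded_cell K)
  have hc : Continuous fun x : EuclideanSpace ℝ (Fin d) => MvPolynomial.eval (fun i => x i) q :=
    (MvPolynomial.continuous_eval q).comp (by fun_prop)
  rw [memLp_indicator_iff_restrict (measurableSet_cell K)]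
  obtain ⟨C, hC⟩ := hcomp.exists_bound_of_continuousOn hc.continuousOn
  have hfin : IsFiniteMeasure ((volume.restrict Ω).restrict (cell K)) :=
    ⟨by
      rw [Measure.restrict_apply_univ]
      exact (Measure.restrict_apply_le _ _).trans_lt hcomp.measure_lt_top⟩
  refine MemLp.of_bound hc.aestronglyMeasurable C ?_
  filter_upwards [ae_restrict_mem (measurableSet_cell K)] with x hx using hC x hx

/-- V_H imposes no continuity between elements: a polynomial on one element, extended by zero,
belongs to it. Orthogonality to V_H thus decouples into moment conditions on each element. -/
theorem Mesh.mem_kerProj_iff (hΩ : IsOpen Ω) (T : Mesh Ω) (p : ℕ) (w : H10 Ω) :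
    w ∈ T.kerProj p ↔ ∀ K ∈ T.cells, ∀ q ∈ MvPolynomial.restrictDegree (Fin d) ℝ p,
      ∫ x in cell K, MvPolynomial.eval (fun i => x i) q * H10.toL2 w x
        ∂(volume.restrict Ω) = 0 := by
  have h1 : w ∈ T.kerProj p ↔ H10.toL2 w ∈ (T.polySpace p)ᗮ := by
    change T.proj p (H10.toL2 w) = 0 ↔ _
    exact Submodule.starProjection_apply_eq_zero_iff _
  rw [h1, Submodule.mem_orthogonal]
  constructor
  · intro h K hK q hq
    have hm := memLp_eval_cell (Ω := Ω) K q
    have hmem : hm.toLp _ ∈ T.polySpace p := by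
      intro K' hK'
      by_cases hKK : K = K'
      · subst hKK
        refine ⟨q, hq, ?_⟩
        filter_upwards [hm.coeFn_toLp] with x hx hxK
        rw [hx, indicator_of_mem hxK]
      · refine ⟨0, Submodule.zero_mem _, ?_⟩
        filter_upwards [hm.coeFn_toLp, T.ae_unique_cell hK' hK (Ne.symm hKK)] with x hx hxn hxK
        rw [hx, indicator_of_notMem (hxn hxK), map_zero]
    have := h _ hmem
    rw [L2.inner_def] at this
    rw [← this, ← integral_indicator (measurableSet_cell K)]
    refine integral_congr_ae ?_
    filter_upwards [hm.coeFn_toLp] with x hx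
    rw [hx]
    by_cases hxK : x ∈ cell K
    · simp [indicator_of_mem hxK, mul_comm]
    · simp [indicator_of_notMem hxK]
  · intro h v hv
    rw [L2.inner_def, T.integral_eq_sum hΩ (L2.integrable_inner _ _)]
    refine Finset.sum_eq_zero fun K hK => ?_
    obtain ⟨q, hq, hvq⟩ := hv K hK
    rw [← h K hK q hq]
    refine integral_congr_ae ?_
    filter_upwards [ae_restrict_of_ae hvq, ae_restrict_mem (measurableSet_cell K)] with x hx hxK
    rw [hx hxK]
    simp [mul_comm]

/-! ### Bubble functions dual to polynomials -/

/-- The multi-indices of partial degree at most `p`. -/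
abbrev MultiIndex (d p : ℕ) : Type := Fin d → Fin (p + 1)

/-- The monomial with exponents `k`. -/
def mono {p : ℕ} (k : MultiIndex d p) (x : EuclideanSpace ℝ (Fin d)) : ℝ :=
  ∏ i, x i ^ (k i : ℕ)

theorem continuous_mono {p : ℕ} (k : MultiIndex d p) : Continuous (mono k) := by
  unfold mono; fun_prop

theorem exists_affine_pow_eq (p : ℕ) (s t : ℝ) (m : Fin (p + 1)) :
    ∃ c : Fin (p + 1) → ℝ, ∀ y : ℝ, (s + t * y) ^ (m : ℕ) = ∑ j, c j * y ^ (j : ℕ) := by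
  refine ⟨fun j => t ^ (j : ℕ) * s ^ ((m : ℕ) - j) * ((m : ℕ).choose j), fun y => ?_⟩
  rw [Fin.sum_univ_eq_sum_range
    (fun j => t ^ j * s ^ ((m : ℕ) - j) * ((m : ℕ).choose j) * y ^ j), add_comm, add_pow]
  have hsub : Finset.range ((m : ℕ) + 1) ⊆ Finset.range (p + 1) :=
    Finset.range_mono (by have := m.2; omega)
  rw [← Finset.sum_subset hsub fun j _ hj => ?_]
  · refine Finset.sum_congr rfl fun j _ => ?_
    rw [mul_pow]; ring
  · rw [Nat.choose_eq_zero_of_lt (by simpa using hj)]; simp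

/-- Monomials in affinely transformed coordinates are combinations of monomials. -/
theorem exists_prod_affine_pow_eq {p : ℕ} (s t : Fin d → ℝ) (k : MultiIndex d p) :
    ∃ c : MultiIndex d p → ℝ, ∀ y : EuclideanSpace ℝ (Fin d),
      ∏ i, (s i + t i * y i) ^ (k i : ℕ) = ∑ j, c j * mono j y := by
  choose c hc using fun i => exists_affine_pow_eq p (s i) (t i) (k i)
  refine ⟨fun j => ∏ i, c i (j i), fun y => ?_⟩
  simp only [hc, mono]
  rw [Finset.prod_univ_sum, Fintype.piFinset_univ]
  exact Finset.sum_congr rfl fun j _ => Finset.prod_mul_distrib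

theorem eval_monomial_eq (n : Fin d →₀ ℕ) (x : Fin d → ℝ) :
    MvPolynomial.eval x (MvPolynomial.monomial n 1) = ∏ i, x i ^ n i := by
  rw [MvPolynomial.eval_monomial, one_mul, Finsupp.prod_fintype _ _ fun i => pow_zero _]

theorem exists_eval_eq_sum_mono {p : ℕ} {q : MvPolynomial (Fin d) ℝ}
    (hq : q ∈ MvPolynomial.restrictDegree (Fin d) ℝ p) :
    ∃ c : MultiIndex d p → ℝ, ∀ x : EuclideanSpace ℝ (Fin d),
      MvPolynomial.eval (fun i => x i) q = ∑ j, c j * mono j x := by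
  classical
  have key : ∀ n ∈ q.support, ∃ k : MultiIndex d p, ∀ x : EuclideanSpace ℝ (Fin d),
      ∏ i, x i ^ n i = mono k x := fun n hn =>
    ⟨fun i => ⟨n i, Nat.lt_succ_of_le ((MvPolynomial.mem_restrictDegree (Fin d) q p).1 hq n hn i)⟩,
      fun x => rfl⟩
  choose! k hk using key
  refine ⟨fun j => ∑ n ∈ q.support with k n = j, q.coeff n, fun x => ?_⟩
  rw [MvPolynomial.eval_eq']
  simp only [Finset.sum_mul]
  rw [← Finset.sum_fiberwise_of_maps_to (s := q.support) (t := Finset.univ) (g := k)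
    fun _ _ => Finset.mem_univ _]
  refine Finset.sum_congr rfl fun j _ => Finset.sum_congr rfl fun n hn => ?_
  rw [Finset.mem_filter] at hn
  rw [hk n hn.1, hn.2]

/-- The last clause carries the linear independence of the monomials over to the functions `mono`.
-/
theorem exists_mvPolynomial_eq_mono {p : ℕ} (c : MultiIndex d p → ℝ) :
    ∃ q ∈ MvPolynomial.restrictDegree (Fin d) ℝ p,
      (∀ x : EuclideanSpace ℝ (Fin d),
        MvPolynomial.eval (fun i => x i) q = ∑ j, c j * mono j x) ∧ (q = 0 → c = 0) := by
  classical
  let n : MultiIndex d p → (Fin d →₀ ℕ) := fun k => Finsupp.equivFunOnFinite.symm fun i => (k i : ℕ)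
  have hn : Function.Injective n := by
    intro k k' h
    have := Finsupp.equivFunOnFinite.symm.injective h
    funext i
    exact Fin.ext (congrFun this i)
  refine ⟨∑ j, c j • MvPolynomial.monomial (n j) 1, ?_, fun x => ?_, fun h => ?_⟩
  · refine Submodule.sum_mem _ fun j _ => Submodule.smul_mem _ _ ?_
    rw [MvPolynomial.mem_restrictDegree]
    intro s hs i
    rw [Finset.mem_singleton.1 (MvPolynomial.support_monomial_subset hs)]
    exact Nat.le_of_lt_succ (j i).2
  · rw [map_sum]
    refine Finset.sum_congr rfl fun j _ => ?_
    rw [MvPolynomial.smul_eval, eval_monomial_eq]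
    rfl
  · funext j
    have := congrArg (MvPolynomial.coeff (n j)) h
    simpa [MvPolynomial.coeff_sum, MvPolynomial.coeff_monomial, hn.eq_iff] using this

/-- The open unit cube. -/
def unitCube (d : ℕ) : Set (EuclideanSpace ℝ (Fin d)) := {x | ∀ i, x i ∈ Ioo (0 : ℝ) 1}

theorem isOpen_unitCube : IsOpen (unitCube d) := by
  simp only [unitCube, mem_Ioo, ofPred_forall, ofPred_and]
  refine isOpen_iInter_of_finite fun i => IsOpen.inter ?_ ?_
  · exact isOpen_lt continuous_const (by fun_prop)
  · exact isOpen_lt (by fun_prop) continuous_const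

/-- A polynomial that vanishes on a product of infinite sets is zero. -/
theorem eq_zero_of_sum_mono_eq_zero {p : ℕ} {c : MultiIndex d p → ℝ}
    (h : ∀ x ∈ unitCube d, ∑ j, c j * mono j x = 0) : c = 0 := by
  obtain ⟨q, -, hq, hc⟩ := exists_mvPolynomial_eq_mono c
  refine hc (MvPolynomial.funext_set (fun _ => Ioo (0 : ℝ) 1) (fun _ => Ioo_infinite zero_lt_one)
    fun x hx => ?_)
  have hx' : ∀ i, x i ∈ Ioo (0 : ℝ) 1 := fun i => hx i (mem_univ i)
  rw [map_zero, ← h (WithLp.toLp 2 x) hx']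
  exact hq (WithLp.toLp 2 x)

/-- Smooth functions with compact support in the unit cube that are dual to the monomials. -/
theorem exists_dual_bubbles (d p : ℕ) : ∃ b : MultiIndex d p → EuclideanSpace ℝ (Fin d) → ℝ,
    (∀ k, ContDiff ℝ ∞ (b k) ∧ HasCompactSupport (b k) ∧ tsupport (b k) ⊆ unitCube d) ∧
    ∀ k j, ∫ x, b k x * mono j x = if k = j then 1 else 0 := by
  classical
  have hint : ∀ {φ : EuclideanSpace ℝ (Fin d) → ℝ}, ContDiff ℝ ∞ φ → HasCompactSupport φ →
      ∀ j : MultiIndex d p, Integrable fun x => φ x * mono j x := fun h1 h2 j =>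
    (h1.continuous.mul (continuous_mono j)).integrable_of_hasCompactSupport h2.mul_right
  -- The moment vectors attained by smooth functions with compact support in the cube. Dual bubbles
  -- exist once this is the whole space.
  let V : Submodule ℝ (MultiIndex d p → ℝ) :=
    { carrier := {y | ∃ φ : EuclideanSpace ℝ (Fin d) → ℝ, (ContDiff ℝ ∞ φ ∧ HasCompactSupport φ ∧
        tsupport φ ⊆ unitCube d) ∧ ∀ j, ∫ x, φ x * mono j x = y j}
      zero_mem' := ⟨0, ⟨contDiff_const, HasCompactSupport.zero, by simp [tsupport]⟩, by simp⟩
      add_mem' := by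
        rintro y z ⟨φ, ⟨h1, h2, h3⟩, h4⟩ ⟨ψ, ⟨k1, k2, k3⟩, k4⟩
        refine ⟨φ + ψ, ⟨h1.add k1, h2.add k2, (tsupport_add φ ψ).trans (union_subset h3 k3)⟩,
          fun j => ?_⟩
        simp only [Pi.add_apply, add_mul]
        rw [integral_add (hint h1 h2 j) (hint k1 k2 j), h4, k4]
      smul_mem' := by
        rintro c y ⟨φ, ⟨h1, h2, h3⟩, h4⟩
        refine ⟨c • φ, ⟨contDiff_const.smul h1, h2.smul_left (f := fun _ => c),
          (closure_mono (Function.support_const_smul_subset c φ)).trans h3⟩, fun j => ?_⟩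
        simp only [Pi.smul_apply, smul_eq_mul, mul_assoc]
        rw [integral_const_mul, h4] }
  have hV : V = ⊤ := by
    by_contra hne
    obtain ⟨f, hf, hVf⟩ := V.exists_le_ker_of_lt_top (lt_top_iff_ne_top.2 hne)
    refine hf ?_
    let c : MultiIndex d p → ℝ := fun j => f (Pi.single j 1)
    have hfc : ∀ y, f y = ∑ j, y j * c j := fun y => by
      conv_lhs => rw [← Finset.univ_sum_single y]
      rw [map_sum]
      refine Finset.sum_congr rfl fun j _ => ?_
      have : Pi.single j (y j) = y j • (Pi.single j 1 : MultiIndex d p → ℝ) := by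
        rw [← Pi.single_smul, smul_eq_mul, mul_one]
      rw [this, map_smul, smul_eq_mul]
    have hR : Continuous fun x : EuclideanSpace ℝ (Fin d) => ∑ j, c j * mono j x :=
      continuous_finsetSum _ fun j _ => continuous_const.mul (continuous_mono j)
    -- A functional c that kills all moment vectors says that the polynomial with coefficients c
    -- integrates to zero against every test function. It is then zero on the cube, so c = 0.
    have hae := isOpen_unitCube.ae_eq_zero_of_integral_contDiff_smul_eq_zero (μ := volume)
      (hR.locallyIntegrable.locallyIntegrableOn (unitCube d)) (by
        intro φ h1 h2 h3
        have : f (fun j => ∫ x, φ x * mono j x) = 0 := hVf ⟨φ, ⟨h1, h2, h3⟩, fun j => rfl⟩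
        rw [hfc] at this
        rw [← this]
        simp only [smul_eq_mul, Finset.mul_sum]
        rw [integral_finsetSum _ fun j _ => ?_]
        · refine Finset.sum_congr rfl fun j _ => ?_
          rw [← integral_mul_const]
          exact integral_congr_ae (Eventually.of_forall fun x => by dsimp only; ring)
        · have := (hint h1 h2 j).const_mul (c j)
          refine this.congr (Eventually.of_forall fun x => by dsimp only; ring))
    have hae' : (fun x : EuclideanSpace ℝ (Fin d) => ∑ j, c j * mono j x)
        =ᵐ[volume.restrict (unitCube d)] fun _ => 0 :=
      (ae_restrict_iff' isOpen_unitCube.measurableSet).2 hae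
    have hc0 : c = 0 := eq_zero_of_sum_mono_eq_zero
      (Measure.eqOn_open_of_ae_eq hae' isOpen_unitCube hR.continuousOn continuousOn_const)
    refine LinearMap.ext fun y => ?_
    rw [hfc, hc0]; simp
  have hex : ∀ k : MultiIndex d p, ∃ φ : EuclideanSpace ℝ (Fin d) → ℝ,
      (ContDiff ℝ ∞ φ ∧ HasCompactSupport φ ∧ tsupport φ ⊆ unitCube d) ∧
      ∀ j, ∫ x, φ x * mono j x = (Pi.single k 1 : MultiIndex d p → ℝ) j := fun k => by
    have : (Pi.single k 1 : MultiIndex d p → ℝ) ∈ V := hV ▸ Submodule.mem_top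
    exact this
  choose b hb hb' using hex
  refine ⟨b, hb, fun k j => ?_⟩
  rw [hb', Pi.single_apply]
  simp only [eq_comm]

/-! ### Scaling to an element -/

/-- The linear part of the map of the rectangle `K` onto the unit cube. -/
noncomputable def scaleLin (K : BoxIntegral.Box (Fin d)) :
    EuclideanSpace ℝ (Fin d) →L[ℝ] EuclideanSpace ℝ (Fin d) :=
  LinearMap.toContinuousLinearMap
    { toFun := fun x => WithLp.toLp 2 fun i => (K.upper i - K.lower i)⁻¹ * x i
      map_add' := fun x y => by ext i; simp [mul_add]
      map_smul' := fun c x => by ext i; simp; ring }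

theorem scaleLin_apply (K : BoxIntegral.Box (Fin d)) (x : EuclideanSpace ℝ (Fin d)) (i : Fin d) :
    scaleLin K x i = (K.upper i - K.lower i)⁻¹ * x i := rfl

/-- The affine map of the rectangle `K` onto the unit cube. -/
noncomputable def scale (K : BoxIntegral.Box (Fin d)) (x : EuclideanSpace ℝ (Fin d)) :
    EuclideanSpace ℝ (Fin d) :=
  scaleLin K (x - WithLp.toLp 2 K.lower)

section scale

variable (K : BoxIntegral.Box (Fin d))

theorem scale_apply (x : EuclideanSpace ℝ (Fin d)) (i : Fin d) :
    scale K x i = (K.upper i - K.lower i)⁻¹ * (x i - K.lower i) := rfl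

theorem side_pos (i : Fin d) : 0 < K.upper i - K.lower i := sub_pos.2 (K.lower_lt_upper i)

theorem contDiff_scale : ContDiff ℝ ∞ (scale K) :=
  (scaleLin K).contDiff.comp (contDiff_id.sub contDiff_const)

theorem hasFDerivAt_scale (x : EuclideanSpace ℝ (Fin d)) :
    HasFDerivAt (scale K) (scaleLin K) x := by
  have := (scaleLin K).hasFDerivAt.comp x ((hasFDerivAt_id x).sub_const (WithLp.toLp 2 K.lower))
  exact this

theorem norm_scaleLin_le {h : ℝ} (hh : 0 < h) (hside : ∀ i, h ≤ K.upper i - K.lower i) :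
    ‖scaleLin K‖ ≤ h⁻¹ := by
  refine ContinuousLinearMap.opNorm_le_bound _ (by positivity) fun x => ?_
  refine le_of_sq_le_sq ?_ (by positivity)
  rw [mul_pow, EuclideanSpace.norm_sq_eq, EuclideanSpace.norm_sq_eq, Finset.mul_sum]
  refine Finset.sum_le_sum fun i _ => ?_
  rw [scaleLin_apply, norm_mul, mul_pow]
  refine mul_le_mul_of_nonneg_right (pow_le_pow_left₀ (norm_nonneg _) ?_ 2) (sq_nonneg _)
  rw [Real.norm_eq_abs, abs_of_pos (inv_pos.2 (side_pos K i))]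
  exact inv_anti₀ hh (hside i)

theorem scale_mem_unitCube {x : EuclideanSpace ℝ (Fin d)} :
    scale K x ∈ unitCube d ↔ x ∈ interior (cell K) := by
  rw [interior_cell]
  refine forall_congr' fun i => ?_
  rw [scale_apply, mem_Ioo, mem_Ioo, inv_mul_lt_one₀ (side_pos K i),
    mul_pos_iff_of_pos_left (inv_pos.2 (side_pos K i)), sub_pos, sub_lt_sub_iff_right]

theorem scale_mem_Icc {x : EuclideanSpace ℝ (Fin d)} (hx : x ∈ cell K) (i : Fin d) :
    scale K x i ∈ Icc (0 : ℝ) 1 := by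
  obtain ⟨h1, h2⟩ := hx i
  rw [scale_apply]
  exact ⟨mul_nonneg (inv_pos.2 (side_pos K i)).le (by linarith),
    (inv_mul_le_one₀ (side_pos K i)).2 (by linarith)⟩

/-- The inverse of `scale K`. -/
def unscale (y : EuclideanSpace ℝ (Fin d)) : EuclideanSpace ℝ (Fin d) :=
  WithLp.toLp 2 fun i => K.lower i + (K.upper i - K.lower i) * y i

theorem continuous_unscale : Continuous (unscale K) := by
  unfold unscale; fun_prop

theorem unscale_scale (x : EuclideanSpace ℝ (Fin d)) : unscale K (scale K x) = x := by
  ext i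
  have := (side_pos K i).ne'
  simp only [unscale, scale_apply]
  field_simp
  ring

/-- The factor m is the inverse modulus of the determinant. Its explicit value plays no role: it
cancels in the estimates of the correction. -/
theorem exists_integral_comp_scale : ∃ m : ℝ, 0 < m ∧ ∀ f : EuclideanSpace ℝ (Fin d) → ℝ,
    Measurable f → ∫ x, f (scale K x) = m * ∫ y, f y := by
  have hdet : LinearMap.det (scaleLin K : EuclideanSpace ℝ (Fin d) →ₗ[ℝ] EuclideanSpace ℝ (Fin d))
      ≠ 0 := by
    intro h0
    refine (LinearMap.bot_lt_ker_of_det_eq_zero h0).ne' ?_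
    refine LinearMap.ker_eq_bot'.2 fun x hx => ?_
    ext i
    have : scaleLin K x i = 0 := by
      change (scaleLin K : EuclideanSpace ℝ (Fin d) →ₗ[ℝ] EuclideanSpace ℝ (Fin d)) x i = 0
      rw [hx]; rfl
    rw [scaleLin_apply] at this
    exact (mul_eq_zero.1 this).resolve_left (inv_pos.2 (side_pos K i)).ne'
  refine ⟨|(LinearMap.det (scaleLin K : EuclideanSpace ℝ (Fin d) →ₗ[ℝ]
    EuclideanSpace ℝ (Fin d)))⁻¹|, by positivity, fun f hf => ?_⟩
  unfold scale
  rw [integral_sub_right_eq_self (fun x => f (scaleLin K x)) (WithLp.toLp 2 K.lower)]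
  have h := Measure.map_linearMap_addHaar_eq_smul_addHaar
    (volume : Measure (EuclideanSpace ℝ (Fin d))) hdet
  have h2 : ∫ x, f (scaleLin K x) = ∫ y, f y ∂(Measure.map (scaleLin K) volume) :=
    (integral_map (scaleLin K).continuous.measurable.aemeasurable
      hf.stronglyMeasurable.aestronglyMeasurable).symm
  rw [h2]
  erw [h]
  rw [integral_smul_measure, ENNReal.toReal_ofReal (abs_nonneg _), smul_eq_mul]

end scale

/-- Scaled bubble functions in a rectangle and the polynomials to which they are dual. -/
theorem exists_scaled_bubbles (d p : ℕ) : ∃ C : ℝ, 0 ≤ C ∧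
    ∀ (K : BoxIntegral.Box (Fin d)) (h : ℝ), 0 < h → (∀ i, h ≤ K.upper i - K.lower i) →
    ∃ (b ρ : MultiIndex d p → EuclideanSpace ℝ (Fin d) → ℝ) (m : ℝ), 0 < m ∧
      volume.real (cell K) ≤ C * m ∧
      (∀ k, ContDiff ℝ ∞ (b k) ∧ HasCompactSupport (b k) ∧ tsupport (b k) ⊆ interior (cell K)) ∧
      (∀ k x, ‖fderiv ℝ (b k) x‖ ≤ C / h) ∧
      (∀ k, ∀ x ∈ cell K, |ρ k x| ≤ 1) ∧
      (∀ k j, ∫ x, b k x * ρ j x = if k = j then m else 0) ∧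
      (∀ k, ∃ q ∈ MvPolynomial.restrictDegree (Fin d) ℝ p, ∀ x : EuclideanSpace ℝ (Fin d),
        MvPolynomial.eval (fun i => x i) q = ρ k x) ∧
      ∀ q ∈ MvPolynomial.restrictDegree (Fin d) ℝ p, ∃ c : MultiIndex d p → ℝ,
        ∀ x : EuclideanSpace ℝ (Fin d), MvPolynomial.eval (fun i => x i) q = ∑ k, c k * ρ k x := by
  classical
  obtain ⟨b, hb, hdual⟩ := exists_dual_bubbles d p
  have hM : ∀ k, ∃ M, ∀ x, ‖fderiv ℝ (b k) x‖ ≤ M := fun k =>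
    ((hb k).2.1.fderiv ℝ).exists_bound_of_continuous ((hb k).1.continuous_fderiv (by simp))
  choose M hM using hM
  have hM0 : ∀ k, 0 ≤ M k := fun k => (norm_nonneg _).trans (hM k 0)
  have hMs : ∀ k, M k ≤ ∑ j, M j := fun k =>
    Finset.single_le_sum (fun j _ => hM0 j) (Finset.mem_univ k)
  let Q : Set (EuclideanSpace ℝ (Fin d)) := {y | ∀ i, y i ∈ Icc (0 : ℝ) 1}
  have hQm : MeasurableSet Q := by
    have : Q = ⋂ i, {y : EuclideanSpace ℝ (Fin d) | y i ∈ Icc (0 : ℝ) 1} := by ext; simp [Q]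
    rw [this]
    exact MeasurableSet.iInter fun i =>
      (by fun_prop : Measurable fun y : EuclideanSpace ℝ (Fin d) => y i) measurableSet_Icc
  -- One constant for both bounds: the sum controls the gradients of all reference bubbles, and the
  -- volume of the reference cube controls volume(K) / m.
  refine ⟨∑ j, M j + volume.real Q, add_nonneg (Finset.sum_nonneg fun j _ => hM0 j)
    measureReal_nonneg, fun K h hh hside => ?_⟩
  obtain ⟨m, hm, hint⟩ := exists_integral_comp_scale K
  have hcd : ∀ k, ContDiff ℝ ∞ fun x => b k (scale K x) := fun k =>
    (hb k).1.comp (contDiff_scale K)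
  have hsupp : ∀ k, (fun x => b k (scale K x)).support ⊆ unscale K '' tsupport (b k) :=
    fun k x hx => ⟨scale K x, subset_tsupport _ hx, unscale_scale K x⟩
  have hcomp : ∀ k, IsCompact (unscale K '' tsupport (b k)) := fun k =>
    (hb k).2.1.isCompact.image (continuous_unscale K)
  have hts : ∀ k, tsupport (fun x => b k (scale K x)) ⊆ scale K ⁻¹' tsupport (b k) := fun k =>
    closure_minimal (fun x hx => subset_tsupport _ hx)
      ((isClosed_tsupport _).preimage (contDiff_scale K).continuous)
  refine ⟨fun k x => b k (scale K x), fun k x => mono k (scale K x), m, hm, ?_, fun k =>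
    ⟨hcd k, HasCompactSupport.of_support_subset_isCompact (hcomp k) (hsupp k), ?_⟩, ?_, ?_, ?_,
    ?_, ?_⟩
  -- The transformation rule for the indicator of the closed cube gives volume(K) = m volume(Q).
  · have h1 := hint (Q.indicator fun _ => 1) (measurable_const.indicator hQm)
    have h2 : (fun x => Q.indicator (fun _ => (1 : ℝ)) (scale K x)) =
        (scale K ⁻¹' Q).indicator fun _ => (1 : ℝ) := rfl
    have hQK : MeasurableSet (scale K ⁻¹' Q) := (contDiff_scale K).continuous.measurable hQm
    have hQK' : scale K ⁻¹' Q = cell K := by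
      ext x
      refine ⟨fun hx i => ?_, fun hx i => scale_mem_Icc K hx i⟩
      have hi : scale K x i ∈ Icc (0 : ℝ) 1 := hx i
      rw [scale_apply, mem_Icc, inv_mul_le_one₀ (side_pos K i)] at hi
      have := (mul_nonneg_iff_of_pos_left (inv_pos.2 (side_pos K i))).1 hi.1
      exact ⟨by linarith, by linarith [hi.2]⟩
    rw [h2, integral_indicator hQK, integral_indicator hQm] at h1
    simp only [integral_const, smul_eq_mul, mul_one, measureReal_restrict_apply_univ] at h1
    rw [hQK'] at h1
    rw [h1, mul_comm]
    refine mul_le_mul_of_nonneg_right ?_ hm.le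
    linarith [Finset.sum_nonneg fun j (_ : j ∈ Finset.univ) => hM0 j]
  · exact fun x hx => (scale_mem_unitCube K).1 ((hb k).2.2 (hts k hx))
  · intro k x
    have : HasFDerivAt (fun x => b k (scale K x))
        ((fderiv ℝ (b k) (scale K x)).comp (scaleLin K)) x :=
      ((hb k).1.differentiable (by simp) _).hasFDerivAt.comp x (hasFDerivAt_scale K x)
    rw [this.fderiv, div_eq_mul_inv]
    refine (ContinuousLinearMap.opNorm_comp_le _ _).trans
      (mul_le_mul ?_ (norm_scaleLin_le K hh hside) (norm_nonneg _) ?_)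
    · exact (hM k _).trans ((hMs k).trans (by linarith [measureReal_nonneg (μ := volume) (s := Q)]))
    · exact add_nonneg (Finset.sum_nonneg fun j _ => hM0 j) measureReal_nonneg
  · intro k x hx
    unfold mono
    rw [Finset.abs_prod]
    refine Finset.prod_le_one (fun i _ => abs_nonneg _) fun i _ => ?_
    obtain ⟨h1, h2⟩ := scale_mem_Icc K hx i
    rw [abs_of_nonneg (pow_nonneg h1 _)]
    exact pow_le_one₀ h1 h2
  · intro k j
    rw [hint (fun y => b k y * mono j y)
      ((hb k).1.continuous.mul (continuous_mono j)).measurable, hdual]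
    simp
  · intro k
    obtain ⟨c, hc⟩ := exists_prod_affine_pow_eq
      (fun i => -((K.upper i - K.lower i)⁻¹ * K.lower i)) (fun i => (K.upper i - K.lower i)⁻¹) k
    obtain ⟨q, hq, hqe, -⟩ := exists_mvPolynomial_eq_mono c
    refine ⟨q, hq, fun x => ?_⟩
    rw [hqe, ← hc]
    refine Finset.prod_congr rfl fun i _ => ?_
    rw [scale_apply]
    congr 1
    ring
  · intro q hq
    obtain ⟨c, hc⟩ := exists_eval_eq_sum_mono hq
    choose c' hc' using fun j : MultiIndex d p =>
      exists_prod_affine_pow_eq K.lower (fun i => K.upper i - K.lower i) j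
    refine ⟨fun k => ∑ j, c j * c' j k, fun x => ?_⟩
    rw [hc]
    simp only [Finset.sum_mul]
    rw [Finset.sum_comm]
    refine Finset.sum_congr rfl fun j _ => ?_
    have : mono j x = ∑ k, c' j k * mono k (scale K x) := by
      rw [← hc']
      conv_lhs => rw [← unscale_scale K x]
      rfl
    rw [this, Finset.mul_sum]
    exact Finset.sum_congr rfl fun k _ => (mul_assoc _ _ _).symm

/-! ### Correction by bubble functions -/

theorem sq_integral_mul_le {X : Type*} [MeasurableSpace X] {μ : Measure X} {f g : X → ℝ}
    (hf : MemLp f 2 μ) (hg : MemLp g 2 μ) :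
    (∫ x, f x * g x ∂μ) ^ 2 ≤ (∫ x, f x ^ 2 ∂μ) * ∫ x, g x ^ 2 ∂μ := by
  have e : ∀ {f g : X → ℝ} (hf : MemLp f 2 μ) (hg : MemLp g 2 μ),
      (inner ℝ (hf.toLp f) (hg.toLp g) : ℝ) = ∫ x, f x * g x ∂μ := by
    intro f g hf hg
    rw [L2.inner_def]
    refine integral_congr_ae ?_
    filter_upwards [hf.coeFn_toLp, hg.coeFn_toLp] with x h1 h2
    rw [h1, h2]
    simp [mul_comm]
  have h := real_inner_mul_inner_self_le (hf.toLp f) (hg.toLp g)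
  rw [e, e, e] at h
  simpa only [sq] using h

theorem integrableOn_eval_mul (K : BoxIntegral.Box (Fin d)) (q : MvPolynomial (Fin d) ℝ)
    (w : L2 Ω) : IntegrableOn (fun x : EuclideanSpace ℝ (Fin d) =>
      MvPolynomial.eval (fun i => x i) q * w x) (cell K) (volume.restrict Ω) := by
  have h := ((memLp_indicator_iff_restrict (measurableSet_cell K)).1
    (memLp_eval_cell (Ω := Ω) K q)).integrable_mul ((Lp.memLp w).restrict (cell K))
  exact h

/-- On K take ∑ γ_k b_k with γ_k = m⁻¹ ∫ ρ_k u. Duality reproduces all moments of u up to partial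
degree p, and if these vanish on K, so does the correction. Cauchy–Schwarz gives γ_k² ≤ C ‖u‖² / m
with the norm over K. As the bubbles have gradients of size C / h and K has volume at most C m, the
factor m cancels in the energy. -/
theorem exists_corrector (d p : ℕ) : ∃ C : ℝ, 0 ≤ C ∧
    ∀ (Ω : Set (EuclideanSpace ℝ (Fin d))) (_ : IsLipschitzDomain Ω) (T : Mesh Ω) (h : ℝ)
    (_ : 0 < h) (_ : ∀ K ∈ T.cells, ∀ i, h ≤ K.upper i - K.lower i) (u : H10 Ω), ∃ b : H10 Ω,
    (∀ K ∈ T.cells, ∀ q ∈ MvPolynomial.restrictDegree (Fin d) ℝ p,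
      ∫ x in cell K, MvPolynomial.eval (fun i => x i) q * H10.toL2 b x ∂(volume.restrict Ω) =
      ∫ x in cell K, MvPolynomial.eval (fun i => x i) q * H10.toL2 u x ∂(volume.restrict Ω)) ∧
    (∀ K ∈ T.cells, ∫ x in cell K, ‖H10.grad b x‖ ^ 2 ∂(volume.restrict Ω) ≤
      C / h ^ 2 * ∫ x in cell K, H10.toL2 u x ^ 2 ∂(volume.restrict Ω)) ∧
    (∀ K ∈ T.cells, (∀ q ∈ MvPolynomial.restrictDegree (Fin d) ℝ p,
      ∫ x in cell K, MvPolynomial.eval (fun i => x i) q * H10.toL2 u x ∂(volume.restrict Ω) = 0) →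
      ∀ᵐ x ∂(volume.restrict Ω), x ∈ cell K → H10.toL2 b x = 0 ∧ H10.grad b x = 0) := by
  classical
  obtain ⟨C, hC0, hC⟩ := exists_scaled_bubbles d p
  -- Of the four factors C, two come from the squared gradients, one from the coefficients and one
  -- from the volume. The squared cardinality comes from bounding (∑ |γ_k|)².
  refine ⟨C ^ 4 * (Fintype.card (MultiIndex d p)) ^ 2, by positivity, ?_⟩
  intro Ω hΩ T h hh hside u
  have hex := fun K (hK : K ∈ T.cells) => hC K h hh (hside K hK)
  choose! b ρ m hm hvol hb hgrad hρ hdual hρq hqρ using hex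
  let γ : BoxIntegral.Box (Fin d) → MultiIndex d p → ℝ := fun K k =>
    (m K)⁻¹ * ∫ x in cell K, ρ K k x * H10.toL2 u x ∂(volume.restrict Ω)
  let f : BoxIntegral.Box (Fin d) → EuclideanSpace ℝ (Fin d) → ℝ := fun K x =>
    ∑ k, γ K k * b K k x
  have hf1 : ∀ K ∈ T.cells, ContDiff ℝ ∞ (f K) := fun K hK =>
    ContDiff.sum fun k _ => contDiff_const.mul (hb K hK k).1
  have hfs : ∀ K, (f K).support ⊆ ⋃ k, tsupport (b K k) := by
    intro K x hx
    obtain ⟨k, -, hk⟩ := Finset.exists_ne_zero_of_sum_ne_zero hx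
    exact mem_iUnion.2 ⟨k, subset_tsupport _ (right_ne_zero_of_mul hk)⟩
  have hfc : ∀ K ∈ T.cells, HasCompactSupport (f K) := fun K hK =>
    HasCompactSupport.of_support_subset_isCompact
      (isCompact_iUnion fun k => (hb K hK k).2.1.isCompact) (hfs K)
  have hft : ∀ K ∈ T.cells, tsupport (f K) ⊆ interior (cell K) := fun K hK =>
    (closure_minimal (hfs K) (isClosed_iUnion_of_finite fun k => isClosed_tsupport _)).trans
      (iUnion_subset fun k => (hb K hK k).2.2)
  have hφ1 : ContDiff ℝ ∞ fun x => ∑ K ∈ T.cells, f K x := ContDiff.sum fun K hK => hf1 K hK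
  have hφs : (fun x => ∑ K ∈ T.cells, f K x).support ⊆ ⋃ K ∈ T.cells, tsupport (f K) := by
    intro x hx
    obtain ⟨K, hK, hKx⟩ := Finset.exists_ne_zero_of_sum_ne_zero hx
    exact mem_iUnion₂.2 ⟨K, hK, subset_tsupport _ hKx⟩
  have hφcomp : IsCompact (⋃ K ∈ T.cells, tsupport (f K)) :=
    T.cells.isCompact_biUnion fun K hK => (hfc K hK).isCompact
  obtain ⟨B, -, -, -, hB1, hB2⟩ := H10.exists_isTest (Ω := Ω) hφ1
    (HasCompactSupport.of_support_subset_isCompact hφcomp hφs)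
    ((closure_minimal hφs hφcomp.isClosed).trans (iUnion₂_subset fun K hK =>
      (hft K hK).trans (T.interior_cell_subset hΩ hK)))
  -- Bubbles of the other elements have compact support in their open elements, so near every point
  -- of the closed element K only the part `f K` survives.
  have hloc : ∀ K ∈ T.cells, ∀ x ∈ cell K, (fun x => ∑ K ∈ T.cells, f K x) =ᶠ[𝓝 x] f K := by
    intro K hK x hx
    have : ∀ᶠ y in 𝓝 x, ∀ K' ∈ T.cells, K' ≠ K → f K' y = 0 := by
      refine (Filter.eventually_all_finset T.cells).2 fun K' hK' => ?_
      by_cases hne : K' = K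
      · exact Eventually.of_forall fun y h => absurd hne h
      · have : x ∉ tsupport (f K') := fun h =>
          Set.disjoint_left.1 (T.disjoint_interior_cell hK' hK hne) (hft K' hK' h) hx
        filter_upwards [notMem_tsupport_iff_eventuallyEq.1 this] with y hy _ using hy
    filter_upwards [this] with y hy
    exact Finset.sum_eq_single K (fun K' hK' hne => hy K' hK' hne) fun h => absurd hK h
  have hBK : ∀ K ∈ T.cells, ∀ᵐ x ∂(volume.restrict Ω), x ∈ cell K →
      H10.toL2 B x = f K x ∧ H10.grad B x = ∇ (f K) x := by
    intro K hK
    filter_upwards [hB1, hB2] with x h1 h2 hx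
    refine ⟨h1.trans (hloc K hK x hx).eq_of_nhds, h2.trans ?_⟩
    simp only [gradient, (hloc K hK x hx).fderiv_eq]
  have hint : ∀ K ∈ T.cells, ∀ k (w : L2 Ω), IntegrableOn (fun x => ρ K k x * w x) (cell K)
      (volume.restrict Ω) := by
    intro K hK k w
    obtain ⟨q, -, hq⟩ := hρq K hK k
    simp only [← hq]
    exact integrableOn_eval_mul K q w
  have hsum : ∀ K ∈ T.cells, ∀ (c : MultiIndex d p → ℝ) (w : L2 Ω),
      ∫ x in cell K, (∑ k, c k * ρ K k x) * w x ∂(volume.restrict Ω) =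
      ∑ k, c k * ∫ x in cell K, ρ K k x * w x ∂(volume.restrict Ω) := by
    intro K hK c w
    simp only [Finset.sum_mul, mul_assoc]
    rw [integral_finsetSum _ fun k _ => (hint K hK k w).const_mul (c k)]
    exact Finset.sum_congr rfl fun k _ => integral_const_mul _ _
  refine ⟨B, ?_, ?_, ?_⟩
  · intro K hK q hq
    obtain ⟨c, hc⟩ := hqρ K hK q hq
    simp only [hc]
    rw [hsum K hK, hsum K hK]
    refine Finset.sum_congr rfl fun j _ => congrArg _ ?_
    have z : ∀ x, x ∉ interior (cell K) → f K x = 0 := fun x hx =>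
      image_eq_zero_of_notMem_tsupport fun h => hx (hft K hK h)
    have e1 : ∫ x in cell K, ρ K j x * H10.toL2 B x ∂(volume.restrict Ω) =
        ∫ x in cell K, ρ K j x * f K x ∂(volume.restrict Ω) := by
      refine integral_congr_ae ?_
      filter_upwards [ae_restrict_of_ae (hBK K hK), ae_restrict_mem (measurableSet_cell K)]
        with x hx hxK
      rw [(hx hxK).1]
    rw [e1, setIntegral_of_eq_zero (measurableSet_cell K) fun x hx => by
        rw [z x fun h => hx (T.interior_cell_subset hΩ hK h), mul_zero],
      setIntegral_eq_integral_of_forall_compl_eq_zero fun x hx => by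
        rw [z x fun h => hx (interior_subset h), mul_zero]]
    have ib : ∀ k, Integrable fun x => γ K k * (b K k x * ρ K j x) := by
      intro k
      obtain ⟨q, -, hq⟩ := hρq K hK j
      have hcont : Continuous (ρ K j) := by
        have : ρ K j = fun x => MvPolynomial.eval (fun i => x i) q := funext fun x => (hq x).symm
        rw [this]
        exact (MvPolynomial.continuous_eval q).comp (by fun_prop)
      exact (((hb K hK k).1.continuous.mul hcont).integrable_of_hasCompactSupport
        (hb K hK k).2.1.mul_right).const_mul _
    have e2 : ∀ x, ρ K j x * f K x = ∑ k, γ K k * (b K k x * ρ K j x) := fun x => by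
      simp only [f, Finset.mul_sum]
      exact Finset.sum_congr rfl fun k _ => by ring
    simp only [e2]
    rw [integral_finsetSum _ fun k _ => ib k]
    simp only [integral_const_mul, hdual K hK]
    simp only [mul_ite, mul_zero, Finset.sum_ite_eq', Finset.mem_univ, if_true, γ]
    have := (hm K hK).ne'
    field_simp
  · intro K hK
    set X := ∫ x in cell K, H10.toL2 u x ^ 2 ∂(volume.restrict Ω) with hX
    have hX0 : 0 ≤ X := integral_nonneg fun x => sq_nonneg _
    have hmK := hm K hK
    have hcomp : IsCompact (cell K) := Metric.isCompact_of_isClosed_isBounded (isClosed_cell K)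
      (isBounded_cell K)
    have hfin : (volume.restrict Ω) (cell K) ≠ ⊤ :=
      ((Measure.restrict_apply_le _ _).trans_lt hcomp.measure_lt_top).ne
    have hv : (volume.restrict Ω).real (cell K) ≤ C * m K :=
      (ENNReal.toReal_mono hcomp.measure_lt_top.ne (Measure.restrict_apply_le _ _)).trans
        (hvol K hK)
    have hγ : ∀ k, γ K k ^ 2 ≤ C * X / m K := by
      intro k
      obtain ⟨q, -, hq⟩ := hρq K hK k
      have mρ : MemLp (ρ K k) 2 ((volume.restrict Ω).restrict (cell K)) := by
        have : ρ K k = fun x => MvPolynomial.eval (fun i => x i) q := funext fun x => (hq x).symm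
        rw [this]
        exact (memLp_indicator_iff_restrict (measurableSet_cell K)).1 (memLp_eval_cell K q)
      have hcs := sq_integral_mul_le mρ ((Lp.memLp (H10.toL2 u)).restrict (cell K))
      have hρ2 : ∫ x in cell K, ρ K k x ^ 2 ∂(volume.restrict Ω) ≤ C * m K := by
        refine le_trans ?_ hv
        have : ∫ x in cell K, (1 : ℝ) ∂(volume.restrict Ω) = (volume.restrict Ω).real (cell K) := by
          simp
        rw [← this]
        refine setIntegral_mono_on mρ.integrable_sq (integrableOn_const hfin)
          (measurableSet_cell K) fun x hx => ?_
        rw [← sq_abs]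
        exact pow_le_one₀ (abs_nonneg _) (hρ K hK k x hx)
      have h2 : (∫ x in cell K, ρ K k x * H10.toL2 u x ∂(volume.restrict Ω)) ^ 2 ≤ C * m K * X :=
        hcs.trans (mul_le_mul_of_nonneg_right hρ2 hX0)
      simp only [γ]
      rw [mul_pow]
      calc _ ≤ (m K)⁻¹ ^ 2 * (C * m K * X) := mul_le_mul_of_nonneg_left h2 (by positivity)
        _ = _ := by field_simp
    set N : ℝ := ((Fintype.card (MultiIndex d p) : ℕ) : ℝ) with hN
    have hpt : ∀ᵐ x ∂((volume.restrict Ω).restrict (cell K)), ‖H10.grad B x‖ ^ 2 ≤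
        (C / h) ^ 2 * (N * (N * (C * X / m K))) := by
      filter_upwards [ae_restrict_of_ae (hBK K hK), ae_restrict_mem (measurableSet_cell K)]
        with x hx hxK
      rw [(hx hxK).2, norm_gradient]
      have hd : HasFDerivAt (f K) (∑ k, γ K k • fderiv ℝ (b K k) x) x :=
        HasFDerivAt.fun_sum fun k _ =>
          (((hb K hK k).1.differentiable (by simp) x).hasFDerivAt).const_mul (γ K k)
      rw [hd.fderiv]
      have h1 : ‖∑ k, γ K k • fderiv ℝ (b K k) x‖ ≤ C / h * ∑ k, |γ K k| := by
        rw [Finset.mul_sum]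
        refine (norm_sum_le _ _).trans (Finset.sum_le_sum fun k _ => ?_)
        rw [norm_smul, mul_comm, Real.norm_eq_abs]
        exact mul_le_mul_of_nonneg_right (hgrad K hK k x) (abs_nonneg _)
      have h2 : (∑ k, |γ K k|) ^ 2 ≤ N * (N * (C * X / m K)) := by
        have h3 := sq_sum_le_card_mul_sum_sq (s := Finset.univ) (f := fun k => |γ K k|)
        refine h3.trans ?_
        rw [Finset.card_univ]
        refine mul_le_mul_of_nonneg_left ?_ (by positivity)
        have := Finset.sum_le_card_nsmul Finset.univ (fun k => |γ K k| ^ 2) (C * X / m K)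
          fun k _ => by rw [sq_abs]; exact hγ k
        rwa [Finset.card_univ, nsmul_eq_mul] at this
      calc _ ≤ (C / h * ∑ k, |γ K k|) ^ 2 := pow_le_pow_left₀ (norm_nonneg _) h1 2
        _ = (C / h) ^ 2 * (∑ k, |γ K k|) ^ 2 := mul_pow _ _ _
        _ ≤ _ := mul_le_mul_of_nonneg_left h2 (sq_nonneg _)
    have hle := integral_mono_ae ((integrable_norm_sq (H10.grad B)).integrableOn (s := cell K))
      (integrableOn_const hfin) hpt
    refine hle.trans ?_
    rw [setIntegral_const, smul_eq_mul]
    calc _ ≤ (C * m K) * ((C / h) ^ 2 * (N * (N * (C * X / m K)))) :=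
          mul_le_mul_of_nonneg_right hv (by positivity)
      _ = _ := by field_simp
  · intro K hK h0
    have hγ0 : ∀ k, γ K k = 0 := by
      intro k
      obtain ⟨q, hq, hqe⟩ := hρq K hK k
      have := h0 q hq
      simp only [hqe] at this
      simp only [γ, this, mul_zero]
    have hf0 : f K = fun _ => 0 := by
      funext x
      simp only [f, hγ0, zero_mul, Finset.sum_const_zero]
    filter_upwards [hBK K hK] with x hx hxK
    obtain ⟨h1, h2⟩ := hx hxK
    rw [h1, h2, hf0]
    exact ⟨rfl, by simp [gradient]⟩

/-! ### Localization inside the kernel -/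

/-- Localization in `W`: a function in `W` can be set to zero on the elements in `I` and kept away
from them, at the cost of a constant in the gradient norm on every element. -/
theorem exists_localization (d p : ℕ) (r : ℝ) : ∃ C : ℝ, 0 ≤ C ∧
    ∀ (Ω : Set (EuclideanSpace ℝ (Fin d))) (_ : IsLipschitzDomain Ω) (T : Mesh Ω) (h : ℝ)
    (_ : 0 < h) (_ : ∀ K ∈ T.cells, ∀ i, h ≤ K.upper i - K.lower i)
    (_ : ∀ K ∈ T.cells, Metric.diam (cell K) ≤ r * h)
    (I : Finset (BoxIntegral.Box (Fin d))) (_ : I ⊆ T.cells) (z : H10 Ω) (_ : z ∈ T.kerProj p),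
    ∃ w ∈ T.kerProj p,
      (∀ K ∈ I, ∀ᵐ x ∂(volume.restrict Ω), x ∈ cell K → H10.toL2 w x = 0 ∧ H10.grad w x = 0) ∧
      (∀ K ∈ T.cells, K ∉ T.layer I → ∀ᵐ x ∂(volume.restrict Ω), x ∈ cell K →
        H10.toL2 w x = H10.toL2 z x ∧ H10.grad w x = H10.grad z x) ∧
      ∀ K ∈ T.cells, ∫ x in cell K, ‖H10.grad w x‖ ^ 2 ∂(volume.restrict Ω) ≤
        C * ∫ x in cell K, ‖H10.grad z x‖ ^ 2 ∂(volume.restrict Ω) := by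
  obtain ⟨C₁, hC₁, hcut⟩ := exists_cutoff d
  obtain ⟨C₂, hC₂, hcorr⟩ := exists_corrector d p
  -- The terms come from μ∇z, z∇μ and ∇b. In the last two the factor 1 / h² meets the Poincaré
  -- constant 2^d (r h)², so h drops out.
  refine ⟨4 + (4 * C₁ ^ 2 + 2 * C₂) * (2 ^ d * r ^ 2), by positivity, ?_⟩
  intro Ω hΩ T h hh hside hdiam I hI z hz
  obtain ⟨μ, hμ, hμ01, hμ0, hμ1, hμd⟩ := hcut Ω hΩ.isOpen T h hh hside I hI
  obtain ⟨y, hy, hy'⟩ := H10.exists_mul hΩ.isOpen hμ (M := 1)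
    (fun x _ => by rw [abs_of_nonneg (hμ01 x).1]; exact (hμ01 x).2) hμd z
  obtain ⟨b, hbq, hbn, hb0⟩ := hcorr Ω hΩ T h hh hside y
  have hzq := (T.mem_kerProj_iff hΩ.isOpen p z).1 hz
  have hΩm := ae_mem_of_isOpen hΩ.isOpen
  have hwv : H10.toL2 (y - b) =ᵐ[volume.restrict Ω] fun x => H10.toL2 y x - H10.toL2 b x := by
    rw [map_sub]; exact Lp.coeFn_sub _ _
  have hwg : H10.grad (y - b) =ᵐ[volume.restrict Ω] fun x => H10.grad y x - H10.grad b x := by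
    rw [map_sub]; exact Lp.coeFn_sub _ _
  -- Where the cutoff attains an extreme value 0 or 1 its gradient vanishes; this holds on closed
  -- elements, boundary points included.
  have hg0 : ∀ x, μ x = 0 → ∇ μ x = 0 := by
    intro x hx
    have : IsLocalMin μ x := Eventually.of_forall fun y => by rw [hx]; exact (hμ01 y).1
    simp [gradient, this.fderiv_eq_zero]
  have hg1 : ∀ x, μ x = 1 → ∇ μ x = 0 := by
    intro x hx
    have : IsLocalMax μ x := Eventually.of_forall fun y => by rw [hx]; exact (hμ01 y).2
    simp [gradient, this.fderiv_eq_zero]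
  refine ⟨y - b, ?_, ?_, ?_, ?_⟩
  · rw [T.mem_kerProj_iff hΩ.isOpen]
    intro K hK q hq
    rw [← sub_eq_zero.2 (hbq K hK q hq).symm, ← integral_sub (integrableOn_eval_mul K q _)
      (integrableOn_eval_mul K q _)]
    refine integral_congr_ae (ae_restrict_of_ae ?_)
    filter_upwards [hwv] with x hx
    rw [hx]; ring
  · intro K hK
    have hyK : ∀ᵐ x ∂(volume.restrict Ω), x ∈ cell K → H10.toL2 y x = 0 ∧ H10.grad y x = 0 := by
      filter_upwards [hy, hy'] with x h1 h2 hx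
      rw [h1, h2, hμ0 K hK x hx, hg0 x (hμ0 K hK x hx)]
      simp
    -- On I the product y is zero, so its moments vanish and no correction is added.
    have hbK := hb0 K (hI hK) fun q _ => by
      refine integral_eq_zero_of_ae ?_
      filter_upwards [ae_restrict_of_ae hyK, ae_restrict_mem (measurableSet_cell K)] with x h1 hx
      rw [(h1 hx).1]; simp
    filter_upwards [hyK, hbK, hwv, hwg] with x h1 h2 h3 h4 hx
    rw [h3, h4, (h1 hx).1, (h1 hx).2, (h2 hx).1, (h2 hx).2]
    simp
  · intro K hK hKn
    have hyK : ∀ᵐ x ∂(volume.restrict Ω), x ∈ cell K →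
        H10.toL2 y x = H10.toL2 z x ∧ H10.grad y x = H10.grad z x := by
      filter_upwards [hy, hy'] with x h1 h2 hx
      rw [h1, h2, hμ1 K hK hKn x hx, hg1 x (hμ1 K hK hKn x hx)]
      simp
    -- Here y = z, whose moments vanish because z is in W; again no correction is added.
    have hbK := hb0 K hK fun q hq => by
      rw [← hzq K hK q hq]
      refine integral_congr_ae ?_
      filter_upwards [ae_restrict_of_ae hyK, ae_restrict_mem (measurableSet_cell K)] with x h1 hx
      rw [(h1 hx).1]
    filter_upwards [hyK, hbK, hwv, hwg] with x h1 h2 h3 h4 hx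
    rw [h3, h4, (h1 hx).1, (h1 hx).2, (h2 hx).1, (h2 hx).2]
    simp
  · intro K hK
    set Z := ∫ x in cell K, ‖H10.grad z x‖ ^ 2 ∂(volume.restrict Ω) with hZ
    have hZ0 : 0 ≤ Z := integral_nonneg fun x => sq_nonneg _
    have iz : IntegrableOn (fun x => ‖H10.grad z x‖ ^ 2) (cell K) (volume.restrict Ω) :=
      (integrable_norm_sq _).integrableOn
    have ib : IntegrableOn (fun x => ‖H10.grad b x‖ ^ 2) (cell K) (volume.restrict Ω) :=
      (integrable_norm_sq _).integrableOn
    have iw : IntegrableOn (fun x => ‖H10.grad (y - b) x‖ ^ 2) (cell K) (volume.restrict Ω) :=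
      (integrable_norm_sq _).integrableOn
    have sqi : ∀ u : L2 Ω, IntegrableOn (fun x => u x ^ 2) (cell K) (volume.restrict Ω) := fun u =>
      (Lp.memLp u).integrable_sq.integrableOn
    have hpoin : ∫ x in cell K, H10.toL2 z x ^ 2 ∂(volume.restrict Ω) ≤
        2 ^ d * (r * h) ^ 2 * Z := by
      refine H10.poincare K (fun x hx x' hx' => ?_) z ?_
      · rw [← dist_eq_norm]
        exact (Metric.dist_le_diam_of_mem (isBounded_cell K) hx' hx).trans (hdiam K hK)
      -- Testing against the constant 1, admissible for every p, gives the zero mean required by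
      -- Poincaré.
      · have := hzq K hK 1 (by
          rw [MvPolynomial.mem_restrictDegree]
          intro s hs i
          have hs' : s = 0 := by
            by_contra hne
            rw [MvPolynomial.mem_support_iff, MvPolynomial.coeff_one, if_neg (Ne.symm hne)] at hs
            exact hs rfl
          simp [hs'])
        simpa using this
    have hyz : ∫ x in cell K, H10.toL2 y x ^ 2 ∂(volume.restrict Ω) ≤
        ∫ x in cell K, H10.toL2 z x ^ 2 ∂(volume.restrict Ω) := by
      refine integral_mono_ae (sqi _) (sqi _) (ae_restrict_of_ae ?_)
      filter_upwards [hy] with x hx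
      rw [hx, mul_pow]
      exact mul_le_of_le_one_left (sq_nonneg _) (pow_le_one₀ (hμ01 x).1 (hμ01 x).2)
    have hb := hbn K hK
    have hpt : ∫ x in cell K, ‖H10.grad (y - b) x‖ ^ 2 ∂(volume.restrict Ω) ≤
        ∫ x in cell K, (4 * ‖H10.grad z x‖ ^ 2 + 4 * (C₁ / h) ^ 2 * H10.toL2 z x ^ 2 +
          2 * ‖H10.grad b x‖ ^ 2) ∂(volume.restrict Ω) := by
      refine integral_mono_ae iw (((iz.const_mul 4).add ((sqi (H10.toL2 z)).const_mul _)).add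
        (ib.const_mul 2)) (ae_restrict_of_ae ?_)
      filter_upwards [hwg, hy', hΩm] with x h1 h2 hx
      rw [h1, h2]
      have n1 : ‖μ x • H10.grad z x + H10.toL2 z x • ∇ μ x - H10.grad b x‖ ≤
          ‖H10.grad z x‖ + C₁ / h * |H10.toL2 z x| + ‖H10.grad b x‖ := by
        refine (norm_sub_le _ _).trans (add_le_add_left ((norm_add_le _ _).trans
          (add_le_add ?_ ?_)) _)
        · rw [norm_smul, Real.norm_eq_abs, abs_of_nonneg (hμ01 x).1]
          exact mul_le_of_le_one_left (norm_nonneg _) (hμ01 x).2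
        · rw [norm_smul, norm_gradient, mul_comm, Real.norm_eq_abs]
          exact mul_le_mul_of_nonneg_right (hμd x hx) (abs_nonneg _)
      have n2 := pow_le_pow_left₀ (norm_nonneg _) n1 2
      have n3 : (C₁ / h * |H10.toL2 z x|) ^ 2 = (C₁ / h) ^ 2 * H10.toL2 z x ^ 2 := by
        rw [mul_pow, sq_abs]
      -- (a + b + c)² ≤ 2(a + b)² + 2c² ≤ 4a² + 4b² + 2c².
      nlinarith [sq_nonneg (‖H10.grad z x‖ - C₁ / h * |H10.toL2 z x|),
        sq_nonneg (‖H10.grad z x‖ + C₁ / h * |H10.toL2 z x| - ‖H10.grad b x‖)]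
    refine hpt.trans ?_
    have i1 : IntegrableOn (fun x => 4 * ‖H10.grad z x‖ ^ 2 +
        4 * (C₁ / h) ^ 2 * H10.toL2 z x ^ 2) (cell K) (volume.restrict Ω) :=
      (iz.const_mul 4).add ((sqi (H10.toL2 z)).const_mul _)
    rw [integral_add i1 (ib.const_mul 2),
      integral_add (iz.const_mul 4) ((sqi (H10.toL2 z)).const_mul _), integral_const_mul,
      integral_const_mul, integral_const_mul, ← hZ]
    have e1 : 4 * (C₁ / h) ^ 2 * (2 ^ d * (r * h) ^ 2 * Z) = 4 * C₁ ^ 2 * (2 ^ d * r ^ 2) * Z := by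
      field_simp
    have e2 : C₂ / h ^ 2 * (2 ^ d * (r * h) ^ 2 * Z) = C₂ * (2 ^ d * r ^ 2) * Z := by
      field_simp
    have l1 := mul_le_mul_of_nonneg_left hpoin (by positivity : 0 ≤ 4 * (C₁ / h) ^ 2)
    have l2 := mul_le_mul_of_nonneg_left (hyz.trans hpoin) (by positivity : 0 ≤ C₂ / h ^ 2)
    rw [e1] at l1
    rw [e2] at l2
    linarith

/-! ### Exponential decay of the correctors -/

/-- The elements of the patch of order `ℓ` around the element `G`. -/
noncomputable def Mesh.patchCells (T : Mesh Ω) (G : BoxIntegral.Box (Fin d)) :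
    ℕ → Finset (BoxIntegral.Box (Fin d))
  | 0 => {G}
  | ℓ + 1 => T.layer (T.patchCells G ℓ)

section patchCells

variable (T : Mesh Ω) {G : BoxIntegral.Box (Fin d)}

theorem Mesh.patchCells_subset (hG : G ∈ T.cells) (ℓ : ℕ) : T.patchCells G ℓ ⊆ T.cells := by
  cases ℓ with
  | zero => simpa [Mesh.patchCells] using hG
  | succ ℓ => exact fun K hK => (mem_layer.1 hK).1

theorem Mesh.patchCells_subset_succ (hG : G ∈ T.cells) (ℓ : ℕ) :
    T.patchCells G ℓ ⊆ T.patchCells G (ℓ + 1) :=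
  subset_layer (T.patchCells_subset hG ℓ)

theorem Mesh.mem_patchCells (hG : G ∈ T.cells) (ℓ : ℕ) : G ∈ T.patchCells G ℓ := by
  induction ℓ with
  | zero => simp [Mesh.patchCells]
  | succ ℓ ih => exact T.patchCells_subset_succ hG ℓ ih

/-- Connects the patches as point sets, which define W(S), with the sets of elements on which
cutoffs and energies are indexed. -/
theorem Mesh.patch_eq (ℓ : ℕ) : T.patch (cell G) ℓ = ⋃ K ∈ T.patchCells G ℓ, cell K := by
  induction ℓ with
  | zero => simp [Mesh.patch, Mesh.patchCells, (isClosed_cell G).closure_eq]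
  | succ ℓ ih =>
    have hcl : closure (T.patch (cell G) ℓ) = ⋃ K ∈ T.patchCells G ℓ, cell K := by
      rw [(T.isClosed_patch _ _).closure_eq, ih]
    change T.nbhd (T.patch (cell G) ℓ) = ⋃ K ∈ T.layer (T.patchCells G ℓ), cell K
    unfold Mesh.nbhd
    ext x
    simp only [mem_iUnion, exists_prop, Mesh.mem_layer, hcl, mem_ofPred_eq, iUnion_inter,
      nonempty_iUnion]

end patchCells

/-! ### Elementwise energies and hole filling -/

/-- The energy of `u` on an element. -/
noncomputable def energy (u : H10 Ω) (K : BoxIntegral.Box (Fin d)) : ℝ :=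
  ∫ x in cell K, ‖H10.grad u x‖ ^ 2 ∂(volume.restrict Ω)

theorem energy_nonneg (u : H10 Ω) (K : BoxIntegral.Box (Fin d)) : 0 ≤ energy u K :=
  integral_nonneg fun _ => sq_nonneg _

open Classical in
/-- The energy of `u` on the elements that are not in `I`. -/
noncomputable def Mesh.energyOff (T : Mesh Ω) (I : Finset (BoxIntegral.Box (Fin d)))
    (u : H10 Ω) : ℝ :=
  ∑ K ∈ T.cells with K ∉ I, energy u K

theorem Mesh.sum_energy (T : Mesh Ω) (hΩ : IsOpen Ω) (u : H10 Ω) :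
    ∑ K ∈ T.cells, energy u K = ‖H10.grad u‖ ^ 2 := by
  rw [← real_inner_self_eq_norm_sq, L2.inner_def]
  simp only [real_inner_self_eq_norm_sq]
  exact (T.integral_eq_sum hΩ (integrable_norm_sq _)).symm

/-- Because the bound is local to each element and w has no gradient on I, the energy of z on I
never enters. -/
theorem Mesh.norm_grad_sq_le (T : Mesh Ω) (hΩ : IsOpen Ω)
    {I : Finset (BoxIntegral.Box (Fin d))} {w z : H10 Ω} {C : ℝ}
    (h0 : ∀ K ∈ I, ∀ᵐ x ∂(volume.restrict Ω), x ∈ cell K → H10.grad w x = 0)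
    (hC : ∀ K ∈ T.cells, energy w K ≤ C * energy z K) :
    ‖H10.grad w‖ ^ 2 ≤ C * T.energyOff I z := by
  classical
  rw [← T.sum_energy hΩ, Mesh.energyOff, Finset.mul_sum, Finset.sum_filter]
  refine Finset.sum_le_sum fun K hK => ?_
  by_cases h : K ∈ I
  · rw [if_neg (not_not.2 h)]
    refine le_of_eq (integral_eq_zero_of_ae ?_)
    filter_upwards [ae_restrict_of_ae (h0 K h), ae_restrict_mem (measurableSet_cell K)]
      with x hx hxK
    rw [hx hxK]; simp
  · rw [if_pos h]
    exact hC K hK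

/-- Allows the equations on a patch and on Ω to be subtracted. -/
theorem Coefficient.form_eq_univ {α β : ℝ} (A : Coefficient Ω α β)
    (S : Set (EuclideanSpace ℝ (Fin d))) (u w : H10 Ω)
    (h : ∀ᵐ x ∂(volume.restrict Ω), x ∉ S → H10.grad w x = 0) :
    A.form S u w = A.form univ u w := by
  unfold Coefficient.form
  rw [Measure.restrict_univ]
  refine setIntegral_eq_integral_of_ae_compl_eq_zero ?_
  filter_upwards [h] with x hx hxS
  rw [hx hxS]; simp

theorem Coefficient.form_univ_eq_sum {α β : ℝ} (A : Coefficient Ω α β) (T : Mesh Ω)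
    (hΩ : IsOpen Ω) (u w : H10 Ω) :
    A.form univ u w = ∑ K ∈ T.cells, A.form (cell K) u w := by
  unfold Coefficient.form
  rw [Measure.restrict_univ]
  exact T.integral_eq_sum hΩ (A.integrable_form u w)

/-- The energy outside of a patch is bounded by the energy in the outermost layer of elements. -/
theorem energy_outside_le {α β C : ℝ} (hΩ : IsOpen Ω) (A : Coefficient Ω α β) (hβ : 0 ≤ β)
    (T : Mesh Ω) {I J : Finset (BoxIntegral.Box (Fin d))} (hIJ : I ⊆ J) {z w : H10 Ω}
    (horth : A.form univ z w = 0)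
    (h0 : ∀ K ∈ I, ∀ᵐ x ∂(volume.restrict Ω), x ∈ cell K → H10.grad w x = 0)
    (h1 : ∀ K ∈ T.cells, K ∉ J → ∀ᵐ x ∂(volume.restrict Ω), x ∈ cell K →
      H10.grad w x = H10.grad z x)
    (hC : ∀ K ∈ T.cells, energy w K ≤ C * energy z K) :
    α * T.energyOff J z ≤
      β * (1 + C) / 2 * (T.energyOff I z -
        T.energyOff J z) := by
  classical
  rw [A.form_univ_eq_sum T hΩ] at horth
  have iu : ∀ (u : H10 Ω) K, IntegrableOn (fun x => ‖H10.grad u x‖ ^ 2) (cell K)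
      (volume.restrict Ω) := fun u K => (integrable_norm_sq _).integrableOn
  -- Three kinds of elements: on I the form is zero; on J \ I Young's inequality and the local bound
  -- on w give at least -β(1 + C)/2 times the energy of z; off J, w and z have equal gradients and
  -- coercivity applies. By orthogonality the sum of all contributions is zero.
  have key : ∀ K ∈ T.cells, α * (if K ∉ J then energy z K else 0) - β * (1 + C) / 2 *
      ((if K ∉ I then energy z K else 0) - (if K ∉ J then energy z K else 0)) ≤
      A.form (cell K) z w := by
    intro K hK
    by_cases hJ : K ∈ J
    · by_cases hI : K ∈ I
      · have : A.form (cell K) z w = 0 := by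
          refine integral_eq_zero_of_ae ?_
          filter_upwards [ae_restrict_of_ae (h0 K hI), ae_restrict_mem (measurableSet_cell K)]
            with x hx hxK
          rw [hx hxK]; simp
        simp [hI, hJ, this]
      · rw [if_neg (not_not.2 hJ), if_pos hI]
        have hle : ∫ x in cell K, (-(β / 2) * ‖H10.grad z x‖ ^ 2 + -(β / 2) * ‖H10.grad w x‖ ^ 2)
            ∂(volume.restrict Ω) ≤ A.form (cell K) z w := by
          refine integral_mono_ae (((iu z K).const_mul _).add ((iu w K).const_mul _))
            (A.integrable_form z w).integrableOn (ae_restrict_of_ae ?_)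
          filter_upwards [A.bounds] with x hx
          have hA : 0 ≤ A.toFun x := A.pos.le.trans hx.1
          have hin := neg_le_of_abs_le (abs_real_inner_le_norm (H10.grad z x) (H10.grad w x))
          have s1 : -(A.toFun x * (‖H10.grad z x‖ * ‖H10.grad w x‖)) ≤
              A.toFun x * inner ℝ (H10.grad z x) (H10.grad w x) := by
            rw [← mul_neg]; exact mul_le_mul_of_nonneg_left hin hA
          have s2 : A.toFun x * (‖H10.grad z x‖ * ‖H10.grad w x‖) ≤
              β * (‖H10.grad z x‖ * ‖H10.grad w x‖) :=
            mul_le_mul_of_nonneg_right hx.2 (by positivity)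
          have s3 := mul_nonneg hβ (sq_nonneg (‖H10.grad z x‖ - ‖H10.grad w x‖))
          nlinarith
        rw [integral_add ((iu z K).const_mul _) ((iu w K).const_mul _), integral_const_mul,
          integral_const_mul] at hle
        refine le_trans ?_ hle
        have h2 := mul_le_mul_of_nonneg_left (hC K hK) (by positivity : 0 ≤ β / 2)
        unfold energy at h2 ⊢
        linarith
    · have hI : K ∉ I := fun h => hJ (hIJ h)
      rw [if_pos hJ, if_pos hI, sub_self, mul_zero, sub_zero]
      unfold energy
      rw [← integral_const_mul]
      refine integral_mono_ae ((iu z K).const_mul _) (A.integrable_form z w).integrableOn ?_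
      filter_upwards [ae_restrict_of_ae (h1 K hK hJ), ae_restrict_of_ae A.bounds,
        ae_restrict_mem (measurableSet_cell K)] with x hx hA hxK
      rw [hx hxK, real_inner_self_eq_norm_sq]
      exact mul_le_mul_of_nonneg_right hA.1 (sq_nonneg _)
  have hs := Finset.sum_le_sum key
  rw [horth, Finset.sum_sub_distrib, ← Finset.mul_sum, ← Finset.mul_sum, Finset.sum_sub_distrib,
    ← Finset.sum_filter, ← Finset.sum_filter] at hs
  unfold Mesh.energyOff
  linarith

/-- The localized solution is quasi-optimal. -/
theorem norm_grad_sub_sq_le {α β : ℝ} (A : Coefficient Ω α β) (T : Mesh Ω) (p : ℕ)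
    {S : Set (EuclideanSpace ℝ (Fin d))} (hS : IsClosed S) (hΩ : IsOpen Ω)
    (G : BoxIntegral.Box (Fin d)) (v : L2 Ω) {y z w : H10 Ω}
    (hy : IsEnrichedCorrection A T p S G v y) (hz : IsEnrichedCorrection A T p (closure Ω) G v z)
    (hw : w ∈ T.kerProjOn p S) :
    α * ‖H10.grad (y - z)‖ ^ 2 ≤ β * ‖H10.grad (w - z)‖ ^ 2 := by
  have hΩm : ∀ᵐ x ∂(volume.restrict Ω), x ∈ closure Ω :=
    (ae_mem_of_isOpen hΩ).mono fun x hx => subset_closure hx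
  -- Galerkin orthogonality: W(S) is contained in W, and both problems have the same right-hand
  -- side.
  have horth : ∀ u ∈ T.kerProjOn p S, A.form univ (y - z) u = 0 := by
    intro u hu
    have hu' : u ∈ T.kerProjOn p (closure Ω) :=
      ⟨hu.1, hΩm.mono fun x hx hxn => absurd hx hxn⟩
    have e1 := hy.2 u hu
    have e2 := hz.2 u hu'
    rw [A.form_eq_univ S _ _ (H10.grad_eq_zero u hS hu.2)] at e1
    rw [A.form_eq_univ (closure Ω) _ _ (hΩm.mono fun x hx hxn => absurd hx hxn)] at e2
    have e3 : A.form univ (y - z) u = A.form univ y u - A.form univ z u :=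
      LinearMap.map_sub₂ (A.bilinForm univ) y z u
    rw [e3, e1, e2, sub_self]
  have h1 : A.form univ (y - z) (y - z) = A.form univ (y - z) (w - z) := by
    have h2 := horth (y - w) ((T.kerProjOn p S).sub_mem hy.1 hw)
    have h3 : A.form univ (y - z) (y - w) =
        A.form univ (y - z) (y - z) - A.form univ (y - z) (w - z) := by
      rw [← sub_sub_sub_cancel_right y w z]
      exact (A.bilinForm univ (y - z)).map_sub _ _
    linarith
  have hcs : A.form univ (y - z) (w - z) * A.form univ (w - z) (y - z) ≤
      A.form univ (y - z) (y - z) * A.form univ (w - z) (w - z) :=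
    LinearMap.BilinForm.apply_mul_apply_le_of_forall_zero_le (A.bilinForm univ)
      (A.form_self_nonneg univ) _ _
  rw [A.form_comm univ (w - z) (y - z), ← h1] at hcs
  refine (A.le_form_self univ (y - z) isClosed_univ
    (Eventually.of_forall fun x hx => absurd (mem_univ x) hx)).trans
    (le_trans ?_ (A.form_self_le univ (w - z)))
  -- Cauchy–Schwarz gives a(e, e)² ≤ a(e, e) a(w - z, w - z) for e = y - z; division needs a(e, e) >
  -- 0, and the other case is trivial.
  rcases (A.form_self_nonneg univ (y - z)).eq_or_lt with h0 | h0
  · rw [← h0]; exact A.form_self_nonneg univ (w - z)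
  · exact le_of_mul_le_mul_left hcs h0

/-- Take h = diam G / (τσ) for any one element G. Quasi-uniformity compares all diameters with diam
G, and shape regularity compares sides with diameters. The signs of σ and τ follow from the
existence of an element, whose diameter is positive as d ≥ 1. -/
theorem Mesh.exists_uniform_size [NeZero d] (T : Mesh Ω) {σ τ : ℝ} (hσ : T.IsShapeRegular σ)
    (hτ : T.IsQuasiUniform τ) (hne : T.cells.Nonempty) : ∃ h : ℝ, 0 < h ∧
      (∀ K ∈ T.cells, ∀ i, h ≤ K.upper i - K.lower i) ∧
      ∀ K ∈ T.cells, Metric.diam (cell K) ≤ τ ^ 2 * σ * h := by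
  obtain ⟨G, hG⟩ := hne
  have hD : 0 < Metric.diam (cell G) := by
    refine Metric.diam_pos ?_ (isBounded_cell G)
    refine ⟨WithLp.toLp 2 G.lower, fun i => ⟨le_rfl, G.lower_le_upper i⟩, WithLp.toLp 2 G.upper,
      fun i => ⟨G.lower_le_upper i, le_rfl⟩, fun h => ?_⟩
    have := congrFun (congrArg WithLp.ofLp h) 0
    exact (G.lower_lt_upper 0).ne this
  have hσ0 : 0 < σ := by
    have := hσ G hG 0
    exact pos_of_mul_pos_left (hD.trans_le this) (side_pos G 0).le
  have hτ0 : 0 < τ := pos_of_mul_pos_left (hD.trans_le (hτ G hG G hG)) hD.le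
  refine ⟨Metric.diam (cell G) / (τ * σ), by positivity, fun K hK i => ?_, fun K hK => ?_⟩
  · rw [div_le_iff₀ (by positivity)]
    calc _ ≤ τ * Metric.diam (cell K) := hτ K hK G hG
      _ ≤ τ * (σ * (K.upper i - K.lower i)) := mul_le_mul_of_nonneg_left (hσ K hK i) hτ0.le
      _ = _ := by ring
  · refine (hτ G hG K hK).trans (le_of_eq ?_)
    field_simp

end LOD

/-! ### Assembly of the decay estimate -/

theorem mainTheorem5 {d : ℕ} [NeZero d] (Ω : Set (EuclideanSpace ℝ (Fin d)))
    (hΩ : LOD.IsLipschitzDomain Ω) (p : ℕ) (α β σ τ : ℝ) :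
    ∃ C₀ > 0, ∃ C > 0, ∀ (A : LOD.Coefficient Ω α β) (T : LOD.Mesh Ω),
      T.IsShapeRegular σ → T.IsQuasiUniform τ →
      ∀ G ∈ T.cells, ∀ ℓ : ℕ, 1 ≤ ℓ → ∀ v : LOD.L2 Ω,
        ‖LOD.H10.grad (LOD.localEnrichedCorrector A T p G ℓ v - LOD.enrichedCorrector A T p G v)‖
          ≤ C₀ * Real.exp (-(C * ℓ)) * ‖LOD.H10.grad (LOD.enrichedCorrector A T p G v)‖ := by
  classical
  -- The constants are fixed before the coefficient. If the bounds are inconsistent no coefficient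
  -- exists, since Ω has positive measure, and any constants serve.
  by_cases hαβ : ¬ (0 < α ∧ α ≤ β)
  · refine ⟨1, one_pos, 1, one_pos, fun A => absurd ⟨A.pos, ?_⟩ hαβ⟩
    have : (ae (volume.restrict Ω)).NeBot := by
      rw [ae_neBot, Ne, Measure.restrict_eq_zero]
      exact (hΩ.isOpen.measure_pos volume hΩ.isConnected.nonempty).ne'
    obtain ⟨x, h1, h2⟩ := A.bounds.exists
    exact h1.trans h2
  obtain ⟨hα, hαβ⟩ := not_not.1 hαβ
  have hβ : 0 < β := hα.trans_le hαβ
  obtain ⟨M, hM0, hM⟩ := LOD.exists_localization d p (τ ^ 2 * σ)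
  -- Hole filling reads R (k + 1) ≤ c (R k - R (k + 1)), which rearranges to the contraction factor
  -- c / (1 + c).
  set c : ℝ := β * (1 + M) / 2 / α with hc
  have hc0 : 0 < c := by positivity
  set θ : ℝ := c / (1 + c) with hθ
  have hθ0 : 0 < θ := by positivity
  have hθ1 : θ < 1 := by rw [hθ, div_lt_one (by positivity)]; linarith
  -- The squared error is at most (β / α) M θ^(ℓ - 1) ‖∇z‖². Division by θ absorbs the lost layer,
  -- the logarithm is halved by the square root, and M + 1 instead of M keeps the constant positive.
  refine ⟨Real.sqrt (β / α * (M + 1) / θ), by positivity, -Real.log θ / 2,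
    by linarith [Real.log_neg hθ0 hθ1], ?_⟩
  intro A T hσ hτ G hG ℓ hℓ v
  obtain ⟨h, hh, hside, hdiam⟩ := T.exists_uniform_size hσ hτ ⟨G, hG⟩
  set z := LOD.enrichedCorrector A T p G v with hz
  have hzs := LOD.enrichedCorrector_spec A T p G v
  have hys := LOD.localEnrichedCorrector_spec A T p G ℓ v
  have hΩm : ∀ᵐ x ∂(volume.restrict Ω), x ∈ closure Ω :=
    (LOD.ae_mem_of_isOpen hΩ.isOpen).mono fun x hx => subset_closure hx
  let R : ℕ → ℝ := fun k => T.energyOff (T.patchCells G k) z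
  have hloc := fun k => hM Ω hΩ T h hh hside hdiam (T.patchCells G k) (T.patchCells_subset hG k) z
    hzs.1.1
  have hstep : ∀ k, R (k + 1) ≤ θ * R k := by
    intro k
    obtain ⟨w, hw, hw0, hw1, hwC⟩ := hloc k
    have horth : A.form univ z w = 0 := by
      have hw' : w ∈ T.kerProjOn p (closure Ω) := ⟨hw, hΩm.mono fun x hx hxn => absurd hx hxn⟩
      rw [← A.form_eq_univ (closure Ω) _ _ (hΩm.mono fun x hx hxn => absurd hx hxn),
        hzs.2 w hw', neg_eq_zero]
      -- The right-hand side only sees G, which belongs to every patch and on which w vanishes.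
      refine integral_eq_zero_of_ae ?_
      filter_upwards [ae_restrict_of_ae (hw0 G (T.mem_patchCells hG k)),
        ae_restrict_mem (LOD.measurableSet_cell G)] with x hx hxG
      rw [(hx hxG).1]; simp
    have h1 := LOD.energy_outside_le hΩ.isOpen A hβ.le T (T.patchCells_subset_succ hG k) horth
      (fun K hK => (hw0 K hK).mono fun x hx hxK => (hx hxK).2)
      (fun K hK hKn => (hw1 K hK hKn).mono fun x hx hxK => (hx hxK).2) hwC
    have h2 : α * R (k + 1) ≤ β * (1 + M) / 2 * (R k - R (k + 1)) := h1
    have h3 : R (k + 1) ≤ c * (R k - R (k + 1)) := by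
      rw [hc, div_mul_eq_mul_div, le_div_iff₀ hα]
      linarith
    rw [hθ, div_mul_eq_mul_div, le_div_iff₀ (by positivity)]
    linarith
  have hR : ∀ k, R k ≤ θ ^ k * ‖LOD.H10.grad z‖ ^ 2 := by
    intro k
    induction k with
    | zero =>
      rw [pow_zero, one_mul, ← T.sum_energy hΩ.isOpen]
      exact Finset.sum_le_sum_of_subset_of_nonneg (Finset.filter_subset _ _)
        fun K _ _ => LOD.energy_nonneg z K
    | succ k ih =>
      refine (hstep k).trans ?_
      rw [pow_succ', mul_assoc]
      exact mul_le_mul_of_nonneg_left ih hθ0.le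
  -- One layer is spent on the transition: localizing at order ℓ - 1 gives w = z outside the patch
  -- of order ℓ, so z - w is an admissible competitor in W(N^ℓ(G)).
  obtain ⟨k, rfl⟩ : ∃ k, ℓ = k + 1 := ⟨ℓ - 1, by omega⟩
  obtain ⟨w, hw, hw0, hw1, hwC⟩ := hloc k
  have hwS : z - w ∈ T.kerProjOn p (T.patch (LOD.cell G) (k + 1)) := by
    refine ⟨Submodule.sub_mem _ hzs.1.1 hw, ?_⟩
    have hall : ∀ᵐ x ∂(volume.restrict Ω), ∀ K ∈ T.cells, K ∉ T.patchCells G (k + 1) →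
        x ∈ LOD.cell K → LOD.H10.toL2 w x = LOD.H10.toL2 z x := by
      refine (Filter.eventually_all_finset T.cells).2 fun K hK => ?_
      by_cases hKn : K ∈ T.patchCells G (k + 1)
      · exact Eventually.of_forall fun x hx => absurd hKn hx
      · exact (hw1 K hK hKn).mono fun x hx _ hxK => (hx hxK).1
    have hsub : LOD.H10.toL2 (z - w) =ᵐ[volume.restrict Ω]
        fun x => LOD.H10.toL2 z x - LOD.H10.toL2 w x := by
      rw [map_sub]; exact Lp.coeFn_sub _ _
    filter_upwards [hall, hsub, LOD.ae_mem_of_isOpen hΩ.isOpen] with x h1 h2 hx hxn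
    obtain ⟨K, hK, hxK⟩ := T.exists_cell hx
    rw [h2, h1 K hK (fun hKp => hxn ?_) hxK, sub_self]
    rw [T.patch_eq]
    exact mem_iUnion₂.2 ⟨K, hKp, hxK⟩
  have hquasi := LOD.norm_grad_sub_sq_le A T p (T.isClosed_patch _ _) hΩ.isOpen G v hys hzs hwS
  have hwn : ‖LOD.H10.grad (z - w - z)‖ = ‖LOD.H10.grad w‖ := by
    rw [sub_sub_cancel_left, map_neg, norm_neg]
  have hwR : ‖LOD.H10.grad w‖ ^ 2 ≤ M * R k :=
    T.norm_grad_sq_le hΩ.isOpen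
      (fun K hK => (hw0 K hK).mono fun x hx hxK => (hx hxK).2) hwC
  rw [← hz, hwn] at hquasi
  refine le_of_sq_le_sq ?_ (by positivity)
  have hexp : Real.exp (-(-Real.log θ / 2 * ((k + 1 : ℕ) : ℝ))) ^ 2 = θ ^ (k + 1) := by
    rw [← Real.exp_nat_mul, ← Real.exp_log (pow_pos hθ0 (k + 1)), Real.log_pow]
    congr 1
    push_cast
    ring
  rw [mul_pow, mul_pow, hexp, Real.sq_sqrt (by positivity)]
  calc _ ≤ β * ‖LOD.H10.grad w‖ ^ 2 / α := by rw [le_div_iff₀ hα]; linarith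
    _ ≤ β * ((M + 1) * (θ ^ k * ‖LOD.H10.grad z‖ ^ 2)) / α := by
        gcongr
        refine hwR.trans ((mul_le_mul_of_nonneg_left (hR k) hM0).trans ?_)
        exact mul_le_mul_of_nonneg_right (by linarith) (by positivity)
    _ = _ := by field_simp; ring
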